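/- Let $n\ge 1$. Let $\mathbb{RP}^{2n-1}=S^{2n-1}/\{\pm1\}$ carry the contact form $\alpha_0$ induced by the restriction to $S^{2n-1}$ of $\lambda_0=\frac12\sum_{j=1}^n(x_j\,dy_j-y_j\,dx_j)$, and let $\xi_{\mathrm{st}}=\ker\alpha_0$, co-oriented by $\alpha_0$. Let $\mathrm{Cont}(\mathbb{RP}^{2n-1},\xi_{\mathrm{st}})$ be the group of diffeomorphisms preserving $\xi_{\mathrm{st}}$ with its co-orientation, $\mathrm{Cont}_0$ its identity component, and $G=\widetilde{\mathrm{Cont}}_0(\mathbb{RP}^{2n-1},\xi_{\mathrm{st}})$ the universal cover of $\mathrm{Cont}_0$, i.e. the group of homotopy classes with fixed end-points of smooth paths $[0,1]\to\mathrm{Cont}(\mathbb{RP}^{2n-1},\xi_{\mathrm{st}})$ starting at $\mathrm{id}$. A smooth path in $G$ projects to a smooth path $\phi^t$ of contactomorphisms, generated by contact vector fields $X_t$ through $\frac{d}{dt}\phi^t=X_t(\phi^t)$; the path is called non-negative if $\alpha_0(X_t)\ge0$ everywhere on $\mathbb{RP}^{2n-1}$ for all $t\in[0,1]$, and somewhere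 positive if for some $t\in[0,1]$ one has $\alpha_0(X_t)>0$ everywhere on $\mathbb{RP}^{2n-1}$. Write $\phi_0\le\phi_1$ if there is a non-negative path in $G$ from $\phi_0$ to $\phi_1$. Let $d:G\times G\to[0,+\infty]$ be a function such that: (i) $d(\phi_0,\phi_1)>0$ if and only if there is a non-negative and somewhere positive path from $\phi_0$ to $\phi_1$; (ii) $d(\phi_0,\phi_2)\ge d(\phi_0,\phi_1)+d(\phi_1,\phi_2)$ whenever $\phi_0\le\phi_1\le\phi_2$; (iii) $d$ is bi-invariant, i.e. $d(\psi\phi_0,\psi\phi_1)=d(\phi_0,\phi_1)=d(\phi_0\psi,\phi_1\psi)$ for all $\psi,\phi_0,\phi_1\in G$. Then $d(\phi_0,\phi_1)=+\infty$ if there is a non-negative and somewhere positive path from $\phi_0$ to $\phi_1$, and $d(\phi_0,\phi_1)=0$ otherwise. In particular, this dichotomy holds for the Lorentz distance $\mathrm{dist}_V(\phi_0,\phi_1)=\sup\int_0^1V(X_t)\,dt$, where the supremum is over all non-negative paths in $G$ from $\phi_0$ to $\phi_1$ and is $0$ if there is none. Here, for a contact vector field $X$ with $\alpha_0(X)>0$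 everywhere, $V(X)=\big(\int_{\mathbb{RP}^{2n-1}}\beta\wedge(d\beta)^{n-1}\big)^{-1/n}$, where $\beta=\alpha_0(X)^{-1}\alpha_0$ is the contact form defining the co-oriented structure $\xi_{\mathrm{st}}$ whose Reeb vector field is $X$, the integral being taken with respect to the orientation given by the volume form $\beta\wedge(d\beta)^{n-1}$; and $V(X)=0$ for the other contact vector fields with $\alpha_0(X)\ge0$. So $\mathrm{dist}_V$ takes only the values $0$ and $+\infty$. -/

import Mathlib

open scoped Manifold ContDiff ENNReal RealInnerProductSpace
open Set Metric

noncomputable section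

/-! ### Contactomorphisms, contact isotopies and the universal cover -/

section Contact

variable {F : Type*} [NormedAddCommGroup F] [NormedSpace ℝ F] {H : Type*} [TopologicalSpace H]
  {I : ModelWithCorners ℝ F H} {M : Type*} [TopologicalSpace M] [ChartedSpace H M]

/-- The contactomorphism group `Cont(M, ξ)` of the co-oriented contact structure `ξ = ker α`:
the diffeomorphisms of `M` whose differential preserves the set of tangent vectors that are
positively transverse to `ξ` (hence also `ξ` itself). -/
def ContactoGroup (α : ∀ p : M, TangentSpace I p →L[ℝ] ℝ) : Subgroup (Equiv.Perm M) where
  carrier := {φ | ContMDiff I I ∞ φ ∧ ContMDiff I I ∞ φ.symm ∧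
    ∀ (p : M) (v : TangentSpace I p), 0 < α (φ p) (mfderiv I I φ p v) ↔ 0 < α p v}
  one_mem' := by
    refine ⟨contMDiff_id, contMDiff_id, fun p v => ?_⟩
    have : mfderiv I I (⇑(1 : Equiv.Perm M)) p = ContinuousLinearMap.id ℝ (TangentSpace I p) :=
      mfderiv_id
    rw [this]
    rfl
  mul_mem' := by
    rintro φ ψ ⟨h1, h2, h3⟩ ⟨k1, k2, k3⟩
    refine ⟨h1.comp k1, k2.comp h2, fun p v => ?_⟩
    have : mfderiv I I (⇑(φ * ψ)) p = (mfderiv I I φ (ψ p)).comp (mfderiv I I ψ p) :=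
      mfderiv_comp p (h1.mdifferentiable (by simp) _) (k1.mdifferentiable (by simp) _)
    rw [this]
    exact (h3 (ψ p) _).trans (k3 p v)
  inv_mem' := by
    rintro φ ⟨h1, h2, h3⟩
    refine ⟨h2, h1, fun p v => ?_⟩
    have hc : (mfderiv I I φ (φ.symm p)).comp (mfderiv I I φ.symm p)
        = ContinuousLinearMap.id ℝ (TangentSpace I p) := by
      rw [← mfderiv_id (I := I) (x := p)]
      have hid : (id : M → M) = φ ∘ φ.symm := by ext x; simp
      rw [hid]
      exact (mfderiv_comp p (h1.mdifferentiable (by simp) _)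
        (h2.mdifferentiable (by simp) _)).symm
    have key := h3 (φ.symm p) (mfderiv I I φ.symm p v)
    have hv : mfderiv I I φ (φ.symm p) (mfderiv I I φ.symm p v) = v :=
      congrArg (fun A : F →L[ℝ] F => A v) hc
    rw [hv] at key
    have hp : φ (φ.symm p) = p := φ.apply_symm_apply p
    have hα : ∀ q : M, q = p → ∀ w : F, ((α q : F →L[ℝ] ℝ) w = (α p : F →L[ℝ] ℝ) w) := by
      rintro q rfl w; rfl
    have h4 := hα _ hp v
    exact key.symm.trans (by
      constructor
      · intro h; exact h4 ▸ h
      · intro h; exact h4.symm ▸ h)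

variable {α : ∀ p : M, TangentSpace I p →L[ℝ] ℝ}

/-- A family of contactomorphisms, parametrised by a subset `s` of a normed space, is smooth if
`(t, p) ↦ φ_t(p)` and `(t, p) ↦ φ_t⁻¹(p)` are smooth on `s × M`. -/
def IsSmoothFamily {P : Type*} [NormedAddCommGroup P] [NormedSpace ℝ P] (s : Set P)
    (φ : P → ContactoGroup α) : Prop :=
  ContMDiffOn (𝓘(ℝ, P).prod I) I ∞ (fun z : P × M => (φ z.1 : Equiv.Perm M) z.2) (s ×ˢ univ) ∧
  ContMDiffOn (𝓘(ℝ, P).prod I) I ∞ (fun z : P × M => (φ z.1 : Equiv.Perm M).symm z.2)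
    (s ×ˢ univ)

namespace IsSmoothFamily

variable {P : Type*} [NormedAddCommGroup P] [NormedSpace ℝ P] {s : Set P} {φ ψ : P → ContactoGroup α}

lemma one : IsSmoothFamily s (fun _ => (1 : ContactoGroup α)) :=
  ⟨contMDiffOn_snd, contMDiffOn_snd⟩

lemma mul (h : IsSmoothFamily s φ) (k : IsSmoothFamily s ψ) :
    IsSmoothFamily s (fun t => φ t * ψ t) :=
  ⟨h.1.comp (contMDiffOn_fst.prodMk k.1) fun _ hz => ⟨hz.1, mem_univ _⟩,
   k.2.comp (contMDiffOn_fst.prodMk h.2) fun _ hz => ⟨hz.1, mem_univ _⟩⟩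

lemma inv (h : IsSmoothFamily s φ) : IsSmoothFamily s (fun t => (φ t)⁻¹) :=
  ⟨h.2, h.1⟩

lemma comp {Q : Type*} [NormedAddCommGroup Q] [NormedSpace ℝ Q] {r : Set Q} {f : Q → P}
    (h : IsSmoothFamily s φ) (hf : ContDiff ℝ ∞ f) (hm : MapsTo f r s) :
    IsSmoothFamily r (fun t => φ (f t)) := by
  have hg : ContMDiffOn (𝓘(ℝ, Q).prod I) (𝓘(ℝ, P).prod I) ∞
      (fun z : Q × M => (f z.1, z.2)) (r ×ˢ univ) :=
    (hf.contMDiff.comp_contMDiffOn contMDiffOn_fst).prodMk contMDiffOn_snd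
  exact ⟨h.1.comp hg fun z hz => ⟨hm hz.1, mem_univ _⟩,
    h.2.comp hg fun z hz => ⟨hm hz.1, mem_univ _⟩⟩

end IsSmoothFamily

variable (α) in
/-- A contact isotopy: a smooth path `[0, 1] → Cont(M, ξ)` starting at the identity. (The values
outside `[0, 1]` play no role.) -/
structure ContactIsotopy where
  toFun : ℝ → ContactoGroup α
  smooth : IsSmoothFamily (Icc (0 : ℝ) 1) toFun
  zero : toFun 0 = 1

namespace ContactIsotopy

/-- Smooth homotopies with fixed end-points between contact isotopies. -/
def Homotopic (φ ψ : ContactIsotopy α) : Prop :=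
  ∃ K : ℝ × ℝ → ContactoGroup α, IsSmoothFamily (Icc (0 : ℝ) 1 ×ˢ Icc (0 : ℝ) 1) K ∧
    (∀ t ∈ Icc (0 : ℝ) 1, K (0, t) = φ.toFun t ∧ K (1, t) = ψ.toFun t) ∧
    ∀ s ∈ Icc (0 : ℝ) 1, K (s, 0) = 1 ∧ K (s, 1) = φ.toFun 1

/-- The constant isotopy. -/
def refl : ContactIsotopy α := ⟨fun _ => 1, .one, rfl⟩

/-- The pointwise composition `t ↦ φ_t ∘ ψ_t`. -/
def mul (φ ψ : ContactIsotopy α) : ContactIsotopy α :=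
  ⟨fun t => φ.toFun t * ψ.toFun t, φ.smooth.mul ψ.smooth, by simp [φ.zero, ψ.zero]⟩

/-- The pointwise inverse `t ↦ φ_t⁻¹`. -/
def inv (φ : ContactIsotopy α) : ContactIsotopy α :=
  ⟨fun t => (φ.toFun t)⁻¹, φ.smooth.inv, by simp [φ.zero]⟩

/-- The isotopy `s ↦ φ_{ts}`, that is, the restriction of `φ` to `[0, t]`. -/
def restrict (φ : ContactIsotopy α) (t : Icc (0 : ℝ) 1) : ContactIsotopy α :=
  ⟨fun s => φ.toFun (t * s), φ.smooth.comp (f := fun s : ℝ => (t : ℝ) * s) (by fun_prop)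
    fun s hs => ⟨mul_nonneg t.2.1 hs.1, mul_le_one₀ t.2.2 hs.1 hs.2⟩, by simp [φ.zero]⟩

lemma const_smooth (φ : ContactIsotopy α) :
    IsSmoothFamily (Icc (0 : ℝ) 1 ×ˢ Icc (0 : ℝ) 1) (fun z : ℝ × ℝ => φ.toFun z.2) :=
  φ.smooth.comp contDiff_snd fun _ hz => hz.2

lemma Homotopic.mul_left (χ : ContactIsotopy α) {φ ψ : ContactIsotopy α} (h : Homotopic φ ψ) :
    Homotopic (χ.mul φ) (χ.mul ψ) := by
  obtain ⟨K, hK, h1, h2⟩ := h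
  refine ⟨fun z => χ.toFun z.2 * K z, χ.const_smooth.mul hK, fun t ht => ?_, fun s hs => ?_⟩
  · simp [mul, (h1 t ht).1, (h1 t ht).2]
  · simp [mul, (h2 s hs).1, (h2 s hs).2, χ.zero]

lemma Homotopic.mul_right (χ : ContactIsotopy α) {φ ψ : ContactIsotopy α} (h : Homotopic φ ψ) :
    Homotopic (φ.mul χ) (ψ.mul χ) := by
  obtain ⟨K, hK, h1, h2⟩ := h
  refine ⟨fun z => K z * χ.toFun z.2, hK.mul χ.const_smooth, fun t ht => ?_, fun s hs => ?_⟩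
  · simp [mul, (h1 t ht).1, (h1 t ht).2]
  · simp [mul, (h2 s hs).1, (h2 s hs).2, χ.zero]

lemma Homotopic.inv {φ ψ : ContactIsotopy α} (h : Homotopic φ ψ) :
    Homotopic φ.inv ψ.inv := by
  obtain ⟨K, hK, h1, h2⟩ := h
  refine ⟨fun z => (K z)⁻¹, hK.inv, fun t ht => ?_, fun s hs => ?_⟩
  · simp [ContactIsotopy.inv, (h1 t ht).1, (h1 t ht).2]
  · simp [ContactIsotopy.inv, (h2 s hs).1, (h2 s hs).2]

/-- The contact vector field `X_t` generating the isotopy, given by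
`d/dt φ_t = X_t ∘ φ_t`; the value at `q` is a tangent vector at `q = φ_t(φ_t⁻¹(q))`. -/
def generator (φ : ContactIsotopy α) (t : ℝ) (q : M) : TangentSpace I q :=
  mfderivWithin 𝓘(ℝ, ℝ) I
    (fun s : ℝ => (φ.toFun s : Equiv.Perm M) ((φ.toFun t : Equiv.Perm M).symm q))
    (Icc (0 : ℝ) 1) t (1 : ℝ)

end ContactIsotopy

/-- A vector field belongs to `cont⁺(M, ξ)` if it is everywhere positively transverse to
`ξ = ker α`. -/
def IsPositiveField (α : ∀ p : M, TangentSpace I p →L[ℝ] ℝ) (X : ∀ q : M, TangentSpace I q) :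
    Prop :=
  ∀ q, 0 < α q (X q)

namespace ContactIsotopy

/-- A non-negative path: `α(X_t) ≥ 0` for all `t`. -/
def IsNonneg (φ : ContactIsotopy α) : Prop :=
  ∀ t ∈ Icc (0 : ℝ) 1, ∀ q, 0 ≤ α q (φ.generator t q)

/-- A somewhere positive path: `X_t ∈ cont⁺(M, ξ)` for some `t`. -/
def IsSomewherePositive (φ : ContactIsotopy α) : Prop :=
  ∃ t ∈ Icc (0 : ℝ) 1, IsPositiveField α (φ.generator t)

end ContactIsotopy

variable (α) in
/-- The universal cover of `Cont₀(M, ξ)`: homotopy classes with fixed end-points of smooth paths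
in `Cont(M, ξ)` starting at the identity. -/
def UniversalCover : Type _ := Quot (ContactIsotopy.Homotopic (α := α))

namespace UniversalCover

/-- The homotopy class of a contact isotopy. -/
def mk (φ : ContactIsotopy α) : UniversalCover α := Quot.mk _ φ

instance : Group (UniversalCover α) where
  mul := Quot.map₂ ContactIsotopy.mul (fun χ _ _ h => h.mul_left χ) (fun _ _ χ h => h.mul_right χ)
  one := mk ContactIsotopy.refl
  inv := Quot.map ContactIsotopy.inv fun _ _ h => h.inv
  mul_assoc := by
    rintro ⟨a⟩ ⟨b⟩ ⟨c⟩
    refine congrArg (Quot.mk _) ?_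
    simp [ContactIsotopy.mul, mul_assoc]
  one_mul := by
    rintro ⟨a⟩
    refine congrArg (Quot.mk _) ?_
    simp [ContactIsotopy.mul, ContactIsotopy.refl]
  mul_one := by
    rintro ⟨a⟩
    refine congrArg (Quot.mk _) ?_
    simp [ContactIsotopy.mul, ContactIsotopy.refl]
  inv_mul_cancel := by
    rintro ⟨a⟩
    refine congrArg (Quot.mk _) ?_
    simp [ContactIsotopy.mul, ContactIsotopy.inv, ContactIsotopy.refl]

lemma mk_mul (φ ψ : ContactIsotopy α) : mk φ * mk ψ = mk (φ.mul ψ) := rfl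

end UniversalCover

/-- The smooth path in the universal cover which starts at `a` and is generated by the same
time-dependent contact vector field as the isotopy `φ`. Every smooth path in the universal cover
is of this form, for a unique isotopy `φ`. -/
def ContactIsotopy.lift (φ : ContactIsotopy α) (a : UniversalCover α) (t : Icc (0 : ℝ) 1) :
    UniversalCover α :=
  UniversalCover.mk (φ.restrict t) * a

lemma ContactIsotopy.lift_zero (φ : ContactIsotopy α) (a : UniversalCover α) :
    φ.lift a 0 = a := by
  have : φ.restrict 0 = ContactIsotopy.refl := by
    simp [ContactIsotopy.restrict, ContactIsotopy.refl, φ.zero]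
  rw [ContactIsotopy.lift, this]
  exact one_mul a

lemma ContactIsotopy.lift_one (φ : ContactIsotopy α) (a : UniversalCover α) :
    φ.lift a 1 = UniversalCover.mk φ * a := by
  have : φ.restrict 1 = φ := by
    cases φ; simp [ContactIsotopy.restrict]
  rw [ContactIsotopy.lift, this]

namespace UniversalCover

/-- The partial order on the universal cover: there is a non-negative path from `a` to `b`. -/
def Precedes (a b : UniversalCover α) : Prop :=
  ∃ φ : ContactIsotopy α, φ.IsNonneg ∧ φ.lift a 1 = b

/-- There is a non-negative and somewhere positive path from `a` to `b`. -/
def StrictlyPrecedes (a b : UniversalCover α) : Prop :=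
  ∃ φ : ContactIsotopy α, φ.IsNonneg ∧ φ.IsSomewherePositive ∧ φ.lift a 1 = b

/-- Bi-invariance of a function of two elements of the universal cover. -/
def IsBiInvariant (d : UniversalCover α → UniversalCover α → ℝ≥0∞) : Prop :=
  ∀ g a b, d (g * a) (g * b) = d a b ∧ d (a * g) (b * g) = d a b

end UniversalCover

end Contact

/-! ### Real projective space with its standard contact structure -/

section RealProjective

/-- The Euclidean space `ℝ²ⁿ`; `z (inl j)` and `z (inr j)` are the coordinates `x_j`, `y_j`. -/
abbrev PhaseSpace (n : ℕ) : Type := EuclideanSpace ℝ (Fin n ⊕ Fin n)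

instance factFinrankPhaseSpace (n : ℕ) [NeZero n] :
    Fact (Module.finrank ℝ (PhaseSpace n) = (2 * n - 1) + 1) :=
  ⟨by have := NeZero.pos n; simp; omega⟩

/-- The unit sphere `S²ⁿ⁻¹` of `ℝ²ⁿ`. -/
abbrev USphere (n : ℕ) : Type := sphere (0 : PhaseSpace n) 1

instance isCancelSMulUSphere (n : ℕ) : IsCancelSMul (sphere (0 : ℝ) 1) (USphere n) where
  left_cancel' a _ _ h := smul_left_cancel a h
  right_cancel' a b c h := by
    have h2 : (a : ℝ) • (c : PhaseSpace n) = (b : ℝ) • (c : PhaseSpace n) :=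
      congrArg Subtype.val h
    have h3 : (c : PhaseSpace n) ≠ 0 := ne_zero_of_mem_unit_sphere c
    exact Subtype.ext (smul_left_injective ℝ h3 h2)

lemma unitScalar_eq (c : sphere (0 : ℝ) 1) : (c : ℝ) = 1 ∨ (c : ℝ) = -1 := by
  have := c.2
  rw [mem_sphere_zero_iff_norm, Real.norm_eq_abs] at this
  exact eq_or_eq_neg_of_abs_eq this

instance finiteUnitScalars : Finite (sphere (0 : ℝ) 1) :=
  Set.Finite.to_subtype (((Set.finite_singleton (-1 : ℝ)).insert 1).subset fun x hx => by
    simpa using unitScalar_eq ⟨x, hx⟩)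

/-- The real projective space `ℝP²ⁿ⁻¹`: the quotient of `S²ⁿ⁻¹` by the action of the unit scalars
`{1, -1}`, that is, by the antipodal map. Its topology and its charts are those which Mathlib puts
on the quotient of a manifold by a free properly discontinuous action: the charts are composed of
local inverses of the projection and of the charts of the sphere. -/
abbrev RP (n : ℕ) : Type := MulAction.orbitRel.Quotient (sphere (0 : ℝ) 1) (USphere n)

lemma isInvertible_of_comp_eq_id {W : Type*} [NormedAddCommGroup W] [NormedSpace ℝ W]
    [FiniteDimensional ℝ W] {A B : W →L[ℝ] W} (h : A.comp B = ContinuousLinearMap.id ℝ W) :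
    A.IsInvertible := by
  have h5 : A.toLinearMap * B.toLinearMap = 1 := by
    ext1 v; exact congrArg (fun C : W →L[ℝ] W => C v) h
  have h6 := mul_eq_one_comm.1 h5
  refine ContinuousLinearMap.IsInvertible.of_inverse h (g := B) ?_
  ext1 v
  exact congrArg (fun C : W →ₗ[ℝ] W => C v) h6

variable {n : ℕ}

/-- The projection `S²ⁿ⁻¹ → ℝP²ⁿ⁻¹`. -/
def RP.mk (x : USphere n) : RP n := Quotient.mk _ x

namespace RP

lemma mk_eq_mk {x y : USphere n} : mk x = mk y ↔ x = y ∨ x = -y := by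
  have h : mk x = mk y ↔ x ∈ MulAction.orbit (sphere (0 : ℝ) 1) y := Quotient.eq''
  rw [h]
  constructor
  · rintro ⟨c, hc⟩
    have hc' : (c : ℝ) • (y : PhaseSpace n) = x := congrArg Subtype.val hc
    rcases unitScalar_eq c with h1 | h1
    · left; apply Subtype.ext; rw [← hc', h1, one_smul]
    · right; apply Subtype.ext; rw [← hc', h1, neg_one_smul]; rfl
  · rintro (h1 | h1)
    · exact ⟨1, (one_smul _ y).trans h1.symm⟩
    · refine ⟨⟨-1, by simp⟩, ?_⟩
      apply Subtype.ext
      rw [h1]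
      change (-1 : ℝ) • (y : PhaseSpace n) = -(y : PhaseSpace n)
      rw [neg_one_smul]

lemma mk_neg (x : USphere n) : mk (-x) = mk x := mk_eq_mk.2 (Or.inr rfl)

lemma isLocalHomeomorph_mk : IsLocalHomeomorph (mk (n := n)) :=
  (isQuotientCoveringMap_quotientMk_of_properlyDiscontinuousSMul
    (E := USphere n) (G := sphere (0 : ℝ) 1)).isCoveringMap.isLocalHomeomorph

lemma mk_surjective : Function.Surjective (mk (n := n)) := Quotient.mk_surjective

variable [NeZero n]

local notation "𝓜" => 𝓡 (2 * n - 1)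

/-- A local section of the projection, composed with the projection, is locally the identity or
the antipodal map. -/
lemma contMDiffAt_section_comp (e : OpenPartialHomeomorph (RP n) (USphere n))
    (he : (e.symm : USphere n → RP n) = mk) {y : USphere n} (hy : mk y ∈ e.source) :
    ContMDiffAt 𝓜 𝓜 ∞ (fun z => e (mk z)) y := by
  have hopen : IsOpen (mk ⁻¹' e.source) := e.open_source.preimage isLocalHomeomorph_mk.continuous
  have hcont : ContinuousAt (fun z => e (mk z)) y :=
    (e.continuousAt hy).comp (f := mk) isLocalHomeomorph_mk.continuous.continuousAt
  have hall : ∀ z ∈ mk ⁻¹' e.source, e (mk z) = z ∨ e (mk z) = -z := fun z hz => by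
    have h1 : mk (e (mk z)) = mk z := by
      rw [← congrFun he]; exact e.left_inv hz
    exact mk_eq_mk.1 h1
  have hsep : ∀ z w : USphere n, z = -w → dist z w = 2 := by
    rintro z w rfl
    have hw : ‖(w : PhaseSpace n)‖ = 1 := norm_eq_of_mem_sphere w
    rw [Subtype.dist_eq, dist_eq_norm, coe_neg_sphere, ← neg_add', norm_neg, ← two_smul ℝ,
      norm_smul, hw]
    norm_num
  rcases hall y hy with h0 | h0
  · have hd : ContinuousAt (fun z => dist (e (mk z)) z) y := hcont.dist continuousAt_id
    have hlt : ∀ᶠ z in nhds y, dist (e (mk z)) z < 2 :=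
      hd.eventually_lt continuousAt_const (by simp [h0])
    refine contMDiffAt_id.congr_of_eventuallyEq ?_
    filter_upwards [hlt, hopen.mem_nhds hy] with z h1 h2
    rcases hall z h2 with h3 | h3
    · exact h3
    · exact absurd (hsep _ _ h3) h1.ne
  · have hd : ContinuousAt (fun z => dist (e (mk z)) (-z)) y :=
      hcont.dist continuous_neg.continuousAt
    have hlt : ∀ᶠ z in nhds y, dist (e (mk z)) (-z) < 2 :=
      hd.eventually_lt continuousAt_const (by simp [h0])
    refine ContMDiffAt.congr_of_eventuallyEq (f := fun z : USphere n => -z)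
      contMDiff_neg_sphere.contMDiffAt ?_
    filter_upwards [hlt, hopen.mem_nhds hy] with z h1 h2
    rcases hall z h2 with h3 | h3
    · exact absurd (hsep (e (mk z)) (-z) (by rw [h3, neg_neg])) h1.ne
    · exact h3

lemma exists_atlas_eq (c : OpenPartialHomeomorph (RP n) (EuclideanSpace ℝ (Fin (2 * n - 1))))
    (hc : c ∈ atlas (EuclideanSpace ℝ (Fin (2 * n - 1))) (RP n)) :
    ∃ (e : OpenPartialHomeomorph (RP n) (USphere n)) (x : USphere n),
      (e.symm : USphere n → RP n) = mk ∧
      c = e.trans (chartAt (EuclideanSpace ℝ (Fin (2 * n - 1))) x) := by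
  obtain ⟨q, rfl⟩ := hc
  exact ⟨_, _, isLocalHomeomorph_mk.localInverseAt_symm _, rfl⟩

/-- `ℝP²ⁿ⁻¹` is a smooth manifold. -/
instance isManifold : IsManifold 𝓜 ∞ (RP n) := by
  refine isManifold_of_contDiffOn 𝓜 ∞ (RP n) fun c c' hc hc' => ?_
  obtain ⟨e, x, he, rfl⟩ := exists_atlas_eq c hc
  obtain ⟨e', x', he', rfl⟩ := exists_atlas_eq c' hc'
  rw [← contMDiffOn_iff_contDiffOn]
  intro u hu
  refine ContMDiffAt.contMDiffWithinAt ?_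
  simp only [modelWithCornersSelf_coe, modelWithCornersSelf_coe_symm, range_id, inter_univ,
    preimage_id_eq, id, OpenPartialHomeomorph.trans_source, OpenPartialHomeomorph.symm_source,
    OpenPartialHomeomorph.trans_symm_eq_symm_trans_symm,
    mem_inter_iff, mem_preimage, OpenPartialHomeomorph.coe_trans, Function.comp_apply, he] at hu
  obtain ⟨⟨hu1, _⟩, hu2, hu3⟩ := hu
  have hfun : (𝓜 ∘ ((e.trans (chartAt (EuclideanSpace ℝ (Fin (2 * n - 1))) x)).symm ≫ₕ
      (e'.trans (chartAt (EuclideanSpace ℝ (Fin (2 * n - 1))) x'))) ∘ (𝓜).symm)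
      = (chartAt (EuclideanSpace ℝ (Fin (2 * n - 1))) x') ∘ (fun z => e' (mk z)) ∘
        (chartAt (EuclideanSpace ℝ (Fin (2 * n - 1))) x).symm := by
    ext1 z
    simp [OpenPartialHomeomorph.trans_symm_eq_symm_trans_symm, he]
  rw [hfun]
  refine ContMDiffAt.comp u (I' := 𝓜)
    ((contMDiffOn_chart (I := 𝓜) (n := ∞) (x := x')).contMDiffAt
      ((chartAt (EuclideanSpace ℝ (Fin (2 * n - 1))) x').open_source.mem_nhds hu3)) ?_
  refine ContMDiffAt.comp u (I' := 𝓜) (contMDiffAt_section_comp e' he' hu2) ?_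
  exact (contMDiffOn_chart_symm (I := 𝓜) (n := ∞) (x := x)).contMDiffAt
      ((chartAt (EuclideanSpace ℝ (Fin (2 * n - 1))) x).open_target.mem_nhds hu1)

/-- Near each point there is a smooth local section of the projection. -/
lemma exists_smooth_section (p : RP n) : ∃ e : OpenPartialHomeomorph (RP n) (USphere n),
    (e.symm : USphere n → RP n) = mk ∧ p ∈ e.source ∧ ContMDiffAt 𝓜 𝓜 ∞ e p ∧
      ContMDiffAt 𝓜 𝓜 ∞ mk (e p) := by
  obtain ⟨e, x, he, hc⟩ := exists_atlas_eq _
    (chart_mem_atlas (EuclideanSpace ℝ (Fin (2 * n - 1))) p)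
  set c := chartAt (EuclideanSpace ℝ (Fin (2 * n - 1))) p with hcdef
  set k := chartAt (EuclideanSpace ℝ (Fin (2 * n - 1))) x with hkdef
  have hp : p ∈ c.source := mem_chart_source _ p
  have hp' := hp
  rw [hc, OpenPartialHomeomorph.trans_source] at hp'
  refine ⟨e, he, hp'.1, ?_, ?_⟩
  · have h1 : ContMDiffAt 𝓜 𝓜 ∞ (k.symm ∘ c) p := by
      refine ContMDiffAt.comp p (I' := 𝓜) ?_ (contMDiffAt_of_mem_maximalAtlas
        (IsManifold.chart_mem_maximalAtlas p) hp)
      refine (contMDiffOn_chart_symm (I := 𝓜) (n := ∞) (x := x)).contMDiffAt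
        (k.open_target.mem_nhds ?_)
      rw [hc]
      exact k.map_source hp'.2
    refine h1.congr_of_eventuallyEq ?_
    filter_upwards [c.open_source.mem_nhds hp] with q hq
    rw [hc, OpenPartialHomeomorph.trans_source] at hq
    rw [hc]
    exact (k.left_inv hq.2).symm
  · have h1 : ContMDiffAt 𝓜 𝓜 ∞ (c.symm ∘ k) (e p) := by
      refine ContMDiffAt.comp (e p) (I' := 𝓜) ?_
        ((contMDiffOn_chart (I := 𝓜) (n := ∞) (x := x)).contMDiffAt
          (k.open_source.mem_nhds hp'.2))
      refine (contMDiffOn_chart_symm (I := 𝓜) (n := ∞) (x := p)).contMDiffAt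
        (c.open_target.mem_nhds ?_)
      have : k (e p) = c p := by rw [hc]; rfl
      rw [this]
      exact c.map_source hp
    refine h1.congr_of_eventuallyEq ?_
    filter_upwards [k.open_source.mem_nhds hp'.2] with z hz
    rw [hc, Function.comp_apply, OpenPartialHomeomorph.trans_symm_eq_symm_trans_symm,
      OpenPartialHomeomorph.coe_trans, Function.comp_apply, k.left_inv hz, he]

/-- The projection `S²ⁿ⁻¹ → ℝP²ⁿ⁻¹` is smooth. -/
lemma contMDiff_mk : ContMDiff 𝓜 𝓜 ∞ (mk (n := n)) := by
  intro x
  obtain ⟨e, he, hp, -, h2⟩ := exists_smooth_section (mk x)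
  have h1 : mk (e (mk x)) = mk x := by rw [← congrFun he]; exact e.left_inv hp
  rcases mk_eq_mk.1 h1 with h | h
  · rwa [h] at h2
  · rw [h] at h2
    have h3 : ContMDiffAt 𝓜 𝓜 ∞ (mk ∘ fun z : USphere n => -z) x :=
      ContMDiffAt.comp x h2 contMDiff_neg_sphere.contMDiffAt
    have h4 : (mk ∘ fun z : USphere n => -z) = mk (n := n) := funext fun z => mk_neg z
    rwa [h4] at h3

/-- Near `mk x` there is a smooth local section of the projection through `x`. -/
lemma exists_smooth_section_through (x : USphere n) : ∃ s : RP n → USphere n,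
    ContMDiffAt 𝓜 𝓜 ∞ s (mk x) ∧ s (mk x) = x ∧ ∀ᶠ q in nhds (mk x), mk (s q) = q := by
  obtain ⟨e, he, hp, h1, -⟩ := exists_smooth_section (mk x)
  have hsec : ∀ q ∈ e.source, mk (e q) = q := fun q hq => by
    rw [← congrFun he]; exact e.left_inv hq
  rcases mk_eq_mk.1 (hsec _ hp) with h | h
  · exact ⟨e, h1, h, by filter_upwards [e.open_source.mem_nhds hp] with q hq using hsec q hq⟩
  · refine ⟨fun q => -e q, ?_, by simp [h], ?_⟩
    · exact ContMDiffAt.comp (mk x) (contMDiff_neg_sphere (n := 2 * n - 1)).contMDiffAt h1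
    · filter_upwards [e.open_source.mem_nhds hp] with q hq
      rw [mk_neg, hsec q hq]

/-- The differential of the projection is invertible. -/
lemma mfderiv_mk_isInvertible (x : USphere n) :
    (mfderiv 𝓜 𝓜 mk x : TangentSpace 𝓜 x →L[ℝ] TangentSpace 𝓜 (mk x)).IsInvertible := by
  obtain ⟨s, h1, h2, h3⟩ := exists_smooth_section_through x
  have hm : MDifferentiableAt 𝓜 𝓜 (mk (n := n)) (s (mk x)) :=
    (contMDiff_mk (n := n)).mdifferentiable (by simp) _
  have hs : MDifferentiableAt 𝓜 𝓜 s (mk x) := h1.mdifferentiableAt (by simp)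
  have hc : (mfderiv 𝓜 𝓜 mk (s (mk x))).comp (mfderiv 𝓜 𝓜 s (mk x)) =
      ContinuousLinearMap.id ℝ (TangentSpace 𝓜 (mk x)) := by
    rw [← mfderiv_comp (mk x) hm hs, ← mfderiv_id]
    exact Filter.EventuallyEq.mfderiv_eq h3
  have hA : ∀ y : USphere n, y = x → ∀ B : EuclideanSpace ℝ (Fin (2 * n - 1)) →L[ℝ]
      EuclideanSpace ℝ (Fin (2 * n - 1)),
      ContinuousLinearMap.comp (mfderiv 𝓜 𝓜 (mk (n := n)) y : EuclideanSpace ℝ (Fin (2 * n - 1)) →L[ℝ]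
        EuclideanSpace ℝ (Fin (2 * n - 1))) B =
        ContinuousLinearMap.id ℝ (EuclideanSpace ℝ (Fin (2 * n - 1))) →
      ContinuousLinearMap.IsInvertible
        (mfderiv 𝓜 𝓜 mk x : TangentSpace 𝓜 x →L[ℝ] TangentSpace 𝓜 (mk x)) := by
    rintro y rfl B hB
    exact isInvertible_of_comp_eq_id hB
  exact hA _ h2 _ hc

end RP

/-- A representative in the sphere of a point of the projective space. -/
def RP.rep (p : RP n) : USphere n := (RP.mk_surjective p).choose

lemma RP.mk_rep (p : RP n) : RP.mk p.rep = p := (RP.mk_surjective p).choose_spec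

/-- The Liouville form `λ₀ = ½ ∑ (x_j dy_j - y_j dx_j)` of `ℝ²ⁿ`. -/
def liouvilleForm (z : PhaseSpace n) : PhaseSpace n →L[ℝ] ℝ :=
  (1 / 2 : ℝ) • ∑ j : Fin n,
    (z (Sum.inl j) • (EuclideanSpace.proj (Sum.inr j) : PhaseSpace n →L[ℝ] ℝ) -
      z (Sum.inr j) • (EuclideanSpace.proj (Sum.inl j) : PhaseSpace n →L[ℝ] ℝ))

lemma liouvilleForm_apply (z w : PhaseSpace n) : liouvilleForm z w =
    1 / 2 * ∑ j : Fin n, (z (Sum.inl j) * w (Sum.inr j) - z (Sum.inr j) * w (Sum.inl j)) := by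
  simp [liouvilleForm]

variable [NeZero n]

local notation "𝓜" => 𝓡 (2 * n - 1)

/-- The restriction of the Liouville form to the unit sphere. -/
def sphereForm (x : USphere n) : TangentSpace 𝓜 x →L[ℝ] ℝ :=
  (liouvilleForm (x : PhaseSpace n)).comp
    (mvfderiv 𝓜 (Subtype.val : USphere n → PhaseSpace n) x)

/-- The standard contact form `α₀` of `ℝP²ⁿ⁻¹`, induced by the restriction of the Liouville form to
the sphere; it is characterized by `stdForm_mfderiv_mk`. -/
def stdForm (p : RP n) : TangentSpace 𝓜 p →L[ℝ] ℝ :=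
  (sphereForm p.rep).comp (mfderiv 𝓜 𝓜 RP.mk p.rep).inverse

lemma sphereForm_neg (x : USphere n) (v : TangentSpace 𝓜 x) :
    sphereForm (-x) (mfderiv 𝓜 𝓜 (fun z : USphere n => -z) x v) = sphereForm x v := by
  have h1 : MDifferentiableAt 𝓜 𝓘(ℝ, PhaseSpace n) (Subtype.val : USphere n → PhaseSpace n) (-x) :=
    (contMDiff_coe_sphere (m := ∞)).mdifferentiable (by simp) _
  have h2 : MDifferentiableAt 𝓜 𝓜 (fun z : USphere n => -z) x :=
    (contMDiff_neg_sphere (m := ∞)).mdifferentiable (by simp) _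
  have h3 : mvfderiv 𝓜 ((Subtype.val : USphere n → PhaseSpace n) ∘ fun z : USphere n => -z) x =
      (mvfderiv 𝓜 (Subtype.val : USphere n → PhaseSpace n) (-x)).comp
        (mfderiv 𝓜 𝓜 (fun z : USphere n => -z) x) := mfderiv_comp x h1 h2
  have h4 : (Subtype.val : USphere n → PhaseSpace n) ∘ (fun z : USphere n => -z) =
      -(Subtype.val : USphere n → PhaseSpace n) := rfl
  rw [h4, mvfderiv_neg] at h3
  have h5 : mvfderiv 𝓜 (Subtype.val : USphere n → PhaseSpace n) (-x)
      (mfderiv 𝓜 𝓜 (fun z : USphere n => -z) x v) =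
      -(mvfderiv 𝓜 (Subtype.val : USphere n → PhaseSpace n) x v) :=
    (congrArg (fun C => C v) h3).symm
  have h6 : liouvilleForm (-(x : PhaseSpace n)) = -liouvilleForm (x : PhaseSpace n) := by
    ext1 w
    rw [neg_apply, liouvilleForm_apply, liouvilleForm_apply, ← mul_neg, ← Finset.sum_neg_distrib]
    refine congrArg _ (Finset.sum_congr rfl fun j _ => ?_)
    simp only [PiLp.neg_apply]
    ring
  change liouvilleForm (-(x : PhaseSpace n)) (mvfderiv 𝓜 _ (-x) _) = liouvilleForm _ _
  rw [h5, h6]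
  simp

/-- The pull-back of `α₀` to the sphere is the restriction of the Liouville form. -/
lemma stdForm_mfderiv_mk (x : USphere n) (v : TangentSpace 𝓜 x) :
    stdForm (RP.mk x) (mfderiv 𝓜 𝓜 RP.mk x v) = sphereForm x v := by
  have hinv : ∀ (y : USphere n) (w : TangentSpace 𝓜 y),
      (mfderiv 𝓜 𝓜 RP.mk y).inverse (mfderiv 𝓜 𝓜 RP.mk y w) = w := fun y w => by
    obtain ⟨e, he⟩ := RP.mfderiv_mk_isInvertible y
    rw [← he, ContinuousLinearMap.inverse_equiv]
    exact e.symm_apply_apply w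
  have hmk : ∀ y : USphere n, MDifferentiableAt 𝓜 𝓜 (RP.mk (n := n)) y :=
    RP.contMDiff_mk.mdifferentiable (by simp)
  have h2 : MDifferentiableAt 𝓜 𝓜 (fun z : USphere n => -z) x :=
    (contMDiff_neg_sphere (m := ∞)).mdifferentiable (by simp) _
  have hneg : mfderiv 𝓜 𝓜 (RP.mk (n := n)) x v =
      mfderiv 𝓜 𝓜 RP.mk (-x) (mfderiv 𝓜 𝓜 (fun z : USphere n => -z) x v) := by
    have h3 := mfderiv_comp x (hmk (-x)) h2
    have h4 : (RP.mk (n := n)) ∘ (fun z : USphere n => -z) = RP.mk := funext RP.mk_neg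
    rw [h4] at h3
    exact congrArg (fun C => C v) h3
  have key : ∀ y : USphere n, RP.mk y = RP.mk x →
      sphereForm y ((mfderiv 𝓜 𝓜 RP.mk y).inverse
        (mfderiv 𝓜 𝓜 RP.mk x v : EuclideanSpace ℝ (Fin (2 * n - 1)))) = sphereForm x v := by
    intro y hy
    rcases RP.mk_eq_mk.1 hy with rfl | rfl
    · exact congrArg (sphereForm y) (hinv y v)
    · rw [← sphereForm_neg x v]
      refine congrArg (sphereForm (-x)) ?_
      rw [hneg]
      exact hinv (-x) _
  exact key _ (RP.mk_rep _)

/-! ### The volume of a contact form and the Lorentz–Finsler metric -/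

/-- A base point of the sphere. -/
def northPole (n : ℕ) [NeZero n] : USphere n :=
  ⟨EuclideanSpace.single (Sum.inl 0) 1, by simp⟩

/-- Stereographic parametrization of the complement of the north pole in the sphere, followed by
the projection to the projective space. -/
def stereoParam (n : ℕ) [NeZero n] (y : EuclideanSpace ℝ (Fin (2 * n - 1))) : RP n :=
  RP.mk ((stereographic' (2 * n - 1) (northPole n)).symm y)

/-- The points of `ℝ²ⁿ⁻¹` which `stereographic'` sends to the open hemisphere opposite to the north
pole. On this open ball `stereoParam n` is a diffeomorphism onto the complement in `ℝP²ⁿ⁻¹` of a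
projective hyperplane, which has measure zero. -/
def hemisphereDomain (n : ℕ) [NeZero n] : Set (EuclideanSpace ℝ (Fin (2 * n - 1))) :=
  {y | ⟪((stereographic' (2 * n - 1) (northPole n)).symm y : PhaseSpace n), northPole n⟫ < 0}

/-- The value on the standard basis `e` of `ℝ²ⁿ⁻¹`, at the point `y`, of `η ∧ (dη)ⁿ⁻¹`, where
`dη(u, v) = D_u η(v) - D_v η(u)`. -/
def wedgeDensity (n : ℕ) [NeZero n]
    (η : EuclideanSpace ℝ (Fin (2 * n - 1)) → EuclideanSpace ℝ (Fin (2 * n - 1)) →L[ℝ] ℝ)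
    (y : EuclideanSpace ℝ (Fin (2 * n - 1))) : ℝ :=
  let e : Fin (2 * n - 1) → EuclideanSpace ℝ (Fin (2 * n - 1)) :=
    fun i => EuclideanSpace.single i 1
  let dη := fun u v => fderiv ℝ η y u v - fderiv ℝ η y v u
  (1 / 2 ^ (n - 1)) * ∑ σ : Equiv.Perm (Fin (2 * n - 1)), ((Equiv.Perm.sign σ : ℤ) : ℝ) *
    (η y (e (σ ⟨0, by have := NeZero.pos n; omega⟩)) *
      ∏ k : Fin (n - 1), dη (e (σ ⟨2 * k + 1, by omega⟩)) (e (σ ⟨2 * k + 2, by omega⟩)))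

/-- The volume `∫ β ∧ (dβ)ⁿ⁻¹` of `ℝP²ⁿ⁻¹` with respect to a contact form `β`, computed in the
coordinates `stereoParam n`. The absolute value accounts for the fact that `ℝP²ⁿ⁻¹` is oriented by
the volume form `β ∧ (dβ)ⁿ⁻¹`. -/
def contactVolume (β : ∀ p : RP n, TangentSpace 𝓜 p →L[ℝ] ℝ) : ℝ :=
  ∫ y in hemisphereDomain n, |wedgeDensity n (fun y => ContinuousLinearMap.comp
    (β (stereoParam n y) : EuclideanSpace ℝ (Fin (2 * n - 1)) →L[ℝ] ℝ)
    (mfderiv 𝓜 𝓜 (stereoParam n) y)) y|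

open Classical in
/-- The Lorentz–Finsler metric `V` on the cone `cont⁺`, extended by zero: if `X ∈ cont⁺`, then
`V(X) = vol(β)^(-1/n)`, where `β = α₀(X)⁻¹ α₀` is the contact form defining the co-oriented
structure `ker α₀` whose Reeb vector field is the contact vector field `X`. -/
def lorentzFinsler (X : ∀ q : RP n, TangentSpace 𝓜 q) : ℝ :=
  if IsPositiveField (stdForm (n := n)) X then
    contactVolume (fun q => (stdForm q (X q))⁻¹ • stdForm q) ^ (-(1 / (n : ℝ)))
  else 0

/-- The universal cover of `Cont₀(ℝP²ⁿ⁻¹, ξ_st)`. -/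
abbrev ContRPCover (n : ℕ) [NeZero n] : Type := UniversalCover (stdForm (n := n))

/-- The Lorentz–Finsler length of a non-negative path: the integral of `V(X_t)` over `[0, 1]`. -/
def lorentzLength (φ : ContactIsotopy (stdForm (n := n))) : ℝ≥0∞ :=
  ∫⁻ t in Icc (0 : ℝ) 1, ENNReal.ofReal (lorentzFinsler (φ.generator t))

/-- The Lorentz distance induced by `V`: the supremum of the lengths of the non-negative paths from
`a` to `b`; it is `0` if there is no such path. -/
def lorentzDist (a b : ContRPCover n) : ℝ≥0∞ :=
  ⨆ (φ : ContactIsotopy (stdForm (n := n))) (_ : φ.IsNonneg ∧ φ.lift a 1 = b), lorentzLength φ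

end RealProjective

end

/-! Contact geometry of the projective space is treated as homogeneous symplectic geometry of ℝ²ⁿ
minus the origin. A map that commutes with real scalars and preserves λ₀ induces a contactomorphism
(`HomSymp.proj`). The contact Hamiltonian of an induced path is the restriction to the unit sphere
of a function homogeneous of degree two, and every such smooth function has a global flow
(`IsHomHam.exists_flow`). Pointwise inequalities of Hamiltonians give inequalities in the order
`Precedes`, which is invariant under left and right multiplication.

Let r_c be the class of t ↦ e^{ict} (`rotClass`). The end-point of a non-negative, somewhere
positive path starting at 1 dominates some r_ε with ε > 0 (`exists_rotClass_precedes`). The heart of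
the matter is that r_ε leaves room for arbitrarily high powers of a positive element
(`squeeze_precedes`, `exists_twin_precedes`). For c = π/(m+1) the end-point e^{ic} commutes with the
flow P of -Im Σ z_j^(2m+2) / |z|^(2m). Conjugating the rotation path by P_s therefore does not
change its class, although its Hamiltonian becomes (c/2)|P_s z|². The flow P expands, uniformly and
without bound, the unit vectors at which Σ (Re z_j^(m+1))² is bounded below (`exists_pump_growth`).
So if H ≥ 0 is supported there and U is the class of its time-one flow, then U^N ≤ r_c for all N.
Conjugation by e^{iπ/(2(m+1))} exchanges real and imaginary parts and gives V with V^N ≤ r_c. Real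
and imaginary parts are never both small, so UV is generated by an everywhere positive Hamiltonian,
and W_N = U^N V^N ≤ r_{2c} ≤ r_ε once m is large.

For an abstract d, bi-invariance and W_{N+1} = U^N (UV) V^N give d(W_N, W_{N+1}) = d(1, UV) > 0. By
the reverse triangle inequality d(1, W_N) ≥ N d(1, UV), and every W_N lies below the given element,
so its distance from 1 is infinite (`eq_top_of_strictlyPrecedes`).

For the distance of V no invariance is invoked; lengths are estimated directly. The path to W_N has
Hamiltonian N · (G ∘ f⁻¹) with f homogeneous symplectic and G fixed. The contact volume of the
corresponding form is N⁻ⁿ times an integral bounded by a constant times the Lebesgue volume of {G ∘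
f⁻¹ < 1} = f {G < 1}, which does not depend on f. Hence V(X_t) ≥ vN with v > 0 fixed
(`exists_le_lorentzFinsler_twinIsotopy`), and completing these paths up to the given element yields
unbounded lengths (`lorentzDist_eq_top`). -/

noncomputable section

/-! ### Smooth flows of bounded Lipschitz vector fields -/

section Nemytskii

open ContinuousMap Filter Topology

variable {K : Type*} [TopologicalSpace K] [CompactSpace K]

/-- Pointwise application of operator-valued functions to vector-valued functions. -/
def ContinuousMap.applyCLM (K : Type*) [TopologicalSpace K] [CompactSpace K]
    (V F : Type*) [NormedAddCommGroup V] [NormedSpace ℝ V] [NormedAddCommGroup F]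
    [NormedSpace ℝ F] : C(K, V →L[ℝ] F) →L[ℝ] C(K, V) →L[ℝ] C(K, F) :=
  LinearMap.mkContinuous₂
    (LinearMap.mk₂ ℝ (fun (A : C(K, V →L[ℝ] F)) (h : C(K, V)) =>
        (⟨fun t => A t (h t), A.continuous.clm_apply h.continuous⟩ : C(K, F)))
      (fun _ _ _ => by ext; simp) (fun _ _ _ => by ext; simp)
      (fun _ _ _ => by ext; simp) (fun _ _ _ => by ext; simp)) 1 (fun A h => by
        rw [one_mul]
        refine (ContinuousMap.norm_le _ (mul_nonneg (norm_nonneg A) (norm_nonneg h))).2 fun t => ?_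
        exact ((A t).le_opNorm _).trans (mul_le_mul (A.norm_coe_le_norm t) (h.norm_coe_le_norm t)
          (norm_nonneg _) (norm_nonneg _)))

variable {V F : Type*} [NormedAddCommGroup V] [NormedSpace ℝ V] [NormedAddCommGroup F]
    [NormedSpace ℝ F]

/-- Continuity of γ ↦ f' ∘ γ in the sup norm controls the oscillation of f' on balls around γ(t)
uniformly in t; the mean value inequality at each t does the rest. -/
lemma ContinuousMap.hasFDerivAt_comp {f : V → F} (hf : Differentiable ℝ f)
    (hc : Continuous f) (hc' : Continuous (fderiv ℝ f)) (γ : C(K, V)) :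
    HasFDerivAt (fun γ : C(K, V) => (⟨f, hc⟩ : C(V, F)).comp γ)
      (ContinuousMap.applyCLM K V F ((⟨fderiv ℝ f, hc'⟩ : C(V, V →L[ℝ] F)).comp γ)) γ := by
  rw [hasFDerivAt_iff_isLittleO_nhds_zero, Asymptotics.isLittleO_iff]
  intro ε hε
  have hcont : Continuous fun γ : C(K, V) => (⟨fderiv ℝ f, hc'⟩ : C(V, V →L[ℝ] F)).comp γ :=
    ContinuousMap.continuous_postcomp _
  obtain ⟨δ, hδ, hd⟩ := (Metric.continuous_iff (α := C(K, V)) (β := C(K, V →L[ℝ] F))).1 hcont γ ε hε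
  filter_upwards [Metric.ball_mem_nhds (0 : C(K, V)) hδ] with h hh
  rw [mem_ball_zero_iff] at hh
  rw [ContinuousMap.norm_le _ (by positivity)]
  intro t
  have hbound : ∀ z ∈ ball (γ t) δ, ‖fderiv ℝ f z - fderiv ℝ f (γ t)‖ ≤ ε := fun z hz => by
    -- Translating γ by the constant z - γ t turns sup-norm continuity into a bound on f' at the
    -- single point z, with δ independent of t.
    have h1 : dist (γ + ContinuousMap.const K (z - γ t)) γ < δ := by
      rw [dist_eq_norm, add_sub_cancel_left]
      refine lt_of_le_of_lt ((ContinuousMap.norm_le _ (norm_nonneg _)).2 fun x => ?_)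
        (mem_ball_iff_norm.1 hz)
      simp
    have h2 := hd _ h1
    have h3 := ((ContinuousMap.dist_lt_iff hε).1 h2 t).le
    rw [dist_eq_norm] at h3
    simpa using h3
  have hm := (convex_ball (γ t) δ).norm_image_sub_le_of_norm_fderiv_le'
    (fun z _ => hf z) hbound (mem_ball_self hδ) (y := γ t + h t) (by
      rw [mem_ball_iff_norm, add_sub_cancel_left]
      exact (h.norm_coe_le_norm t).trans_lt hh)
  rw [add_sub_cancel_left] at hm
  exact hm.trans (mul_le_mul_of_nonneg_left (h.norm_coe_le_norm t) hε.le)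

end Nemytskii

universe u

/-- Induction on m: the derivative at γ is `applyCLM` evaluated at f' ∘ γ, so one derivative of f
pays for one derivative of the operator. The target F must vary in the induction, since f' takes
values in V →L F; this is why all spaces share one universe. -/
lemma ContinuousMap.contDiff_comp_nat {K : Type u} [TopologicalSpace K] [CompactSpace K]
    {V : Type u} [NormedAddCommGroup V] [NormedSpace ℝ V] (m : ℕ) :
    ∀ {F : Type u} [NormedAddCommGroup F] [NormedSpace ℝ F] {f : V → F} (hf : ContDiff ℝ m f),
      ContDiff ℝ m (fun γ : C(K, V) => (⟨f, hf.continuous⟩ : C(V, F)).comp γ) := by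
  induction m with
  | zero =>
    intro F _ _ f hf
    exact contDiff_zero.2 (ContinuousMap.continuous_postcomp _)
  | succ m ih =>
    intro F _ _ f hf
    have h1 := contDiff_succ_iff_fderiv.1
      (show ContDiff ℝ ((m : WithTop ℕ∞) + 1) f by exact_mod_cast hf)
    have hc' : Continuous (fderiv ℝ f) := h1.2.2.continuous
    have hd := ContinuousMap.hasFDerivAt_comp (K := K) h1.1 hf.continuous hc'
    suffices h : ContDiff ℝ ((m : WithTop ℕ∞) + 1)
        (fun γ : C(K, V) => (⟨f, hf.continuous⟩ : C(V, F)).comp γ) by exact_mod_cast h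
    rw [contDiff_succ_iff_fderiv]
    refine ⟨fun γ => (hd γ).differentiableAt, by simp, ?_⟩
    have : fderiv ℝ (fun γ : C(K, V) => (⟨f, hf.continuous⟩ : C(V, F)).comp γ) =
        fun γ => ContinuousMap.applyCLM K V F ((⟨fderiv ℝ f, hc'⟩ : C(V, V →L[ℝ] F)).comp γ) :=
      funext fun γ => (hd γ).fderiv
    rw [this]
    exact (ContinuousMap.applyCLM K V F).contDiff.comp (ih h1.2.2)

lemma ContinuousMap.contDiff_comp {K : Type u} [TopologicalSpace K] [CompactSpace K]
    {V : Type u} [NormedAddCommGroup V] [NormedSpace ℝ V] {F : Type u} [NormedAddCommGroup F]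
    [NormedSpace ℝ F] {f : V → F} (hf : ContDiff ℝ ∞ f) :
    ContDiff ℝ ∞ (fun γ : C(K, V) => (⟨f, hf.continuous⟩ : C(V, F)).comp γ) :=
  contDiff_infty.2 fun m => ContinuousMap.contDiff_comp_nat m (hf.of_le (by exact_mod_cast le_top))

section Flow

variable {V : Type} [NormedAddCommGroup V] [NormedSpace ℝ V]

/-- A Lipschitz vector field has at most one integral curve through each point. -/
lemma integralCurve_unique {v : V → V} {K : NNReal} (hK : LipschitzWith K v) {γ δ : ℝ → V}
    (h1 : ∀ t, HasDerivAt γ (v (γ t)) t) (h2 : ∀ t, HasDerivAt δ (v (δ t)) t) {t₀ : ℝ}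
    (h0 : γ t₀ = δ t₀) : γ = δ :=
  ODE_solution_unique_univ (v := fun _ => v) (s := fun _ => univ) (fun _ => hK.lipschitzOnWith)
    (fun t => ⟨h1 t, mem_univ _⟩) (fun t => ⟨h2 t, mem_univ _⟩) h0

lemma flow_add {v : V → V} {Φ : ℝ → V → V} {K : NNReal} (hK : LipschitzWith K v)
    (h0 : ∀ x, Φ 0 x = x)
    (hΦ : ∀ x t, HasDerivAt (fun t => Φ t x) (v (Φ t x)) t) (s t : ℝ) (x : V) :
    Φ (s + t) x = Φ s (Φ t x) := by
  have h1 : (fun s => Φ (s + t) x) = fun s => Φ s (Φ t x) :=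
    integralCurve_unique hK (fun s => (hΦ x (s + t)).comp_add_const s t) (hΦ _) (t₀ := 0)
      (by simp [h0])
  exact congrFun h1 s

variable [CompleteSpace V]

/-- The primitive vanishing at `0` of a continuous function on `[0, 1]`. -/
def primitiveCLM (V : Type) [NormedAddCommGroup V] [NormedSpace ℝ V] [CompleteSpace V] :
    C(Icc (0 : ℝ) 1, V) →L[ℝ] C(Icc (0 : ℝ) 1, V) :=
  LinearMap.mkContinuous
    { toFun := fun γ => ⟨fun t => ∫ τ in (0 : ℝ)..t, γ (projIcc 0 1 zero_le_one τ), by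
        have : Continuous fun t : ℝ => ∫ τ in (0 : ℝ)..t, γ (projIcc 0 1 zero_le_one τ) :=
          intervalIntegral.continuous_primitive (fun a b =>
            (γ.continuous.comp continuous_projIcc).intervalIntegrable a b) 0
        exact this.comp continuous_subtype_val⟩
      map_add' := fun γ δ => by
        ext t
        exact intervalIntegral.integral_add
          ((γ.continuous.comp continuous_projIcc).intervalIntegrable _ _)
          ((δ.continuous.comp continuous_projIcc).intervalIntegrable _ _)
      map_smul' := fun c γ => by
        ext t
        exact intervalIntegral.integral_smul _ _ } 1 (fun γ => by
    rw [ContinuousMap.norm_le _ (by positivity)]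
    intro t
    have h := intervalIntegral.norm_integral_le_of_norm_le_const (a := (0 : ℝ)) (b := t)
      (C := ‖γ‖) (f := fun τ => γ (projIcc 0 1 zero_le_one τ))
      (fun τ _ => γ.norm_coe_le_norm _)
    refine h.trans ?_
    rw [sub_zero, abs_of_nonneg t.2.1, one_mul]
    exact mul_le_of_le_one_right (norm_nonneg _) t.2.2)

lemma primitiveCLM_apply (γ : C(Icc (0 : ℝ) 1, V)) (t : Icc (0 : ℝ) 1) :
    primitiveCLM V γ t = ∫ τ in (0 : ℝ)..t, γ (projIcc 0 1 zero_le_one τ) := rfl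

lemma norm_primitiveCLM_le : ‖primitiveCLM V‖ ≤ 1 :=
  LinearMap.mkContinuous_norm_le _ zero_le_one _

variable {v : V → V}

/-- The integral equation of the vector field `s • v`, as a map on curves. -/
def picardMap (hv : Continuous v) (p : C(Icc (0 : ℝ) 1, V) × ℝ) : C(Icc (0 : ℝ) 1, V) × ℝ :=
  (p.1 - p.2 • primitiveCLM V ((⟨v, hv⟩ : C(V, V)).comp p.1), p.2)

lemma contDiff_picardMap (hv : ContDiff ℝ ∞ v) : ContDiff ℝ ∞ (picardMap hv.continuous) :=
  (contDiff_fst.sub (contDiff_snd.smul ((primitiveCLM V).contDiff.comp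
    ((ContinuousMap.contDiff_comp hv).comp contDiff_fst)))).prodMk contDiff_snd

/-- The integral term is Lipschitz with constant |s| K, so ‖γ - δ‖ ≤ |s| K ‖γ - δ‖ with |s| K < 1.
-/
lemma picardMap_injective {K : NNReal} (hv : Continuous v) (hK : LipschitzWith K v)
    {γ δ : C(Icc (0 : ℝ) 1, V)} {s : ℝ} (hs : |s| * K < 1)
    (h : picardMap hv (γ, s) = picardMap hv (δ, s)) : γ = δ := by
  have h1 : γ - δ = s • primitiveCLM V ((⟨v, hv⟩ : C(V, V)).comp γ - (⟨v, hv⟩ : C(V, V)).comp δ) := by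
    have := congrArg Prod.fst h
    simp only [picardMap] at this
    rw [map_sub, smul_sub, sub_eq_sub_iff_add_eq_add, add_comm γ]
    rw [sub_eq_sub_iff_add_eq_add] at this
    rw [add_comm (s • _) γ, add_comm _ δ]
    exact this
  have h2 : ‖(⟨v, hv⟩ : C(V, V)).comp γ - (⟨v, hv⟩ : C(V, V)).comp δ‖ ≤ K * ‖γ - δ‖ := by
    rw [ContinuousMap.norm_le _ (by positivity)]
    intro t
    refine (hK.norm_sub_le (γ t) (δ t)).trans ?_
    exact mul_le_mul_of_nonneg_left ((γ - δ).norm_coe_le_norm t) K.2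
  have h3 : ‖γ - δ‖ ≤ |s| * K * ‖γ - δ‖ := by
    calc ‖γ - δ‖ = |s| * ‖primitiveCLM V ((⟨v, hv⟩ : C(V, V)).comp γ - (⟨v, hv⟩ : C(V, V)).comp δ)‖ := by 
          conv_lhs => rw [h1, norm_smul, Real.norm_eq_abs]
      _ ≤ |s| * (1 * (K * ‖γ - δ‖)) := by
        gcongr
        exact (ContinuousLinearMap.le_opNorm _ _).trans (mul_le_mul norm_primitiveCLM_le h2
          (norm_nonneg _) zero_le_one)
      _ = _ := by ring
  have h4 : ‖γ - δ‖ = 0 := by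
    by_contra hne
    have : 0 < ‖γ - δ‖ := lt_of_le_of_ne (norm_nonneg _) (Ne.symm hne)
    nlinarith
  exact sub_eq_zero.1 (norm_eq_zero.1 h4)

/-- The derivative is block triangular, (h, τ) ↦ ((1 - s P M) h - τ b, τ), with P integration and M
multiplication by v' ∘ γ. Since ‖s P M‖ < 1, the block 1 - s P M is inverted by a Neumann series. -/
lemma exists_hasFDerivAt_picardMap {K : NNReal} (hv : ContDiff ℝ ∞ v) (hK : LipschitzWith K v)
    (γ : C(Icc (0 : ℝ) 1, V)) {s : ℝ} (hs : |s| * K < 1) :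
    ∃ e : (C(Icc (0 : ℝ) 1, V) × ℝ) ≃L[ℝ] (C(Icc (0 : ℝ) 1, V) × ℝ),
      HasFDerivAt (picardMap hv.continuous) (e : _ →L[ℝ] _) (γ, s) := by
  have hc' : Continuous (fderiv ℝ v) := hv.continuous_fderiv (by simp)
  have hd := ContinuousMap.hasFDerivAt_comp (K := Icc (0 : ℝ) 1) (hv.differentiable (by simp))
    hv.continuous hc' γ
  set M := ContinuousMap.applyCLM (Icc (0 : ℝ) 1) V V
    ((⟨fderiv ℝ v, hc'⟩ : C(V, V →L[ℝ] V)).comp γ) with hM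
  set P := primitiveCLM V
  set b := P ((⟨v, hv.continuous⟩ : C(V, V)).comp γ) with hb
  have hMn : ‖M‖ ≤ K := by
    refine ContinuousLinearMap.opNorm_le_bound _ K.2 fun h => ?_
    refine (ContinuousMap.norm_le _ (mul_nonneg K.2 (norm_nonneg h))).2 fun t => ?_
    exact ((fderiv ℝ v (γ t)).le_opNorm _).trans (mul_le_mul (norm_fderiv_le_of_lipschitz ℝ hK)
      (h.norm_coe_le_norm t) (norm_nonneg _) K.2)
  have hn : ‖s • P.comp M‖ < 1 := by
    refine lt_of_le_of_lt (ContinuousLinearMap.opNorm_le_bound _ (by positivity) fun h => ?_) hs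
    change ‖s • P (M h)‖ ≤ _
    rw [norm_smul, Real.norm_eq_abs, mul_assoc]
    refine mul_le_mul_of_nonneg_left ?_ (abs_nonneg s)
    calc ‖P (M h)‖ ≤ 1 * ‖M h‖ := P.le_of_opNorm_le norm_primitiveCLM_le _
      _ ≤ K * ‖h‖ := by rw [one_mul]; exact M.le_of_opNorm_le hMn _
  set A : C(Icc (0 : ℝ) 1, V) ≃L[ℝ] C(Icc (0 : ℝ) 1, V) :=
    ContinuousLinearEquiv.unitsEquiv ℝ _ (Units.oneSub (s • P.comp M) hn) with hA
  have hAapp : ∀ h, A h = h - s • P (M h) := fun h => rfl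
  have hD : HasFDerivAt (picardMap hv.continuous)
      ((((A : C(Icc (0 : ℝ) 1, V) →L[ℝ] C(Icc (0 : ℝ) 1, V)).comp
        (ContinuousLinearMap.fst ℝ _ ℝ)) - (ContinuousLinearMap.snd ℝ C(Icc (0 : ℝ) 1, V) ℝ).smulRight b).prod
          (ContinuousLinearMap.snd ℝ _ ℝ)) (γ, s) := by
    have h1 : HasFDerivAt (fun p : C(Icc (0 : ℝ) 1, V) × ℝ =>
        P ((⟨v, hv.continuous⟩ : C(V, V)).comp p.1))
        (P.comp (M.comp (ContinuousLinearMap.fst ℝ _ ℝ))) (γ, s) :=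
      P.hasFDerivAt.comp (γ, s) (HasFDerivAt.comp (f := Prod.fst) (γ, s) hd hasFDerivAt_fst)
    have h2 := (hasFDerivAt_fst (𝕜 := ℝ) (p := (γ, s))).sub
      ((hasFDerivAt_snd (𝕜 := ℝ) (p := (γ, s))).smul h1)
    refine (h2.prodMk hasFDerivAt_snd).congr_fderiv ?_
    refine ContinuousLinearMap.ext fun p => Prod.ext ?_ rfl
    change p.1 - (s • P (M p.1) + p.2 • b) = A p.1 - p.2 • b
    rw [hAapp]; abel
  refine ⟨ContinuousLinearEquiv.equivOfInverse
    (((A : C(Icc (0 : ℝ) 1, V) →L[ℝ] C(Icc (0 : ℝ) 1, V)).comp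
        (ContinuousLinearMap.fst ℝ _ ℝ) -
        (ContinuousLinearMap.snd ℝ C(Icc (0 : ℝ) 1, V) ℝ).smulRight b).prod
          (ContinuousLinearMap.snd ℝ _ ℝ))
    ((((A.symm : C(Icc (0 : ℝ) 1, V) →L[ℝ] C(Icc (0 : ℝ) 1, V)).comp
      (ContinuousLinearMap.fst ℝ _ ℝ + (ContinuousLinearMap.snd ℝ C(Icc (0 : ℝ) 1, V) ℝ).smulRight b))).prod
          (ContinuousLinearMap.snd ℝ _ ℝ)) ?_ ?_, hD⟩
  · intro p
    refine Prod.ext ?_ rfl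
    change A.symm ((A p.1 - p.2 • b) + p.2 • b) = p.1
    simp
  · intro p
    refine Prod.ext ?_ rfl
    change A (A.symm (p.1 + p.2 • b)) - p.2 • b = p.1
    simp

variable {Φ : ℝ → V → V}

/-- As v is bounded by L, Picard–Lindelöf works on [-T, T] with the ball of radius L T, for every T;
the solutions agree on overlaps by uniqueness. -/
lemma exists_flow {L K : NNReal} (hL : ∀ x, ‖v x‖ ≤ L) (hK : LipschitzWith K v) (x : V) :
    ∃ γ : ℝ → V, γ 0 = x ∧ ∀ t, HasDerivAt γ (v (γ t)) t := by
  have hloc : ∀ T : ℝ, 0 < T → ∃ γ : ℝ → V, γ 0 = x ∧ ∀ t ∈ Ioo (-T) T, HasDerivAt γ (v (γ t)) t := by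
    intro T hT
    have h0 : (0 : ℝ) ∈ Icc (-T) T := ⟨by linarith, hT.le⟩
    have hP : IsPicardLindelof (fun _ => v) (⟨0, h0⟩ : Icc (-T) T) x
        (L * T.toNNReal) 0 L K :=
      .of_time_independent (fun y _ => hL y) hK.lipschitzOnWith (by
          simp [hT.le])
    obtain ⟨γ, h1, h2⟩ := hP.exists_eq_forall_mem_Icc_hasDerivWithinAt₀
    exact ⟨γ, h1, fun t ht => (h2 t ⟨ht.1.le, ht.2.le⟩).hasDerivAt (Icc_mem_nhds ht.1 ht.2)⟩
  choose! γ hγ0 hγ using hloc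
  have hagree : ∀ S T t : ℝ, |t| < S → |t| < T → γ S t = γ T t := by
    intro S T t hS hT
    have hS0 := (abs_nonneg t).trans_lt hS
    have hT0 := (abs_nonneg t).trans_lt hT
    have hm : 0 < min S T := lt_min hS0 hT0
    refine ODE_solution_unique_of_mem_Ioo (v := fun _ => v) (s := fun _ => univ)
      (fun _ _ => hK.lipschitzOnWith) (a := -min S T) (b := min S T) (t₀ := 0)
      ⟨by linarith, hm⟩ (fun t ht => ⟨hγ S hS0 t ?_, mem_univ _⟩)
      (fun t ht => ⟨hγ T hT0 t ?_, mem_univ _⟩) ?_ ?_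
    · exact ⟨(neg_le_neg (min_le_left _ _)).trans_lt ht.1, ht.2.trans_le (min_le_left _ _)⟩
    · exact ⟨(neg_le_neg (min_le_right _ _)).trans_lt ht.1, ht.2.trans_le (min_le_right _ _)⟩
    · rw [hγ0 S hS0, hγ0 T hT0]
    · exact abs_lt.1 (lt_min hS hT)
  -- The solution read off at t depends on t through its interval; near t it coincides with the
  -- single solution for the bound |t| + 2, which is differentiable there.
  refine ⟨fun t => γ (|t| + 1) t, hγ0 _ (by positivity), fun t => ?_⟩
  have h1 : HasDerivAt (γ (|t| + 2)) (v (γ (|t| + 2) t)) t :=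
    hγ _ (by positivity) t (abs_lt.1 (by linarith))
  have h2 : ∀ᶠ s in nhds t, γ (|s| + 1) s = γ (|t| + 2) s := by
    have : ∀ᶠ s in nhds t, |s| < |t| + 1 := continuous_abs.continuousAt.eventually_lt
      continuousAt_const (by linarith)
    filter_upwards [this] with s hs
    exact hagree _ _ s (by linarith) (by linarith)
  have h3 := h1.congr_of_eventuallyEq h2
  rwa [← h2.self_of_nhds] at h3

/-- The rescaled orbit τ ↦ Φ (s τ) x on [0, 1] is sent by `picardMap` to (constant x, s). The
inverse function theorem in the space of curves supplies a smooth local inverse; by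
`picardMap_injective` it returns the orbit, and evaluation at τ = 1 recovers Φ s x. -/
lemma flow_contDiffAt_of_small {K : NNReal} (hv : ContDiff ℝ ∞ v) (hK : LipschitzWith K v)
    (h0 : ∀ x, Φ 0 x = x) (hΦ : ∀ x t, HasDerivAt (fun t => Φ t x) (v (Φ t x)) t)
    {s : ℝ} (hs : |s| * K < 1) (x : V) :
    ContDiffAt ℝ ∞ (fun p : ℝ × V => Φ p.1 p.2) (s, x) := by
  have hcont : ∀ x, Continuous fun t => Φ t x := fun x =>
    continuous_iff_continuousAt.2 fun t => (hΦ x t).continuousAt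
  let c : ℝ → V → C(Icc (0 : ℝ) 1, V) := fun s x =>
    ⟨fun t => Φ (s * t) x, (hcont x).comp (by fun_prop)⟩
  have hc : ∀ s x, picardMap hv.continuous (c s x, s) = (ContinuousMap.const _ x, s) := by
    intro s x
    refine Prod.ext ?_ rfl
    ext t
    have h1 : ∀ τ ∈ uIcc (0 : ℝ) t, HasDerivAt (fun τ => Φ (s * τ) x) (s • v (Φ (s * τ) x)) τ := by
      intro τ _
      have := HasDerivAt.scomp (h := fun τ : ℝ => s * τ) τ (hΦ x (s * τ))
        (by simpa using (hasDerivAt_id τ).const_mul s)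
      exact this
    have h2 := intervalIntegral.integral_eq_sub_of_hasDerivAt h1
      ((continuous_const.smul (hv.continuous.comp ((hcont x).comp (by fun_prop)))).intervalIntegrable _ _)
    have h3 : ∫ τ in (0 : ℝ)..t, s • v (Φ (s * τ) x) =
        s • primitiveCLM V ((⟨v, hv.continuous⟩ : C(V, V)).comp (c s x)) t := by
      rw [primitiveCLM_apply, ← intervalIntegral.integral_smul]
      refine intervalIntegral.integral_congr fun τ hτ => ?_
      rw [uIcc_of_le t.2.1] at hτ
      have : (projIcc (0 : ℝ) 1 zero_le_one τ : ℝ) = τ := by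
        rw [projIcc_of_mem _ ⟨hτ.1, hτ.2.trans t.2.2⟩]
      simp [c, this]
    rw [h3, mul_zero, h0] at h2
    change Φ (s * t) x - s • _ = x
    rw [h2]; abel
  obtain ⟨e, he⟩ := exists_hasFDerivAt_picardMap hv hK (c s x) hs
  have hG := (contDiff_picardMap hv).contDiffAt (x := (c s x, s))
  have hinf : (∞ : WithTop ℕ∞) ≠ 0 := by simp
  have hinv := hG.to_localInverse he hinf
  rw [hc] at hinv
  have hright : ∀ᶠ y in nhds (picardMap hv.continuous (c s x, s)),
      picardMap hv.continuous (hG.localInverse he hinf y) = y :=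
    (hG.hasStrictFDerivAt' he hinf).eventually_right_inverse
  rw [hc] at hright
  have hι : ContDiff ℝ ∞ (fun p : ℝ × V => ((ContinuousMap.const (Icc (0 : ℝ) 1) p.2, p.1) :
      C(Icc (0 : ℝ) 1, V) × ℝ)) := by
    have : ContDiff ℝ ∞ (fun y : V => ContinuousMap.const (Icc (0 : ℝ) 1) y) :=
      (ContinuousLinearMap.contDiff (𝕜 := ℝ) (LinearMap.mkContinuous
        { toFun := fun y : V => ContinuousMap.const (Icc (0 : ℝ) 1) y
          map_add' := fun _ _ => rfl
          map_smul' := fun _ _ => rfl } 1 (fun y => by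
            rw [ContinuousMap.norm_le _ (by positivity)]
            intro t; rw [one_mul]; exact le_rfl)))
    exact (this.comp contDiff_snd).prodMk contDiff_fst
  have heq : (fun p : ℝ × V => Φ p.1 p.2) =ᶠ[nhds (s, x)] fun p =>
      ContinuousMap.evalCLM ℝ (⟨1, by simp⟩ : Icc (0 : ℝ) 1)
        (hG.localInverse he hinf (ContinuousMap.const _ p.2, p.1)).1 := by
    have hr : ∀ᶠ p : ℝ × V in nhds (s, x), picardMap hv.continuous
        (hG.localInverse he hinf (ContinuousMap.const _ p.2, p.1)) =
        (ContinuousMap.const _ p.2, p.1) :=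
      (hι.continuous.continuousAt (x := (s, x))).eventually hright
    have hr2 : ∀ᶠ p : ℝ × V in nhds (s, x), |p.1| * K < 1 :=
      ContinuousAt.eventually_lt (by fun_prop) continuousAt_const hs
    filter_upwards [hr, hr2] with p hp hp2
    set w := hG.localInverse he hinf (ContinuousMap.const _ p.2, p.1) with hw
    have h2 : w.2 = p.1 := congrArg Prod.snd hp
    have h3 : w = (w.1, p.1) := Prod.ext rfl h2
    have h4 : w.1 = c p.1 p.2 := picardMap_injective hv.continuous hK hp2
      (by rw [← h3, hp, hc])
    rw [h4]
    simp [c]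
  refine ContDiffAt.congr_of_eventuallyEq ?_ heq
  exact (ContinuousMap.evalCLM ℝ _).contDiff.contDiffAt.comp (s, x)
    (contDiffAt_fst.comp (s, x) (hinv.comp (s, x) hι.contDiffAt))

/-- The flow of a smooth bounded Lipschitz vector field is smooth. -/
theorem exists_smooth_flow {L K : NNReal} (hv : ContDiff ℝ ∞ v) (hL : ∀ x, ‖v x‖ ≤ L)
    (hK : LipschitzWith K v) :
    ∃ Φ : ℝ → V → V, ContDiff ℝ ∞ (fun p : ℝ × V => Φ p.1 p.2) ∧ (∀ x, Φ 0 x = x) ∧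
      ∀ x t, HasDerivAt (fun t => Φ t x) (v (Φ t x)) t := by
  choose Ψ hΨ0 hΨ using exists_flow hL hK
  let Φ : ℝ → V → V := fun t x => Ψ x t
  have h0 : ∀ x, Φ 0 x = x := hΨ0
  have hΦ : ∀ x t, HasDerivAt (fun t => Φ t x) (v (Φ t x)) t := hΨ
  refine ⟨Φ, ?_, h0, hΦ⟩
  have hsmall := fun (s : ℝ) (hs : |s| * K < 1) x => flow_contDiffAt_of_small hv hK h0 hΦ hs x
  have hmap : ∀ s : ℝ, |s| * K < 1 → ContDiff ℝ ∞ (Φ s) := fun s hs =>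
    contDiff_iff_contDiffAt.2 fun x => (hsmall s hs x).comp (f := fun y : V => (s, y)) x
      (contDiffAt_const.prodMk contDiffAt_id)
  -- Longer times are reached by iterating a short-time map.
  have hnat : ∀ (s : ℝ) (_ : |s| * K < 1) (m : ℕ), ContDiff ℝ ∞ (Φ (m * s)) := by
    intro s hs m
    induction m with
    | zero =>
      have : Φ ((0 : ℕ) * s) = id := by ext1 x; simp [h0]
      rw [this]; exact contDiff_id
    | succ m ih =>
      have : Φ ((m + 1 : ℕ) * s) = Φ s ∘ Φ (m * s) := by
        ext1 x
        rw [Function.comp_apply, ← flow_add hK h0 hΦ]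
        congr 1; push_cast; ring
      rw [this]; exact (hmap s hs).comp ih
  have hall : ∀ s : ℝ, ContDiff ℝ ∞ (Φ s) := by
    intro s
    obtain ⟨m, hm⟩ := exists_nat_gt (|s| * K)
    have hm0 : (0 : ℝ) < m := lt_of_le_of_lt (by positivity) hm
    have := hnat (s / m) (by
      rw [abs_div, abs_of_pos hm0, div_mul_eq_mul_div, div_lt_one hm0]; exact hm) m
    rwa [mul_div_cancel₀ _ hm0.ne'] at this
  rw [contDiff_iff_contDiffAt]
  rintro ⟨s, x⟩
  -- Joint smoothness near time s: apply the smooth map Φ s first, so that only the small time p.1 -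
  -- s remains.
  have : (fun p : ℝ × V => Φ p.1 p.2) = fun p => Φ (p.1 - s) (Φ s p.2) := by
    ext1 p
    rw [← flow_add hK h0 hΦ, sub_add_cancel]
  rw [this]
  refine ContDiffAt.comp (f := fun p : ℝ × V => (p.1 - s, Φ s p.2))
    (g := fun p : ℝ × V => Φ p.1 p.2) (s, x) ?_ ?_
  · exact hsmall _ (by simp) _
  · exact (contDiffAt_fst.sub contDiffAt_const).prodMk
      ((hall s).contDiffAt.comp (s, x) contDiffAt_snd)

end Flow

/-! ### Homogeneous symplectic maps and contactomorphisms of the projective space -/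

section Liouville

variable {n : ℕ}

/-- Multiplication by `i` on `ℝ²ⁿ = ℂⁿ`. -/
def symplJ (n : ℕ) : PhaseSpace n →L[ℝ] PhaseSpace n :=
  LinearMap.toContinuousLinearMap
    { toFun := fun z => WithLp.toLp 2 (Sum.elim (fun j => -z (Sum.inr j)) (fun j => z (Sum.inl j)))
      map_add' := fun z w => by
        ext i; rcases i with i | i <;> simp [add_comm]
      map_smul' := fun c z => by
        ext i; rcases i with i | i <;> simp }

@[simp] lemma symplJ_inl (z : PhaseSpace n) (j : Fin n) :
    symplJ n z (Sum.inl j) = -z (Sum.inr j) := rfl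

@[simp] lemma symplJ_inr (z : PhaseSpace n) (j : Fin n) :
    symplJ n z (Sum.inr j) = z (Sum.inl j) := rfl

@[simp] lemma symplJ_symplJ (z : PhaseSpace n) : symplJ n (symplJ n z) = -z := by
  ext i; rcases i with i | i <;> simp

lemma inner_phaseSpace (z w : PhaseSpace n) : ⟪z, w⟫ =
    ∑ j : Fin n, (z (Sum.inl j) * w (Sum.inl j) + z (Sum.inr j) * w (Sum.inr j)) := by
  rw [PiLp.inner_apply, Fintype.sum_sum_type, ← Finset.sum_add_distrib]
  simp [mul_comm]

lemma inner_symplJ_left (z w : PhaseSpace n) : ⟪symplJ n z, w⟫ = -⟪z, symplJ n w⟫ := by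
  rw [inner_phaseSpace, inner_phaseSpace, ← Finset.sum_neg_distrib]
  refine Finset.sum_congr rfl fun j _ => ?_
  simp only [symplJ_inl, symplJ_inr]; ring

lemma inner_symplJ_symplJ (z w : PhaseSpace n) : ⟪symplJ n z, symplJ n w⟫ = ⟪z, w⟫ := by
  rw [inner_symplJ_left, symplJ_symplJ, inner_neg_right, neg_neg]

lemma inner_symplJ_self (z : PhaseSpace n) : ⟪symplJ n z, z⟫ = 0 := by
  have := inner_symplJ_left z z
  rw [real_inner_comm (symplJ n z) z] at this
  linarith

lemma liouvilleForm_eq (z w : PhaseSpace n) : liouvilleForm z w = 1 / 2 * ⟪symplJ n z, w⟫ := by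
  rw [liouvilleForm_apply, inner_phaseSpace]
  congr 1
  refine Finset.sum_congr rfl fun j _ => ?_
  simp only [symplJ_inl, symplJ_inr]; ring

lemma liouvilleForm_self (z : PhaseSpace n) : liouvilleForm z z = 0 := by
  rw [liouvilleForm_eq, inner_symplJ_self, mul_zero]

lemma liouvilleForm_smul (c : ℝ) (z w : PhaseSpace n) :
    liouvilleForm (c • z) w = c * liouvilleForm z w := by
  rw [liouvilleForm_eq, liouvilleForm_eq, map_smul, inner_smul_left]; simp; ring

end Liouville

/-! ### Radial projection to the sphere and the contact form -/

section Normalize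

variable {n : ℕ}

lemma contDiffAt_normalization {z : PhaseSpace n} (hz : z ≠ 0) :
    ContDiffAt ℝ ∞ (fun z : PhaseSpace n => ‖z‖⁻¹ • z) z :=
  ((contDiffAt_norm ℝ hz).inv (norm_ne_zero_iff.2 hz)).smul contDiffAt_id

/-- The differential of the radial projection, up to radial vectors. -/
lemma liouvilleForm_fderiv_normalization {z : PhaseSpace n} (hz : z ≠ 0) (v : PhaseSpace n) :
    liouvilleForm (‖z‖⁻¹ • z) (fderiv ℝ (fun z : PhaseSpace n => ‖z‖⁻¹ • z) z v) =
      (‖z‖ ^ 2)⁻¹ * liouvilleForm z v := by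
  have h1 : DifferentiableAt ℝ (fun z : PhaseSpace n => ‖z‖⁻¹) z :=
    ((contDiffAt_norm ℝ hz).inv (norm_ne_zero_iff.2 hz)).differentiableAt (n := ∞) (by simp)
  have h2 := (h1.hasFDerivAt.smul (hasFDerivAt_id z)).fderiv
  have h3 : fderiv ℝ (fun z : PhaseSpace n => ‖z‖⁻¹ • z) z v =
      ‖z‖⁻¹ • v + (fderiv ℝ (fun z : PhaseSpace n => ‖z‖⁻¹) z v) • z := by
    have := congrArg (fun C => C v) h2
    simpa using! this
  -- The derivative of the factor ‖z‖⁻¹ contributes a multiple of z, which λ₀ annihilates at z.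
  rw [h3, liouvilleForm_smul, map_add, map_smul, map_smul, liouvilleForm_self]
  simp only [smul_eq_mul, mul_zero, add_zero]
  ring

variable [NeZero n]

local notation "𝓜" => 𝓡 (2 * n - 1)

/-- The radial projection onto the unit sphere (with an arbitrary value at the origin). -/
def toUSphere (z : PhaseSpace n) : USphere n :=
  if h : z ≠ 0 then ⟨‖z‖⁻¹ • z, by simp [norm_smul, h]⟩ else northPole n

lemma coe_toUSphere {z : PhaseSpace n} (hz : z ≠ 0) : (toUSphere z : PhaseSpace n) = ‖z‖⁻¹ • z := by
  rw [toUSphere, dif_pos hz]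

lemma toUSphere_coe (x : USphere n) : toUSphere (x : PhaseSpace n) = x := by
  refine Subtype.ext ?_
  rw [coe_toUSphere (ne_zero_of_mem_unit_sphere x), norm_eq_of_mem_sphere x, inv_one, one_smul]

lemma mk_toUSphere_smul {c : ℝ} (hc : c ≠ 0) (z : PhaseSpace n) :
    RP.mk (toUSphere (c • z)) = RP.mk (toUSphere z) := by
  by_cases hz : z = 0
  · rw [hz, smul_zero]
  rw [RP.mk_eq_mk]
  have h1 : c • z ≠ 0 := smul_ne_zero hc hz
  have h2 : (toUSphere (c • z) : PhaseSpace n) = (|c|⁻¹ * c) • (toUSphere z : PhaseSpace n) := by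
    rw [coe_toUSphere h1, coe_toUSphere hz, norm_smul, Real.norm_eq_abs, smul_smul, smul_smul,
      mul_inv]
    congr 1; ring
  rcases hc.lt_or_gt with h | h
  · right
    refine Subtype.ext ?_
    rw [h2, abs_of_neg h, coe_neg_sphere, inv_neg, neg_mul, inv_mul_cancel₀ hc, neg_one_smul]
  · left
    refine Subtype.ext ?_
    rw [h2, abs_of_pos h, inv_mul_cancel₀ hc, one_smul]

/-- The bump χ replaces the identity by a map g equal to it near z and nowhere zero: g w lies on the
segment from z to w and leaves z only if ‖w - z‖ < ‖z‖ / 2. Thus g can be normalized globally, as a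
smooth map with values in the sphere. -/
lemma contMDiffAt_toUSphere {z : PhaseSpace n} (hz : z ≠ 0) :
    ContMDiffAt 𝓘(ℝ, PhaseSpace n) 𝓜 ∞ (toUSphere (n := n)) z := by
  have hz' : 0 < ‖z‖ := norm_pos_iff.2 hz
  let χ : ContDiffBump z := ⟨‖z‖ / 4, ‖z‖ / 2, by linarith, by linarith⟩
  let g : PhaseSpace n → PhaseSpace n := fun w => z + χ w • (w - z)
  have hg : ContDiff ℝ ∞ g :=
    contDiff_const.add (χ.contDiff.smul (contDiff_id.sub contDiff_const))
  have hg0 : ∀ w, g w ≠ 0 := by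
    intro w hw
    have h1 : ‖χ w • (w - z)‖ = ‖z‖ := by
      have : χ w • (w - z) = -z := by rw [eq_neg_iff_add_eq_zero, add_comm]; exact hw
      rw [this, norm_neg]
    rw [norm_smul, Real.norm_eq_abs, abs_of_nonneg (χ.nonneg)] at h1
    by_cases hd : ‖w - z‖ < ‖z‖ / 2
    · have := mul_le_of_le_one_left (norm_nonneg (w - z)) (χ.le_one (x := w))
      linarith
    · rw [χ.zero_of_le_dist (by rw [dist_eq_norm]; exact not_lt.1 hd), zero_mul] at h1
      exact hz'.ne h1
  have hN : ContDiff ℝ ∞ fun w => ‖g w‖⁻¹ • g w := contDiff_iff_contDiffAt.2 fun w =>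
    (contDiffAt_normalization (hg0 w)).comp w hg.contDiffAt
  have hs : ∀ w, ‖g w‖⁻¹ • g w ∈ sphere (0 : PhaseSpace n) 1 := fun w => by
    simp [norm_smul, hg0 w]
  have := (hN.contMDiff.codRestrict_sphere (n := 2 * n - 1) hs).contMDiffAt (x := z)
  refine this.congr_of_eventuallyEq ?_
  filter_upwards [χ.eventuallyEq_one] with w hw
  have h1 : g w = w := by simp [g, hw]
  refine Subtype.ext ?_
  rw [coe_toUSphere (by rw [← h1]; exact hg0 w)]
  simp [h1]

variable {F : Type*} [NormedAddCommGroup F] [NormedSpace ℝ F] {H : Type*} [TopologicalSpace H]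
  {I : ModelWithCorners ℝ F H} {M : Type*} [TopologicalSpace M] [ChartedSpace H M]

/-- The value of the contact form on the image of a tangent vector under the projection
`ℝ²ⁿ ∖ 0 → ℝP²ⁿ⁻¹`. -/
lemma stdForm_mfderiv_mk_toUSphere {g : M → PhaseSpace n} {y : M}
    (hg : MDifferentiableAt I 𝓘(ℝ, PhaseSpace n) g y) (h0 : g y ≠ 0) (v : TangentSpace I y) :
    stdForm (RP.mk (toUSphere (g y))) (mfderiv I 𝓜 (fun y => RP.mk (toUSphere (g y))) y v) =
      (‖g y‖ ^ 2)⁻¹ * liouvilleForm (g y) (mvfderiv I g y v) := by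
  have hn : MDifferentiableAt I 𝓜 (fun y => toUSphere (g y)) y :=
    ((contMDiffAt_toUSphere h0).mdifferentiableAt (by simp)).comp y hg
  have hmk : MDifferentiableAt 𝓜 𝓜 (RP.mk (n := n)) (toUSphere (g y)) :=
    RP.contMDiff_mk.mdifferentiable (by simp) _
  have h1 : mfderiv I 𝓜 (fun y => RP.mk (toUSphere (g y))) y v =
      mfderiv 𝓜 𝓜 RP.mk (toUSphere (g y)) (mfderiv I 𝓜 (fun y => toUSphere (g y)) y v) :=
    congrArg (fun C => C v) (mfderiv_comp y hmk hn)
  rw [h1, stdForm_mfderiv_mk]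
  have hval : MDifferentiableAt 𝓜 𝓘(ℝ, PhaseSpace n) (Subtype.val : USphere n → PhaseSpace n)
      (toUSphere (g y)) := (contMDiff_coe_sphere (m := ∞)).mdifferentiable (by simp) _
  have h2 : mvfderiv 𝓜 (Subtype.val : USphere n → PhaseSpace n) (toUSphere (g y))
      (mfderiv I 𝓜 (fun y => toUSphere (g y)) y v) =
      mvfderiv I (fun y => (toUSphere (g y) : PhaseSpace n)) y v :=
    (congrArg (fun C => C v) (mfderiv_comp y hval hn)).symm
  have hd : DifferentiableAt ℝ (fun z : PhaseSpace n => ‖z‖⁻¹ • z) (g y) :=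
    (contDiffAt_normalization h0).differentiableAt (by simp)
  have h3 : mvfderiv I (fun y => (toUSphere (g y) : PhaseSpace n)) y v =
      fderiv ℝ (fun z : PhaseSpace n => ‖z‖⁻¹ • z) (g y) (mvfderiv I g y v) := by
    have he : (fun y => (toUSphere (g y) : PhaseSpace n)) =ᶠ[nhds y]
        (fun z : PhaseSpace n => ‖z‖⁻¹ • z) ∘ g := by
      filter_upwards [hg.continuousAt.eventually_ne h0] with w hw
      exact coe_toUSphere hw
    have h4 := he.mfderiv_eq (I := I) (I' := 𝓘(ℝ, PhaseSpace n))
    have h5 := mfderiv_comp y hd.mdifferentiableAt hg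
    rw [mfderiv_eq_fderiv] at h5
    exact (congrArg (fun C : TangentSpace I y →L[ℝ] PhaseSpace n => C v) h4).trans
      (congrArg (fun C : TangentSpace I y →L[ℝ] PhaseSpace n => C v) h5)
  change liouvilleForm (toUSphere (g y) : PhaseSpace n)
    (mvfderiv 𝓜 (Subtype.val : USphere n → PhaseSpace n) (toUSphere (g y))
      (mfderiv I 𝓜 (fun y => toUSphere (g y)) y v)) = _
  rw [h2, h3, coe_toUSphere h0, liouvilleForm_fderiv_normalization h0]

end Normalize

/-! ### Homogeneous symplectic maps and the contactomorphisms they induce -/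

section HomSymp

/-- The group of positively and negatively homogeneous symplectic maps of `ℝ²ⁿ`: the bijections which
are smooth away from the origin, commute with scalars and preserve the Liouville form. -/
def homSympSubgroup (n : ℕ) : Subgroup (Equiv.Perm (PhaseSpace n)) where
  carrier := {f | ContDiffOn ℝ ∞ f {0}ᶜ ∧ ContDiffOn ℝ ∞ f.symm {0}ᶜ ∧
    (∀ (c : ℝ) z, f (c • z) = c • f z) ∧
    ∀ z, z ≠ 0 → ∀ w, liouvilleForm (f z) (fderiv ℝ f z w) = liouvilleForm z w}
  one_mem' := ⟨contDiffOn_id, contDiffOn_id, fun _ _ => rfl, fun z _ w => by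
    change liouvilleForm z (fderiv ℝ id z w) = _
    rw [fderiv_id]; rfl⟩
  mul_mem' := by
    rintro f g ⟨h1, h2, h3, h4⟩ ⟨k1, k2, k3, k4⟩
    have hne : ∀ (f : Equiv.Perm (PhaseSpace n)) (_ : ∀ (c : ℝ) z, f (c • z) = c • f z) (z),
        z ≠ 0 → f z ≠ 0 := fun f h z hz h0 => hz (f.injective (by
      rw [h0]; simpa using (h 0 0).symm))
    have hs : ∀ (c : ℝ) z, f.symm (c • z) = c • f.symm z := fun c z => by
      rw [Equiv.symm_apply_eq, h3, Equiv.apply_symm_apply]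
    refine ⟨h1.comp k1 fun z hz => hne g k3 z hz, k2.comp h2 fun z hz => hne f.symm hs z hz,
      fun c z => by simp [h3, k3], fun z hz w => ?_⟩
    have hg := (k1.contDiffAt (isOpen_compl_singleton.mem_nhds hz)).differentiableAt (by simp)
    have hf := (h1.contDiffAt (isOpen_compl_singleton.mem_nhds (hne g k3 z hz))).differentiableAt
      (by simp)
    change liouvilleForm (f (g z)) (fderiv ℝ (f ∘ g) z w) = _
    rw [fderiv_comp z hf hg, ContinuousLinearMap.comp_apply, h4 _ (hne g k3 z hz), k4 z hz]
  inv_mem' := by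
    rintro f ⟨h1, h2, h3, h4⟩
    have hs : ∀ (c : ℝ) z, f.symm (c • z) = c • f.symm z := fun c z => by
      rw [Equiv.symm_apply_eq, h3, Equiv.apply_symm_apply]
    have hne : ∀ z, z ≠ 0 → f.symm z ≠ 0 := fun z hz h0 => hz (f.symm.injective (by
      rw [h0]; simpa using (hs 0 0).symm))
    refine ⟨h2, h1, hs, fun z hz w => ?_⟩
    have hg := (h2.contDiffAt (isOpen_compl_singleton.mem_nhds hz)).differentiableAt (by simp)
    have hf := (h1.contDiffAt (isOpen_compl_singleton.mem_nhds (hne z hz))).differentiableAt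
      (by simp)
    change liouvilleForm (f.symm z) (fderiv ℝ f.symm z w) = _
    rw [← h4 _ (hne z hz), f.apply_symm_apply]
    have h5 := fderiv_comp z hf hg
    have h6 : (f ∘ f.symm) = id := by ext1; simp
    rw [h6, fderiv_id] at h5
    have h7 := congrArg (fun C => C w) h5
    exact congrArg _ h7.symm

/-- The homogeneous symplectic maps of `ℝ²ⁿ`. -/
abbrev HomSymp (n : ℕ) : Type := homSympSubgroup n

variable {n : ℕ}

namespace HomSymp

instance : CoeFun (HomSymp n) fun _ => PhaseSpace n → PhaseSpace n := ⟨fun f => (f : Equiv.Perm _)⟩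

variable (f g : HomSymp n)

@[simp] lemma mul_apply (z : PhaseSpace n) : (f * g) z = f (g z) := rfl
@[simp] lemma one_apply (z : PhaseSpace n) : (1 : HomSymp n) z = z := rfl
@[simp] lemma inv_apply_self (z : PhaseSpace n) : f⁻¹ (f z) = z := Equiv.symm_apply_apply _ _
@[simp] lemma apply_inv_self (z : PhaseSpace n) : f (f⁻¹ z) = z := Equiv.apply_symm_apply _ _
lemma contDiffOn : ContDiffOn ℝ ∞ f {0}ᶜ := f.2.1
lemma map_smul (c : ℝ) (z : PhaseSpace n) : f (c • z) = c • f z := f.2.2.2.1 c z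
lemma liouville {z : PhaseSpace n} (hz : z ≠ 0) (w : PhaseSpace n) :
    liouvilleForm (f z) (fderiv ℝ f z w) = liouvilleForm z w := f.2.2.2.2 z hz w
@[simp] lemma map_zero : f 0 = 0 := by simpa using f.map_smul 0 0
lemma map_ne_zero {z : PhaseSpace n} (hz : z ≠ 0) : f z ≠ 0 := fun h =>
  hz ((f : Equiv.Perm _).injective (h.trans f.map_zero.symm))
lemma contDiffAt {z : PhaseSpace n} (hz : z ≠ 0) : ContDiffAt ℝ ∞ f z :=
  f.contDiffOn.contDiffAt (isOpen_compl_singleton.mem_nhds hz)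
lemma differentiableAt {z : PhaseSpace n} (hz : z ≠ 0) : DifferentiableAt ℝ f z :=
  (f.contDiffAt hz).differentiableAt (by simp)

variable {f g}

lemma ext {f g : HomSymp n} (h : ∀ z, f z = g z) : f = g := Subtype.ext (Equiv.ext h)

end HomSymp

variable [NeZero n]

local notation "𝓜" => 𝓡 (2 * n - 1)

namespace HomSymp

/-- The transformation of the projective space induced by a homogeneous map. -/
def projFun (f : HomSymp n) (p : RP n) : RP n := RP.mk (toUSphere (f p.rep))

/-- The chosen representative is a non-zero multiple of z, of either sign, and f commutes with real
scalars. -/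
lemma projFun_mk (f : HomSymp n) {z : PhaseSpace n} (hz : z ≠ 0) :
    f.projFun (RP.mk (toUSphere z)) = RP.mk (toUSphere (f z)) := by
  rw [projFun]
  have h1 := RP.mk_eq_mk.1 (RP.mk_rep (RP.mk (toUSphere z)))
  have h2 : ∃ c : ℝ, c ≠ 0 ∧ ((RP.mk (toUSphere z)).rep : PhaseSpace n) = c • z := by
    have h3 : (‖z‖)⁻¹ ≠ 0 := inv_ne_zero (norm_ne_zero_iff.2 hz)
    rcases h1 with h | h
    · exact ⟨‖z‖⁻¹, h3, by rw [h, coe_toUSphere hz]⟩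
    · exact ⟨-‖z‖⁻¹, neg_ne_zero.2 h3, by rw [h, coe_neg_sphere, coe_toUSphere hz, neg_smul]⟩
  obtain ⟨c, hc, h3⟩ := h2
  rw [h3, f.map_smul, mk_toUSphere_smul hc]

lemma projFun_mk_coe (f : HomSymp n) (x : USphere n) :
    f.projFun (RP.mk x) = RP.mk (toUSphere (f x)) := by
  have := f.projFun_mk (ne_zero_of_mem_unit_sphere x)
  rwa [toUSphere_coe] at this

lemma projFun_mul (f g : HomSymp n) (p : RP n) : (f * g).projFun p = f.projFun (g.projFun p) := by
  obtain ⟨x, rfl⟩ := RP.mk_surjective p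
  rw [projFun_mk_coe, projFun_mk_coe, projFun_mk _ (g.map_ne_zero (ne_zero_of_mem_unit_sphere x))]
  rfl

lemma projFun_one (p : RP n) : (1 : HomSymp n).projFun p = p := by
  obtain ⟨x, rfl⟩ := RP.mk_surjective p
  rw [projFun_mk_coe, one_apply, toUSphere_coe]

/-- A family of transformations induced by homogeneous maps depends smoothly on parameters if the
family of homogeneous maps does. -/
lemma contMDiffOn_projFun {P : Type*} [NormedAddCommGroup P] [NormedSpace ℝ P] {s : Set P}
    {f : P → HomSymp n}
    (hf : ContDiffOn ℝ ∞ (fun q : P × PhaseSpace n => f q.1 q.2) (s ×ˢ {0}ᶜ)) :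
    ContMDiffOn (𝓘(ℝ, P).prod 𝓜) 𝓜 ∞ (fun q : P × RP n => (f q.1).projFun q.2) (s ×ˢ univ) := by
  rintro ⟨t, p⟩ ⟨ht, -⟩
  obtain ⟨x, rfl⟩ := RP.mk_surjective p
  obtain ⟨σ, h1, h2, h3⟩ := RP.exists_smooth_section_through x
  have hx : (x : PhaseSpace n) ≠ 0 := ne_zero_of_mem_unit_sphere x
  have hσ : ContMDiffWithinAt (𝓘(ℝ, P).prod 𝓜) 𝓘(ℝ, P × PhaseSpace n) ∞
      (fun q : P × RP n => (q.1, (σ q.2 : PhaseSpace n))) (s ×ˢ univ) (t, RP.mk x) := by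
    rw [modelWithCornersSelf_prod, ← chartedSpaceSelf_prod]
    refine contMDiffWithinAt_fst.prodMk ?_
    have h4 : ContMDiffAt (𝓘(ℝ, P).prod 𝓜) 𝓜 ∞ (fun q : P × RP n => σ q.2) (t, RP.mk x) :=
      ContMDiffAt.comp (t, RP.mk x) (g := σ) h1 contMDiffAt_snd
    exact ((contMDiff_coe_sphere.contMDiffAt (x := σ (RP.mk x))).comp (t, RP.mk x)
      h4).contMDiffWithinAt
  have hfσ : ContMDiffWithinAt (𝓘(ℝ, P).prod 𝓜) 𝓘(ℝ, PhaseSpace n) ∞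
      (fun q : P × RP n => f q.1 (σ q.2 : PhaseSpace n)) (s ×ˢ univ) (t, RP.mk x) := by
    refine ContMDiffWithinAt.comp (t, RP.mk x) (I' := 𝓘(ℝ, P × PhaseSpace n))
      (g := fun q : P × PhaseSpace n => f q.1 q.2) (t := s ×ˢ {0}ᶜ) ?_ hσ ?_
    · exact (hf _ ⟨ht, by rw [h2]; exact hx⟩).contMDiffWithinAt
    · exact fun q hq => ⟨hq.1, ne_zero_of_mem_unit_sphere _⟩
  have hne : f t (σ (RP.mk x) : PhaseSpace n) ≠ 0 :=
    (f t).map_ne_zero (ne_zero_of_mem_unit_sphere _)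
  have hfin : ContMDiffWithinAt (𝓘(ℝ, P).prod 𝓜) 𝓜 ∞
      (fun q : P × RP n => RP.mk (toUSphere (f q.1 (σ q.2 : PhaseSpace n)))) (s ×ˢ univ)
      (t, RP.mk x) :=
    (RP.contMDiff_mk.contMDiffAt).comp_contMDiffWithinAt (t, RP.mk x)
      (ContMDiffAt.comp_contMDiffWithinAt (t, RP.mk x) (g := toUSphere)
        (f := fun q : P × RP n => f q.1 (σ q.2 : PhaseSpace n))
        (contMDiffAt_toUSphere hne) hfσ)
  have hev : ∀ᶠ q : P × RP n in nhds (t, RP.mk x), RP.mk (σ q.2) = q.2 :=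
    (continuous_snd.continuousAt (x := (t, RP.mk x))).eventually h3
  refine hfin.congr_of_eventuallyEq (hev.filter_mono nhdsWithin_le_nhds |>.mono fun q hq => ?_) ?_
  · have := (f q.1).projFun_mk_coe (σ q.2)
    rwa [hq] at this
  · have := (f t).projFun_mk_coe (σ (RP.mk x))
    rwa [hev.self_of_nhds] at this

lemma contMDiff_projFun (f : HomSymp n) : ContMDiff 𝓜 𝓜 ∞ f.projFun := by
  have h := contMDiffOn_projFun (P := ℝ) (s := univ) (f := fun _ => f)
    (f.contDiffOn.comp contDiffOn_snd fun q hq => hq.2)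
  rw [univ_prod_univ, contMDiffOn_univ] at h
  exact h.comp (contMDiff_const (c := (0 : ℝ)) |>.prodMk contMDiff_id)

/-- The homomorphism from homogeneous symplectic maps to contactomorphisms. -/
def proj : HomSymp n →* ContactoGroup (stdForm (n := n)) where
  toFun f := ⟨⟨f.projFun, f⁻¹.projFun, fun p => by rw [← projFun_mul, inv_mul_cancel, projFun_one],
    fun p => by rw [← projFun_mul, mul_inv_cancel, projFun_one]⟩, f.contMDiff_projFun,
    f⁻¹.contMDiff_projFun, fun p v => by
      obtain ⟨x, rfl⟩ := RP.mk_surjective p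
      obtain ⟨e, he⟩ := RP.mfderiv_mk_isInvertible x
      obtain ⟨w, rfl⟩ : ∃ w, mfderiv 𝓜 𝓜 RP.mk x w = v :=
        ⟨e.symm v, by rw [← he]; exact e.apply_symm_apply v⟩
      have hx : (x : PhaseSpace n) ≠ 0 := ne_zero_of_mem_unit_sphere x
      have hval : MDifferentiableAt 𝓜 𝓘(ℝ, PhaseSpace n)
          (Subtype.val : USphere n → PhaseSpace n) x :=
        (contMDiff_coe_sphere (m := ∞)).mdifferentiable (by simp) _
      have hfx := (f.differentiableAt hx).mdifferentiableAt.comp x hval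
      have h1 := stdForm_mfderiv_mk_toUSphere hfx (f.map_ne_zero hx) w
      have h2 : mfderiv 𝓜 𝓜 f.projFun (RP.mk x) (mfderiv 𝓜 𝓜 RP.mk x w) =
          mfderiv 𝓜 𝓜 (fun y : USphere n => RP.mk (toUSphere (f (y : PhaseSpace n)))) x w := by
        have h3 : (fun y : USphere n => RP.mk (toUSphere (f (y : PhaseSpace n)))) =
          f.projFun ∘ RP.mk := funext fun y => (f.projFun_mk_coe y).symm
        rw [h3]
        exact (congrArg (fun C => C w) (mfderiv_comp x
          (f.contMDiff_projFun.mdifferentiable (by simp) _)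
          (RP.contMDiff_mk.mdifferentiable (by simp) _))).symm
      have h4 : mvfderiv 𝓜 (⇑(f : Equiv.Perm (PhaseSpace n)) ∘
          (Subtype.val : USphere n → PhaseSpace n)) x w =
          fderiv ℝ f x (mvfderiv 𝓜 (Subtype.val : USphere n → PhaseSpace n) x w) := by
        have h5 := mfderiv_comp x (f.differentiableAt hx).mdifferentiableAt hval
        rw [mfderiv_eq_fderiv] at h5
        exact congrArg (fun C : TangentSpace 𝓜 x →L[ℝ] PhaseSpace n => C w) h5
      -- Since f preserves λ₀, the induced map rescales α₀ by ‖f x‖⁻² > 0 and so preserves ξ with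
      -- its co-orientation.
      have h6 : stdForm (f.projFun (RP.mk x)) (mfderiv 𝓜 𝓜 f.projFun (RP.mk x)
          (mfderiv 𝓜 𝓜 RP.mk x w)) = (‖f x‖ ^ 2)⁻¹ * stdForm (RP.mk x) (mfderiv 𝓜 𝓜 RP.mk x w) := by
        have hb : f.projFun (RP.mk x) = RP.mk (toUSphere (f (x : PhaseSpace n))) :=
          f.projFun_mk_coe x
        have hgen : ∀ (q : RP n) (_ : q = RP.mk (toUSphere (f (x : PhaseSpace n))))
            (u : EuclideanSpace ℝ (Fin (2 * n - 1))),
            (stdForm q : EuclideanSpace ℝ (Fin (2 * n - 1)) →L[ℝ] ℝ) u =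
            (stdForm (RP.mk (toUSphere (f (x : PhaseSpace n)))) :
              EuclideanSpace ℝ (Fin (2 * n - 1)) →L[ℝ] ℝ) u := by rintro q rfl u; rfl
        refine (hgen _ hb _).trans ?_
        rw [stdForm_mfderiv_mk]
        refine (congrArg _ h2).trans (h1.trans ?_)
        congr 1
        refine (congrArg _ h4).trans ?_
        exact f.liouville hx _
      change 0 < stdForm (f.projFun (RP.mk x)) (mfderiv 𝓜 𝓜 f.projFun (RP.mk x)
          (mfderiv 𝓜 𝓜 RP.mk x w)) ↔ _
      rw [h6]
      have : 0 < (‖f x‖ ^ 2)⁻¹ := inv_pos.2 (pow_pos (norm_pos_iff.2 (f.map_ne_zero hx)) 2)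
      exact ⟨fun h => pos_of_mul_pos_right h this.le, fun h => mul_pos this h⟩⟩
  map_one' := Subtype.ext (Equiv.ext projFun_one)
  map_mul' f g := Subtype.ext (Equiv.ext (projFun_mul f g))

end HomSymp

end HomSymp

/-! ### Contact Hamiltonians and the order on the universal cover -/

section ContactCalculus

variable {F : Type*} [NormedAddCommGroup F] [NormedSpace ℝ F] {H : Type*} [TopologicalSpace H]
  {I : ModelWithCorners ℝ F H} {M : Type*} [TopologicalSpace M] [ChartedSpace H M]
  {α : ∀ p : M, TangentSpace I p →L[ℝ] ℝ}

lemma uniqueMDiffWithinAt_unitInterval {t : ℝ} (ht : t ∈ Icc (0 : ℝ) 1) :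
    UniqueMDiffWithinAt 𝓘(ℝ, ℝ) (Icc (0 : ℝ) 1) t :=
  (uniqueDiffOn_Icc zero_lt_one t ht).uniqueMDiffWithinAt

/-- The chain rule for a time-dependent map evaluated along a curve. -/
lemma mfderivWithin_eval_curve {f : ℝ → M → M} {c : ℝ → M} {t : ℝ} {y : M}
    (ht : t ∈ Icc (0 : ℝ) 1)
    (hf : MDifferentiableWithinAt (𝓘(ℝ, ℝ).prod I) I (fun z : ℝ × M => f z.1 z.2)
      (Icc (0 : ℝ) 1 ×ˢ univ) (t, y))
    (hc : MDifferentiableWithinAt 𝓘(ℝ, ℝ) I c (Icc (0 : ℝ) 1) t) (hy : c t = y) :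
    (mfderivWithin 𝓘(ℝ, ℝ) I (fun s => f s (c s)) (Icc (0 : ℝ) 1) t (1 : ℝ) : F) =
      (mfderivWithin 𝓘(ℝ, ℝ) I (fun s => f s y) (Icc (0 : ℝ) 1) t (1 : ℝ) : F) +
        (mfderiv I I (f t) y (mfderivWithin 𝓘(ℝ, ℝ) I c (Icc (0 : ℝ) 1) t (1 : ℝ) : F) : F) := by
  subst hy
  have hu := uniqueMDiffWithinAt_unitInterval ht
  -- All three derivatives are the total derivative D at (t, c t), applied to (1, w), (1, 0) and (0,
  -- w).
  have hF := hf.hasMFDerivWithinAt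
  set D := mfderivWithin (𝓘(ℝ, ℝ).prod I) I (fun z : ℝ × M => f z.1 z.2)
    (Icc (0 : ℝ) 1 ×ˢ univ) (t, c t) with hD
  have hid : HasMFDerivWithinAt 𝓘(ℝ, ℝ) 𝓘(ℝ, ℝ) (fun s : ℝ => s) (Icc (0 : ℝ) 1) t
      (ContinuousLinearMap.id ℝ ℝ) := (hasMFDerivAt_id t).hasMFDerivWithinAt
  have h1 := (HasMFDerivWithinAt.comp (f := fun s : ℝ => (s, c s)) t hF
    (hid.prodMk hc.hasMFDerivWithinAt) (fun s hs => ⟨hs, mem_univ _⟩)).mfderivWithin hu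
  have hconst : HasMFDerivWithinAt 𝓘(ℝ, ℝ) I (fun _ : ℝ => c t) (Icc (0 : ℝ) 1) t
      (0 : ℝ →L[ℝ] F) := (hasMFDerivAt_const (c t) t).hasMFDerivWithinAt
  have h2 := (HasMFDerivWithinAt.comp (f := fun s : ℝ => (s, c t)) t hF (hid.prodMk hconst)
    (fun s hs => ⟨hs, mem_univ _⟩)).mfderivWithin hu
  have hconst' : HasMFDerivAt I 𝓘(ℝ, ℝ) (fun _ : M => t) (c t)
      (0 : F →L[ℝ] ℝ) := hasMFDerivAt_const t (c t)
  have hid' : HasMFDerivAt I I (fun y : M => y) (c t) (ContinuousLinearMap.id ℝ F) :=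
    hasMFDerivAt_id (c t)
  have h3 := (HasMFDerivWithinAt.comp (f := fun y : M => (t, y)) (s := univ) (c t) hF
    (hconst'.prodMk hid').hasMFDerivWithinAt (fun s _ => ⟨ht, mem_univ _⟩))
  rw [hasMFDerivWithinAt_univ] at h3
  have h3 := h3.mfderiv
  set w : F := mfderivWithin 𝓘(ℝ, ℝ) I c (Icc (0 : ℝ) 1) t (1 : ℝ) with hw
  have e1 : (mfderivWithin 𝓘(ℝ, ℝ) I (fun s => f s (c s)) (Icc (0 : ℝ) 1) t (1 : ℝ) : F) =
      (D : ℝ × F →L[ℝ] F) (1, w) := congrArg (fun C : ℝ →L[ℝ] F => C 1) h1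
  have e2 : (mfderivWithin 𝓘(ℝ, ℝ) I (fun s => f s (c t)) (Icc (0 : ℝ) 1) t (1 : ℝ) : F) =
      (D : ℝ × F →L[ℝ] F) (1, 0) := congrArg (fun C : ℝ →L[ℝ] F => C 1) h2
  have e3 : (mfderiv I I (f t) (c t) w : F) =
      (D : ℝ × F →L[ℝ] F) (0, w) := congrArg (fun C : F →L[ℝ] F => C w) h3
  have hD' : ∀ (L : ℝ × F →L[ℝ] F) (w : F), L (1, w) = L (1, 0) + L (0, w) := fun L w => by
    rw [← map_add]; simp
  exact e1.trans ((hD' D w).trans (congrArg₂ (· + ·) e2.symm e3.symm))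

namespace ContactoGroup

lemma contMDiff (g : ContactoGroup α) : ContMDiff I I ∞ (g : Equiv.Perm M) := g.2.1

lemma pos_iff (g : ContactoGroup α) (p : M) (v : TangentSpace I p) :
    0 < α ((g : Equiv.Perm M) p) (mfderiv I I (g : Equiv.Perm M) p v) ↔ 0 < α p v := g.2.2.2 p v

/-- Applying the defining equivalence to -v turns strict inequalities into weak ones. -/
lemma nonneg_iff (g : ContactoGroup α) (p : M) (v : TangentSpace I p) :
    0 ≤ α ((g : Equiv.Perm M) p) (mfderiv I I (g : Equiv.Perm M) p v) ↔ 0 ≤ α p v := by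
  have h := pos_iff g p (-v)
  rw [map_neg, map_neg, map_neg, neg_pos, neg_pos] at h
  rw [← not_lt, ← not_lt, h]

lemma smooth_const {P : Type*} [NormedAddCommGroup P] [NormedSpace ℝ P] {s : Set P}
    (g : ContactoGroup α) : IsSmoothFamily s (fun _ => g) :=
  ⟨g.2.1.comp_contMDiffOn contMDiffOn_snd, g.2.2.1.comp_contMDiffOn contMDiffOn_snd⟩

end ContactoGroup

namespace ContactIsotopy

/-- The contact Hamiltonian `α(X_t)` of a contact isotopy. -/
def ham (φ : ContactIsotopy α) (t : ℝ) (q : M) : ℝ := α q (φ.generator t q)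

lemma mdifferentiableWithinAt (φ : ContactIsotopy α) {t : ℝ} (ht : t ∈ Icc (0 : ℝ) 1) (y : M) :
    MDifferentiableWithinAt (𝓘(ℝ, ℝ).prod I) I
      (fun z : ℝ × M => (φ.toFun z.1 : Equiv.Perm M) z.2) (Icc (0 : ℝ) 1 ×ˢ univ) (t, y) :=
  (φ.smooth.1 (t, y) ⟨ht, mem_univ _⟩).mdifferentiableWithinAt (by simp)

lemma mdifferentiableWithinAt_curve (φ : ContactIsotopy α) {t : ℝ} (ht : t ∈ Icc (0 : ℝ) 1)
    (y : M) : MDifferentiableWithinAt 𝓘(ℝ, ℝ) I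
      (fun s : ℝ => (φ.toFun s : Equiv.Perm M) y) (Icc (0 : ℝ) 1) t :=
  MDifferentiableWithinAt.comp (f := fun s : ℝ => (s, y)) t (φ.mdifferentiableWithinAt ht y)
    (mdifferentiableWithinAt_id.prodMk mdifferentiableWithinAt_const)
    (fun _ hs => ⟨hs, mem_univ _⟩)

/-- Product rule: the generator of φ ∘ ψ is that of φ plus the push-forward by φ_t of that of ψ. The
second term is left as a push-forward, whose sign `nonneg_iff` controls. -/
lemma ham_mul (φ ψ : ContactIsotopy α) {t : ℝ} (ht : t ∈ Icc (0 : ℝ) 1) (p : M) :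
    (φ.mul ψ).ham t ((φ.toFun t : Equiv.Perm M) p) =
      φ.ham t ((φ.toFun t : Equiv.Perm M) p) +
        α ((φ.toFun t : Equiv.Perm M) p)
          (mfderiv I I (φ.toFun t : Equiv.Perm M) p (ψ.generator t p)) := by
  have h := mfderivWithin_eval_curve (f := fun s => (φ.toFun s : Equiv.Perm M))
    (c := fun s => (ψ.toFun s : Equiv.Perm M) ((ψ.toFun t : Equiv.Perm M).symm p)) ht
    (φ.mdifferentiableWithinAt ht p) (ψ.mdifferentiableWithinAt_curve ht _)
    (Equiv.apply_symm_apply _ _)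
  have hp : (φ.toFun t : Equiv.Perm M).symm ((φ.toFun t : Equiv.Perm M) p) = p :=
    Equiv.symm_apply_apply _ _
  have h1 : ((φ.mul ψ).generator t ((φ.toFun t : Equiv.Perm M) p) : F) =
      (φ.generator t ((φ.toFun t : Equiv.Perm M) p) : F) +
      (mfderiv I I (φ.toFun t : Equiv.Perm M) p (ψ.generator t p) : F) := by
    unfold generator
    change (mfderivWithin 𝓘(ℝ, ℝ) I (fun s : ℝ => (φ.toFun s : Equiv.Perm M)
      ((ψ.toFun s : Equiv.Perm M) ((ψ.toFun t : Equiv.Perm M).symm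
      ((φ.toFun t : Equiv.Perm M).symm ((φ.toFun t : Equiv.Perm M) p)))))
      (Icc (0 : ℝ) 1) t (1 : ℝ) : F) = _
    rw [hp]
    exact h
  unfold ham
  exact (congrArg (α ((φ.toFun t : Equiv.Perm M) p) : F →L[ℝ] ℝ) h1).trans
    (map_add (α ((φ.toFun t : Equiv.Perm M) p) : F →L[ℝ] ℝ) _ _)

lemma IsNonneg.mul {φ ψ : ContactIsotopy α} (h1 : φ.IsNonneg) (h2 : ψ.IsNonneg) :
    (φ.mul ψ).IsNonneg := by
  intro t ht q
  obtain ⟨p, rfl⟩ := (φ.toFun t : Equiv.Perm M).surjective q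
  change 0 ≤ (φ.mul ψ).ham t _
  rw [ham_mul φ ψ ht]
  exact add_nonneg (h1 t ht _) ((ContactoGroup.nonneg_iff (φ.toFun t) p _).2 (h2 t ht p))

/-- Comparison of isotopies through their Hamiltonians. -/
lemma isNonneg_inv_mul {φ ψ : ContactIsotopy α}
    (h : ∀ t ∈ Icc (0 : ℝ) 1, ∀ q, φ.ham t q ≤ ψ.ham t q) : (φ.inv.mul ψ).IsNonneg := by
  intro t ht p
  -- The product rule for φ (φ⁻¹ψ) = ψ exhibits the push-forward of the generator of φ⁻¹ψ as the
  -- difference of the two Hamiltonians.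
  have hψ : φ.mul (φ.inv.mul ψ) = ψ := by
    cases φ; cases ψ; simp [mul, inv]
  have h1 := ham_mul φ (φ.inv.mul ψ) ht p
  rw [hψ] at h1
  refine (ContactoGroup.nonneg_iff (φ.toFun t) p _).1 ?_
  have := h t ht ((φ.toFun t : Equiv.Perm M) p)
  linarith

/-- Conjugation of an isotopy by a fixed contactomorphism. -/
def conj (g : ContactoGroup α) (φ : ContactIsotopy α) : ContactIsotopy α :=
  ⟨fun t => g * φ.toFun t * g⁻¹, ((ContactoGroup.smooth_const g).mul φ.smooth).mul (ContactoGroup.smooth_const g⁻¹),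
    by simp [φ.zero]⟩

lemma IsNonneg.conj {φ : ContactIsotopy α} (h : φ.IsNonneg) (g : ContactoGroup α) :
    (φ.conj g).IsNonneg := by
  intro t ht q
  obtain ⟨p, rfl⟩ := (g : Equiv.Perm M).surjective q
  have h1 : ((φ.conj g).generator t ((g : Equiv.Perm M) p) : F) =
      (mfderiv I I (g : Equiv.Perm M) p (φ.generator t p) : F) := by
    unfold generator
    change (mfderivWithin 𝓘(ℝ, ℝ) I (fun s : ℝ => (g : Equiv.Perm M)
      ((φ.toFun s : Equiv.Perm M) ((g : Equiv.Perm M).symm ((g : Equiv.Perm M)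
      ((φ.toFun t : Equiv.Perm M).symm ((g : Equiv.Perm M).symm ((g : Equiv.Perm M) p)))))))
      (Icc (0 : ℝ) 1) t (1 : ℝ) : F) = _
    rw [Equiv.symm_apply_apply, Equiv.symm_apply_apply]
    have hp : (φ.toFun t : Equiv.Perm M) ((φ.toFun t : Equiv.Perm M).symm p) = p :=
      Equiv.apply_symm_apply _ _
    have h2 := mfderiv_comp_mfderivWithin (I := 𝓘(ℝ, ℝ)) (I' := I) (I'' := I) t
      (g := (g : Equiv.Perm M))
      (f := fun s : ℝ => (φ.toFun s : Equiv.Perm M) ((φ.toFun t : Equiv.Perm M).symm p))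
      (s := Icc (0 : ℝ) 1)
      ((ContactoGroup.contMDiff g).mdifferentiable (by simp) _) (φ.mdifferentiableWithinAt_curve ht _)
      (uniqueMDiffWithinAt_unitInterval ht)
    have h3 : ∀ (y : M) (_ : y = p) (w : F), (mfderiv I I (g : Equiv.Perm M) y w : F) =
      (mfderiv I I (g : Equiv.Perm M) p w : F) := by rintro y rfl w; rfl
    exact (congrArg (fun C : ℝ →L[ℝ] F => C 1) h2).trans (h3 _ hp _)
  refine le_of_le_of_eq ((ContactoGroup.nonneg_iff g p _).2 (h t ht p)) ?_
  exact congrArg (α ((g : Equiv.Perm M) p) : F →L[ℝ] ℝ) h1.symm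

/-- Reparametrization of time. -/
def reparam (φ : ContactIsotopy α) (a : ℝ → ℝ) (ha : ContDiff ℝ ∞ a)
    (hm : MapsTo a (Icc 0 1) (Icc 0 1)) (h0 : a 0 = 0) : ContactIsotopy α :=
  ⟨fun t => φ.toFun (a t), φ.smooth.comp ha hm, by simp [h0, φ.zero]⟩

lemma ham_reparam (φ : ContactIsotopy α) {a : ℝ → ℝ} (ha : ContDiff ℝ ∞ a)
    (hm : MapsTo a (Icc 0 1) (Icc 0 1)) (h0 : a 0 = 0) {t : ℝ} (ht : t ∈ Icc (0 : ℝ) 1) (q : M) :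
    (φ.reparam a ha hm h0).ham t q = deriv a t * φ.ham (a t) q := by
  have hd := (ha.differentiable (by simp) t).hasDerivAt
  have h1 : ((φ.reparam a ha hm h0).generator t q : F) =
      (deriv a t • (φ.generator (a t) q : F) : F) := by
    have h2 := ((φ.mdifferentiableWithinAt_curve (hm ht)
      ((φ.toFun (a t) : Equiv.Perm M).symm q)).hasMFDerivWithinAt.comp t
      (hd.hasFDerivAt.hasMFDerivAt.hasMFDerivWithinAt (s := Icc (0 : ℝ) 1)) hm).mfderivWithin
      (uniqueMDiffWithinAt_unitInterval ht)
    refine (congrArg (fun C : ℝ →L[ℝ] F => C 1) h2).trans ?_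
    have h3 : ∀ (D : ℝ →L[ℝ] F), D (ContinuousLinearMap.toSpanSingleton ℝ (deriv a t) 1) =
        deriv a t • D 1 := fun D => by
      rw [← map_smul]; simp
    exact h3 _
  unfold ham
  refine (congrArg (α q : F →L[ℝ] ℝ) h1).trans ?_
  exact map_smul (α q : F →L[ℝ] ℝ) _ _

/-- The homotopy evaluates φ along the segment from a to the identity of [0, 1], which stays in [0,
1] by convexity. -/
lemma mk_reparam (φ : ContactIsotopy α) {a : ℝ → ℝ} (ha : ContDiff ℝ ∞ a)
    (hm : MapsTo a (Icc 0 1) (Icc 0 1)) (h0 : a 0 = 0) (h1 : a 1 = 1) :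
    UniversalCover.mk (φ.reparam a ha hm h0) = UniversalCover.mk φ := by
  refine Quot.sound ⟨fun z => φ.toFun ((1 - z.1) * a z.2 + z.1 * z.2), ?_, fun t _ => ?_,
    fun s _ => ?_⟩
  · refine φ.smooth.comp (f := fun z : ℝ × ℝ => (1 - z.1) * a z.2 + z.1 * z.2) ?_ ?_
    · exact ((contDiff_const.sub contDiff_fst).mul (ha.comp contDiff_snd)).add
        (contDiff_fst.mul contDiff_snd)
    · rintro ⟨s, t⟩ ⟨hs, ht⟩
      exact convex_Icc (0 : ℝ) 1 (hm ht) ht (sub_nonneg.2 hs.2) hs.1 (by ring)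
  · simp [reparam]
  · simp [h0, h1, reparam, φ.zero]

/-- In the universal cover, conjugation by the class of an isotopy is induced by conjugation by its
end-point. -/
lemma mk_conj (φ χ : ContactIsotopy α) :
    UniversalCover.mk φ * UniversalCover.mk χ * (UniversalCover.mk φ)⁻¹ =
      UniversalCover.mk (χ.conj (φ.toFun 1)) := by
  change UniversalCover.mk ((φ.mul χ).mul φ.inv) = _
  have hA : IsSmoothFamily (Icc (0 : ℝ) 1 ×ˢ Icc (0 : ℝ) 1)
      (fun z : ℝ × ℝ => φ.toFun (z.2 + z.1 * (1 - z.2))) := by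
    refine φ.smooth.comp (f := fun z : ℝ × ℝ => z.2 + z.1 * (1 - z.2)) (by fun_prop) ?_
    rintro ⟨s, t⟩ ⟨hs, ht⟩
    have := convex_Icc (0 : ℝ) 1 ht (right_mem_Icc.2 zero_le_one) (sub_nonneg.2 hs.2) hs.1
      (by ring)
    have e : t + s * (1 - t) = (1 - s) • t + s • 1 := by simp only [smul_eq_mul]; ring
    change t + s * (1 - t) ∈ _
    rwa [e]
  -- The conjugating element slides from φ_t to φ_1. At t = 0 it conjugates χ_0 = 1 and at t = 1 it
  -- is φ_1 throughout, so the ends stay fixed.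
  refine Quot.sound ⟨fun z => φ.toFun (z.2 + z.1 * (1 - z.2)) * χ.toFun z.2 *
    (φ.toFun (z.2 + z.1 * (1 - z.2)))⁻¹, (hA.mul χ.const_smooth).mul hA.inv, fun t _ => ?_,
    fun s _ => ?_⟩
  · simp [mul, inv, conj]
  · simp [mul, inv, χ.zero]

end ContactIsotopy

namespace UniversalCover

open ContactIsotopy

lemma precedes_iff {a b : UniversalCover α} :
    Precedes a b ↔ ∃ χ : ContactIsotopy α, χ.IsNonneg ∧ mk χ * a = b := by
  simp only [Precedes, lift_one]

lemma Precedes.trans {a b c : UniversalCover α} (h1 : Precedes a b) (h2 : Precedes b c) :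
    Precedes a c := by
  obtain ⟨χ, h3, rfl⟩ := precedes_iff.1 h1
  obtain ⟨χ', h4, rfl⟩ := precedes_iff.1 h2
  exact precedes_iff.2 ⟨χ'.mul χ, h4.mul h3, by rw [← mk_mul, mul_assoc]⟩

lemma Precedes.mul_right {a b : UniversalCover α} (h : Precedes a b) (c : UniversalCover α) :
    Precedes (a * c) (b * c) := by
  obtain ⟨χ, h3, rfl⟩ := precedes_iff.1 h
  exact precedes_iff.2 ⟨χ, h3, by rw [mul_assoc]⟩

lemma mk_surjective (c : UniversalCover α) : ∃ φ : ContactIsotopy α, mk φ = c := Quot.exists_rep c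

/-- The order is defined through paths multiplied on the left, so right invariance is immediate;
left invariance amounts to conjugating the path, which preserves non-negativity. -/
lemma Precedes.mul_left {a b : UniversalCover α} (h : Precedes a b) (c : UniversalCover α) :
    Precedes (c * a) (c * b) := by
  obtain ⟨χ, h3, rfl⟩ := precedes_iff.1 h
  obtain ⟨φ, rfl⟩ := mk_surjective c
  refine precedes_iff.2 ⟨χ.conj (φ.toFun 1), h3.conj _, ?_⟩
  rw [← mk_conj]
  group

lemma Precedes.mul {a b c d : UniversalCover α} (h1 : Precedes a b) (h2 : Precedes c d) :
    Precedes (a * c) (b * d) := (h1.mul_right c).trans (h2.mul_left b)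

lemma precedes_of_ham_le {φ ψ : ContactIsotopy α}
    (h : ∀ t ∈ Icc (0 : ℝ) 1, ∀ q, φ.ham t q ≤ ψ.ham t q) : Precedes (mk φ) (mk ψ) := by
  have h1 : Precedes 1 (mk (φ.inv.mul ψ)) :=
    precedes_iff.2 ⟨_, isNonneg_inv_mul h, mul_one _⟩
  have h2 := h1.mul_left (mk φ)
  rw [mul_one] at h2
  have h3 : mk φ * mk (φ.inv.mul ψ) = mk ψ := by
    change mk φ * ((mk φ)⁻¹ * mk ψ) = _
    rw [mul_inv_cancel_left]
  rwa [h3] at h2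

/-- Puts the non-negative factor on the right, where `lorentzDist_eq_top` can switch it on after a
given path is under way. -/
lemma Precedes.exists_eq_mul {a b : UniversalCover α} (h : Precedes a b) :
    ∃ χ : ContactIsotopy α, χ.IsNonneg ∧ a * mk χ = b := by
  have h1 := h.mul_left a⁻¹
  rw [inv_mul_cancel] at h1
  obtain ⟨χ, h2, h3⟩ := precedes_iff.1 h1
  exact ⟨χ, h2, by rw [mul_one] at h3; rw [h3, mul_inv_cancel_left]⟩

end UniversalCover

end ContactCalculus

/-! ### Paths of homogeneous maps and their Hamiltonians -/

section HomSympFamily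

variable {n : ℕ} {P Q : Type*} [NormedAddCommGroup P] [NormedSpace ℝ P]
  [NormedAddCommGroup Q] [NormedSpace ℝ Q]

namespace HomSymp

/-- A family of homogeneous symplectic maps that depends smoothly on the parameter, together with
its inverses. -/
def SmoothFamily (f : P → HomSymp n) : Prop :=
  ContDiffOn ℝ ∞ (fun q : P × PhaseSpace n => f q.1 q.2) (univ ×ˢ {0}ᶜ) ∧
  ContDiffOn ℝ ∞ (fun q : P × PhaseSpace n => (f q.1)⁻¹ q.2) (univ ×ˢ {0}ᶜ)

namespace SmoothFamily

variable {f g : P → HomSymp n}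

lemma const (h : HomSymp n) : SmoothFamily (fun _ : P => h) :=
  ⟨(contDiffOn h).comp contDiffOn_snd fun _ hq => hq.2,
    (contDiffOn h⁻¹).comp contDiffOn_snd fun _ hq => hq.2⟩

lemma mul (hf : SmoothFamily f) (hg : SmoothFamily g) : SmoothFamily (fun t => f t * g t) :=
  ⟨hf.1.comp (contDiffOn_fst.prodMk hg.1) fun q hq => ⟨mem_univ _, map_ne_zero (g q.1) hq.2⟩,
    hg.2.comp (contDiffOn_fst.prodMk hf.2) fun q hq => ⟨mem_univ _, map_ne_zero (f q.1)⁻¹ hq.2⟩⟩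

lemma inv (hf : SmoothFamily f) : SmoothFamily (fun t => (f t)⁻¹) := ⟨hf.2, hf.1⟩

lemma comp (hf : SmoothFamily f) {a : Q → P} (ha : ContDiff ℝ ∞ a) :
    SmoothFamily (fun t => f (a t)) :=
  have h : ContDiffOn ℝ ∞ (fun q : Q × PhaseSpace n => (a q.1, q.2)) (univ ×ˢ {0}ᶜ) :=
    ((ha.comp contDiff_fst).prodMk contDiff_snd).contDiffOn
  ⟨hf.1.comp h fun _ hq => ⟨mem_univ _, hq.2⟩, hf.2.comp h fun _ hq => ⟨mem_univ _, hq.2⟩⟩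

lemma contDiffAt (hf : SmoothFamily f) (t : P) {x : PhaseSpace n} (hx : x ≠ 0) :
    ContDiffAt ℝ ∞ (fun q : P × PhaseSpace n => f q.1 q.2) (t, x) :=
  hf.1.contDiffAt ((isOpen_univ.prod isOpen_compl_singleton).mem_nhds ⟨mem_univ _, hx⟩)

lemma differentiableAt_curve {f : ℝ → HomSymp n} (hf : SmoothFamily f) (t : ℝ)
    {x : PhaseSpace n} (hx : x ≠ 0) : DifferentiableAt ℝ (fun s => f s x) t :=
  DifferentiableAt.comp (g := fun q : ℝ × PhaseSpace n => f q.1 q.2) (f := fun s : ℝ => (s, x)) t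
    ((hf.contDiffAt t hx).differentiableAt (by simp))
    (differentiableAt_id.prodMk (differentiableAt_const x))

end SmoothFamily

/-- The homogeneous Hamiltonian of a smooth path of homogeneous symplectic maps. -/
def hamiltonian (f : ℝ → HomSymp n) (t : ℝ) (x : PhaseSpace n) : ℝ :=
  liouvilleForm x (deriv (fun s => f s ((f t)⁻¹ x)) t)

lemma deriv_mul_curve {f g : ℝ → HomSymp n} (hf : SmoothFamily f) (hg : SmoothFamily g) (t : ℝ)
    {x : PhaseSpace n} (hx : x ≠ 0) : deriv (fun s => f s (g s x)) t =
      deriv (fun s => f s (g t x)) t + fderiv ℝ (f t) (g t x) (deriv (fun s => g s x) t) := by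
  have hgx : g t x ≠ 0 := map_ne_zero (g t) hx
  have hF := ((hf.contDiffAt t hgx).differentiableAt (by simp)).hasFDerivAt
  set D := fderiv ℝ (fun q : ℝ × PhaseSpace n => f q.1 q.2) (t, g t x) with hD
  have h1 : HasDerivAt (fun s => f s (g s x)) (D (1, deriv (fun s => g s x) t)) t :=
    hF.comp_hasDerivAt (f := fun s : ℝ => (s, g s x)) t ((hasDerivAt_id t).prodMk (hg.differentiableAt_curve t hx).hasDerivAt)
  have h2 : HasDerivAt (fun s => f s (g t x)) (D (1, 0)) t :=
    hF.comp_hasDerivAt (f := fun s : ℝ => (s, g t x)) t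
      ((hasDerivAt_id t).prodMk (hasDerivAt_const t _))
  have h3 : HasFDerivAt (fun y => f t y)
      (D.comp ((0 : PhaseSpace n →L[ℝ] ℝ).prod (ContinuousLinearMap.id ℝ _))) (g t x) :=
    HasFDerivAt.comp (f := fun y => (t, y)) (g t x) hF
      ((hasFDerivAt_const t _).prodMk (hasFDerivAt_id _))
  have h4 : fderiv ℝ (f t) (g t x) = _ := h3.fderiv
  rw [h1.deriv, h2.deriv, h4, ContinuousLinearMap.comp_apply, ← map_add]
  simp

/-- The velocity of f_t g_t is that of f plus the image under df_t of that of g, and f_t preserves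
λ₀; unlike on the projective space, no conformal factor appears. -/
lemma hamiltonian_mul {f g : ℝ → HomSymp n} (hf : SmoothFamily f) (hg : SmoothFamily g) (t : ℝ)
    {x : PhaseSpace n} (hx : x ≠ 0) : hamiltonian (fun t => f t * g t) t x =
      hamiltonian f t x + hamiltonian g t ((f t)⁻¹ x) := by
  have hy : (f t)⁻¹ x ≠ 0 := map_ne_zero (f t)⁻¹ hx
  have hz : (g t)⁻¹ ((f t)⁻¹ x) ≠ 0 := map_ne_zero (g t)⁻¹ hy
  have h1 := deriv_mul_curve hf hg t hz
  rw [apply_inv_self] at h1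
  unfold hamiltonian
  change liouvilleForm x (deriv (fun s => f s (g s ((g t)⁻¹ ((f t)⁻¹ x)))) t) = _
  rw [h1, map_add]
  congr 1
  have h2 := liouville (f t) hy (deriv (fun s => g s ((g t)⁻¹ ((f t)⁻¹ x))) t)
  rwa [apply_inv_self] at h2

lemma hamiltonian_const (h : HomSymp n) (t : ℝ) (x : PhaseSpace n) :
    hamiltonian (fun _ => h) t x = 0 := by
  simp [hamiltonian]

lemma hamiltonian_conj {f : ℝ → HomSymp n} (hf : SmoothFamily f) (h : HomSymp n) (t : ℝ)
    {x : PhaseSpace n} (hx : x ≠ 0) :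
    hamiltonian (fun t => h * f t * h⁻¹) t x = hamiltonian f t (h⁻¹ x) := by
  rw [hamiltonian_mul ((SmoothFamily.const h).mul hf) (SmoothFamily.const h⁻¹) t hx,
    hamiltonian_mul (SmoothFamily.const h) hf t hx, hamiltonian_const, hamiltonian_const]
  simp

lemma hamiltonian_comp {f : ℝ → HomSymp n} (hf : SmoothFamily f) {a : ℝ → ℝ} {a' t : ℝ}
    (ha : HasDerivAt a a' t) {x : PhaseSpace n} (hx : x ≠ 0) :
    hamiltonian (fun t => f (a t)) t x = a' * hamiltonian f (a t) x := by
  unfold hamiltonian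
  have h := ((hf.differentiableAt_curve (a t) (map_ne_zero (f (a t))⁻¹ hx)).hasDerivAt.scomp t
    ha).deriv
  rw [show (fun s => f (a s) ((f (a t))⁻¹ x)) =
    (fun s => f s ((f (a t))⁻¹ x)) ∘ a from rfl, h, _root_.map_smul, smul_eq_mul]

variable [NeZero n]

local notation "𝓜" => 𝓡 (2 * n - 1)

lemma SmoothFamily.isSmoothFamily {f : P → HomSymp n} (hf : SmoothFamily f) (s : Set P) :
    IsSmoothFamily s (fun t => proj (f t)) :=
  ⟨contMDiffOn_projFun (hf.1.mono (prod_mono (subset_univ _) subset_rfl)),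
    contMDiffOn_projFun (f := fun t => (f t)⁻¹)
      (hf.2.mono (prod_mono (subset_univ _) subset_rfl))⟩

/-- The contact isotopy of the projective space induced by a path of homogeneous maps. -/
def isotopy (f : ℝ → HomSymp n) (hf : SmoothFamily f) (h0 : f 0 = 1) :
    ContactIsotopy (stdForm (n := n)) :=
  ⟨fun t => proj (f t), hf.isSmoothFamily _, by rw [h0, _root_.map_one]⟩

/-- The dictionary between the two levels: at a unit vector the factor ‖x‖⁻² of
`stdForm_mfderiv_mk_toUSphere` is 1. -/
lemma ham_isotopy_mk {f : ℝ → HomSymp n} (hf : SmoothFamily f) (h0 : f 0 = 1) {t : ℝ}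
    (ht : t ∈ Icc (0 : ℝ) 1) (x : USphere n) :
    (isotopy f hf h0).ham t (RP.mk x) = hamiltonian f t x := by
  have hx : (x : PhaseSpace n) ≠ 0 := ne_zero_of_mem_unit_sphere x
  set y : PhaseSpace n := (f t)⁻¹ x with hy
  have hy0 : y ≠ 0 := map_ne_zero (f t)⁻¹ hx
  set c : ℝ → PhaseSpace n := fun s => f s y with hc
  have hct : c t = x := apply_inv_self (f t) x
  have hd : DifferentiableAt ℝ c t := hf.differentiableAt_curve t hy0
  have hc0 : c t ≠ 0 := by rwa [hct]
  have h1 := stdForm_mfderiv_mk_toUSphere (I := 𝓘(ℝ, ℝ)) hd.mdifferentiableAt hc0 (1 : ℝ)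
  have h2 : (fun s : ℝ => ((isotopy f hf h0).toFun s : Equiv.Perm (RP n))
      (((isotopy f hf h0).toFun t : Equiv.Perm (RP n)).symm (RP.mk x))) =
      fun s => RP.mk (toUSphere (c s)) := by
    ext1 s
    change (f s).projFun ((f t)⁻¹.projFun (RP.mk x)) = _
    rw [projFun_mk_coe, projFun_mk _ hy0]
  have h3 : MDifferentiableAt 𝓘(ℝ, ℝ) 𝓜 (fun s => RP.mk (toUSphere (c s))) t := by
    have h4 : MDifferentiableAt 𝓘(ℝ, PhaseSpace n) 𝓜 (toUSphere (n := n)) (c t) :=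
      (contMDiffAt_toUSphere hc0).mdifferentiableAt (by simp)
    have h5 : MDifferentiableAt 𝓜 𝓜 (RP.mk (n := n)) (toUSphere (c t)) :=
      RP.contMDiff_mk.mdifferentiable (by simp) _
    exact h5.comp t (h4.comp t hd.mdifferentiableAt)
  have h6 : (isotopy f hf h0).generator t (RP.mk x) =
      (mfderiv 𝓘(ℝ, ℝ) 𝓜 (fun s => RP.mk (toUSphere (c s))) t (1 : ℝ) :
        EuclideanSpace ℝ (Fin (2 * n - 1))) := by
    unfold ContactIsotopy.generator
    rw [h2]
    exact congrArg (fun C : ℝ →L[ℝ] EuclideanSpace ℝ (Fin (2 * n - 1)) => C 1)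
      (mfderivWithin_eq_mfderiv (uniqueMDiffWithinAt_unitInterval ht) h3)
  have h7 : ∀ q : RP n, q = RP.mk x → ∀ v : EuclideanSpace ℝ (Fin (2 * n - 1)),
      (stdForm q : EuclideanSpace ℝ (Fin (2 * n - 1)) →L[ℝ] ℝ) v =
      (stdForm (RP.mk x) : EuclideanSpace ℝ (Fin (2 * n - 1)) →L[ℝ] ℝ) v := by
    rintro q rfl v; rfl
  have h8 : mvfderiv 𝓘(ℝ, ℝ) c t (1 : ℝ) = deriv c t := by
    exact congrArg (fun C : ℝ →L[ℝ] PhaseSpace n => C 1) (mfderiv_eq_fderiv (f := c) (x := t))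
  have h9 : RP.mk (toUSphere (c t)) = RP.mk x := by rw [hct, toUSphere_coe]
  unfold ContactIsotopy.ham
  rw [h6]
  refine (h7 _ h9 _).symm.trans (h1.trans ?_)
  rw [h8, hct, norm_eq_of_mem_sphere]
  simp only [one_pow, inv_one, one_mul]
  rfl

lemma mk_isotopy_mul {f g : ℝ → HomSymp n} (hf : SmoothFamily f) (hf0 : f 0 = 1)
    (hg : SmoothFamily g) (hg0 : g 0 = 1) :
    UniversalCover.mk (isotopy f hf hf0) * UniversalCover.mk (isotopy g hg hg0) =
      UniversalCover.mk (isotopy (fun t => f t * g t) (hf.mul hg) (by simp [hf0, hg0])) := by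
  rw [UniversalCover.mk_mul]
  congr 1
  simp [ContactIsotopy.mul, isotopy]

lemma isotopy_congr {f g : ℝ → HomSymp n} (hf : SmoothFamily f) (hf0 : f 0 = 1)
    (hg : SmoothFamily g) (hg0 : g 0 = 1) (h : ∀ t, f t = g t) :
    isotopy f hf hf0 = isotopy g hg hg0 := by
  obtain rfl : f = g := funext h
  rfl

lemma mk_isotopy_eq_of_homotopy {f g : ℝ → HomSymp n} (hf : SmoothFamily f) (hf0 : f 0 = 1)
    (hg : SmoothFamily g) (hg0 : g 0 = 1) {K : ℝ × ℝ → HomSymp n} (hK : SmoothFamily K)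
    (h0 : ∀ t, K (0, t) = f t) (h1 : ∀ t, K (1, t) = g t) (h2 : ∀ s, K (s, 0) = 1)
    (h3 : ∀ s, K (s, 1) = f 1) :
    UniversalCover.mk (isotopy f hf hf0) = UniversalCover.mk (isotopy g hg hg0) :=
  Quot.sound ⟨fun z => proj (K z), hK.isSmoothFamily _,
    fun t _ => ⟨congrArg proj (h0 t), congrArg proj (h1 t)⟩,
    fun s _ => ⟨(congrArg proj (h2 s)).trans (_root_.map_one _), congrArg proj (h3 s)⟩⟩

lemma precedes_mk_isotopy {f g : ℝ → HomSymp n} (hf : SmoothFamily f) (hf0 : f 0 = 1)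
    (hg : SmoothFamily g) (hg0 : g 0 = 1)
    (h : ∀ t ∈ Icc (0 : ℝ) 1, ∀ x : USphere n, hamiltonian f t x ≤ hamiltonian g t x) :
    UniversalCover.Precedes (UniversalCover.mk (isotopy f hf hf0))
      (UniversalCover.mk (isotopy g hg hg0)) := by
  refine UniversalCover.precedes_of_ham_le fun t ht q => ?_
  obtain ⟨x, rfl⟩ := RP.mk_surjective q
  rw [ham_isotopy_mk hf hf0 ht, ham_isotopy_mk hg hg0 ht]
  exact h t ht x

end HomSymp

end HomSympFamily

/-! ### Global flows of vector fields homogeneous of degree one -/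

section HomogeneousFlow

variable {V : Type} [NormedAddCommGroup V] [InnerProductSpace ℝ V]

/-- The radial rate of growth of a vector field. -/
def radialRate (X : V → V) (x : V) : ℝ := (‖x‖ ^ 2)⁻¹ * ⟪x, X x⟫

lemma radialRate_smul {X : V → V} (hX : ∀ c : ℝ, c ≠ 0 → ∀ x, x ≠ 0 → X (c • x) = c • X x) {c : ℝ}
    (hc : c ≠ 0) {x : V} (hx : x ≠ 0) : radialRate X (c • x) = radialRate X x := by
  have h1 : ‖x‖ ≠ 0 := norm_ne_zero_iff.2 hx
  rw [radialRate, radialRate, hX c hc x hx, norm_smul, real_inner_smul_left, real_inner_smul_right,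
    mul_pow, Real.norm_eq_abs, sq_abs]
  field_simp

/-- The field whose integral curves describe direction and logarithmic radius of the integral
curves of the homogeneous field `X`, cut off away from the unit sphere. -/
def cutoffField (b : ContDiffBump (1 : ℝ)) (X : V → V) (x : V) : V × ℝ :=
  b (‖x‖ ^ 2) • (X x - radialRate X x • x, radialRate X x)

lemma contDiff_cutoffField {b : ContDiffBump (1 : ℝ)} (hb : b.rOut < 1) {X : V → V}
    (hX : ContDiffOn ℝ ∞ X {0}ᶜ) : ContDiff ℝ ∞ (cutoffField b X) := by
  rw [contDiff_iff_contDiffAt]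
  intro x
  by_cases hx : x = 0
  · subst hx
    have h1 : ∀ᶠ x : V in nhds 0, cutoffField b X x = 0 := by
      have h2 : ContinuousAt (fun x : V => dist (‖x‖ ^ 2) 1) 0 := by fun_prop
      have h3 : ∀ᶠ x : V in nhds 0, b.rOut < dist (‖x‖ ^ 2) 1 :=
        h2.eventually (lt_mem_nhds (by simpa using hb))
      filter_upwards [h3] with x hx
      rw [cutoffField, b.zero_of_le_dist hx.le, zero_smul]
    exact contDiffAt_const.congr_of_eventuallyEq h1
  · have h1 : ContDiffAt ℝ ∞ X x := hX.contDiffAt (isOpen_compl_singleton.mem_nhds hx)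
    have h2 : ContDiffAt ℝ ∞ (radialRate X) x :=
      ((contDiff_norm_sq ℝ).contDiffAt.inv (pow_ne_zero 2 (norm_ne_zero_iff.2 hx))).mul
        (contDiffAt_id.inner ℝ h1)
    exact (b.contDiff.contDiffAt.comp x (contDiff_norm_sq ℝ).contDiffAt).smul
      ((h1.sub (h2.smul contDiffAt_id)).prodMk h2)

lemma hasCompactSupport_cutoffField [FiniteDimensional ℝ V] (b : ContDiffBump (1 : ℝ))
    (X : V → V) : HasCompactSupport (cutoffField b X) := by
  refine HasCompactSupport.of_support_subset_isCompact (isCompact_closedBall (0 : V) (1 + b.rOut))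
    fun x hx => ?_
  by_contra h
  rw [mem_closedBall_zero_iff, not_le] at h
  refine hx ?_
  have h1 : b.rOut ≤ dist (‖x‖ ^ 2) 1 := by
    rw [Real.dist_eq]
    have := b.rOut_pos
    exact le_trans (by nlinarith) (le_abs_self _)
  rw [cutoffField, b.zero_of_le_dist h1, zero_smul]

lemma hasDerivAt_half_log_norm_sq {γ : ℝ → V} {w : V} {t : ℝ} (h : HasDerivAt γ w t)
    (h0 : γ t ≠ 0) : HasDerivAt (fun t => 1 / 2 * Real.log (‖γ t‖ ^ 2))
      ((‖γ t‖ ^ 2)⁻¹ * ⟪γ t, w⟫) t := by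
  have h1 := (h.norm_sq.log (pow_ne_zero 2 (norm_ne_zero_iff.2 h0))).const_mul (1 / 2)
  exact h1.congr_deriv (by ring)

lemma exp_half_log_norm_sq {W : Type} [NormedAddCommGroup W] {x : W} (hx : x ≠ 0) :
    Real.exp (1 / 2 * Real.log (‖x‖ ^ 2)) = ‖x‖ := by
  rw [Real.log_pow]
  push_cast
  rw [show (1 / 2 * (2 * Real.log ‖x‖) : ℝ) = Real.log ‖x‖ by ring,
    Real.exp_log (norm_pos_iff.2 hx)]

/-- A vector field which is smooth away from the origin and homogeneous of degree one has a global
flow on the complement of the origin. -/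
theorem exists_homogeneous_flow [FiniteDimensional ℝ V] {X : V → V} (hX : ContDiffOn ℝ ∞ X {0}ᶜ)
    (hhom : ∀ c : ℝ, c ≠ 0 → ∀ x, x ≠ 0 → X (c • x) = c • X x) :
    ∃ φ : ℝ → V → V, (∀ t, φ t 0 = 0) ∧ (∀ t x, x ≠ 0 → φ t x ≠ 0) ∧ (∀ x, φ 0 x = x) ∧
      ContDiffOn ℝ ∞ (fun q : ℝ × V => φ q.1 q.2) (univ ×ˢ {0}ᶜ) ∧
      (∀ x, x ≠ 0 → ∀ t, HasDerivAt (fun t => φ t x) (X (φ t x)) t) ∧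
      ∀ γ : ℝ → V, (∀ t, γ t ≠ 0) → (∀ t, HasDerivAt γ (X (γ t)) t) → ∀ t, γ t = φ t (γ 0) := by
  -- By homogeneity, direction and logarithmic radius evolve by a field that depends on the
  -- direction only. The cut-off is 1 where ‖x‖² = 1 and vanishes near the origin and for large x,
  -- which makes this field smooth, bounded and Lipschitz everywhere.
  set b : ContDiffBump (1 : ℝ) := ⟨1 / 4, 1 / 2, by norm_num, by norm_num⟩ with hb
  have hb1 : b 1 = 1 := b.one_of_mem_closedBall (mem_closedBall_self (by norm_num [hb]))
  set Z := cutoffField b X with hZ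
  have hZs : ContDiff ℝ ∞ Z := contDiff_cutoffField (by norm_num [hb]) hX
  have hZc := hasCompactSupport_cutoffField b X
  have hZ1 : ∀ x : V, ‖x‖ = 1 → Z x = (X x - radialRate X x • x, radialRate X x) := fun x hx => by
    rw [hZ, cutoffField, hx, one_pow, hb1, one_smul]
  obtain ⟨K, hK⟩ := ContDiff.lipschitzWith_of_hasCompactSupport hZc hZs (by simp)
  obtain ⟨L, hL⟩ := hZs.continuous.bounded_above_of_compact_support hZc
  have hW : LipschitzWith (K * 1) (fun p : V × ℝ => Z p.1) := hK.comp LipschitzWith.prod_fst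
  obtain ⟨Φ, hΦs, hΦ0, hΦ⟩ := exists_smooth_flow (v := fun p : V × ℝ => Z p.1) (L := L.toNNReal)
    (hZs.comp contDiff_fst) (fun p => (hL _).trans (Real.le_coe_toNNReal L)) hW
  -- The first component of the field at x is orthogonal to x, so the unit sphere is invariant and
  -- the cut-off is not felt on it.
  have hnorm : ∀ p : V × ℝ, ‖p.1‖ = 1 → ∀ t, ‖(Φ t p).1‖ = 1 := by
    intro p hp t
    have h1 : ∀ t, HasDerivAt (fun t => ‖(Φ t p).1‖ ^ 2) 0 t := fun t => by
      have h2 : HasDerivAt (fun t => (Φ t p).1) (Z (Φ t p).1).1 t :=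
        (ContinuousLinearMap.fst ℝ V ℝ).hasFDerivAt.comp_hasDerivAt t (hΦ p t)
      convert h2.norm_sq using 1
      rw [hZ, cutoffField, Prod.smul_fst, real_inner_smul_right, inner_sub_right,
        real_inner_smul_right, real_inner_self_eq_norm_sq]
      by_cases h3 : (Φ t p).1 = 0
      · simp [h3]
      · have h4 : ‖(Φ t p).1‖ ≠ 0 := norm_ne_zero_iff.2 h3
        rw [radialRate]
        field_simp
        simp
    have h5 := is_const_of_deriv_eq_zero (fun t => (h1 t).differentiableAt)
      (fun t => (h1 t).deriv) t 0
    rw [hΦ0, hp, one_pow] at h5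
    exact (pow_eq_one_iff_of_nonneg (norm_nonneg _) two_ne_zero).1 h5
  have hunit : ∀ x : V, x ≠ 0 → ‖‖x‖⁻¹ • x‖ = 1 := fun x hx => norm_smul_inv_norm (𝕜 := ℝ) hx
  set φ : ℝ → V → V := fun t x => (‖x‖ * Real.exp (Φ t (‖x‖⁻¹ • x, 0)).2) •
    (Φ t (‖x‖⁻¹ • x, 0)).1 with hφ
  refine ⟨φ, fun t => by simp [hφ], fun t x hx => ?_, fun x => ?_, ?_, fun x hx t => ?_,
    fun γ h0 hγ t => ?_⟩
  · refine smul_ne_zero (mul_ne_zero (norm_ne_zero_iff.2 hx) (Real.exp_ne_zero _)) ?_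
    rw [← norm_ne_zero_iff, hnorm _ (hunit x hx)]
    exact one_ne_zero
  · by_cases hx : x = 0
    · simp [hφ, hx]
    · simp [hφ, hΦ0, smul_smul, hx]
  · rintro ⟨t, x⟩ ⟨-, hx⟩
    have h1 : ContDiffAt ℝ ∞ (fun q : ℝ × V => ‖q.2‖) (t, x) := contDiffAt_snd.norm ℝ hx
    have h2 : ContDiffAt ℝ ∞ (fun q : ℝ × V => Φ q.1 (‖q.2‖⁻¹ • q.2, 0)) (t, x) :=
      hΦs.contDiffAt.comp (t, x) (contDiffAt_fst.prodMk
        (((h1.inv (norm_ne_zero_iff.2 hx)).smul contDiffAt_snd).prodMk contDiffAt_const))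
    exact ((h1.mul (contDiffAt_snd.comp (t, x) h2).exp).smul
      (contDiffAt_fst.comp (t, x) h2)).contDiffWithinAt
  · set p : V × ℝ := (‖x‖⁻¹ • x, 0) with hp
    have h1 : HasDerivAt (fun t => (Φ t p).1) (Z (Φ t p).1).1 t :=
      (ContinuousLinearMap.fst ℝ V ℝ).hasFDerivAt.comp_hasDerivAt t (hΦ p t)
    have h2 : HasDerivAt (fun t => (Φ t p).2) (Z (Φ t p).1).2 t :=
      (ContinuousLinearMap.snd ℝ V ℝ).hasFDerivAt.comp_hasDerivAt t (hΦ p t)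
    have h3 := ((h2.exp.const_mul ‖x‖).smul h1)
    have h4 : ‖(Φ t p).1‖ = 1 := hnorm p (hunit x hx) t
    rw [hZ1 _ h4] at h3
    refine h3.congr_deriv ?_
    symm
    change X ((‖x‖ * Real.exp (Φ t p).2) • (Φ t p).1) = _
    rw [hhom _ (mul_ne_zero (norm_ne_zero_iff.2 hx) (Real.exp_ne_zero _)) _
      (norm_ne_zero_iff.1 (by rw [h4]; exact one_ne_zero))]
    module
  · set s : ℝ → ℝ := fun t => 1 / 2 * Real.log (‖γ t‖ ^ 2) with hs
    have hs' : ∀ t, HasDerivAt s (radialRate X (γ t)) t := fun t =>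
      hasDerivAt_half_log_norm_sq (hγ t) (h0 t)
    have hexp : ∀ t, Real.exp (-s t) = ‖γ t‖⁻¹ := fun t => by
      rw [Real.exp_neg, exp_half_log_norm_sq (h0 t)]
    -- An integral curve of X, split into direction and logarithmic radius measured from its start,
    -- is an integral curve of the cut-off field, where uniqueness applies.
    set δ : ℝ → V × ℝ := fun t => (Real.exp (-s t) • γ t, s t - s 0) with hδ
    have hδ' : ∀ t, HasDerivAt δ (Z (δ t).1) t := fun t => by
      have h1 : HasDerivAt δ _ t := ((hs' t).fun_neg.exp.smul (hγ t)).prodMk ((hs' t).sub_const (s 0))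
      have h2 : (δ t).1 = Real.exp (-s t) • γ t := rfl
      have h3 : ‖(δ t).1‖ = 1 := by rw [h2, hexp]; exact hunit _ (h0 t)
      convert h1 using 1
      rw [hZ1 _ h3, h2, radialRate_smul hhom (Real.exp_ne_zero _) (h0 t),
        hhom _ (Real.exp_ne_zero _) _ (h0 t)]
      congr 1
      module
    have h4 : δ = fun t => Φ t (δ 0) :=
      integralCurve_unique hW hδ' (hΦ (δ 0)) (t₀ := 0) (hΦ0 _).symm
    have h5 : δ 0 = (‖γ 0‖⁻¹ • γ 0, 0) := by
      rw [hδ]; simp only [hexp, sub_self]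
    have h6 : Φ t (‖γ 0‖⁻¹ • γ 0, 0) = δ t := by rw [← h5]; exact (congrFun h4 t).symm
    change γ t = (‖γ 0‖ * Real.exp (Φ t (‖γ 0‖⁻¹ • γ 0, 0)).2) • (Φ t (‖γ 0‖⁻¹ • γ 0, 0)).1
    rw [h6]
    change γ t = (‖γ 0‖ * Real.exp (s t - s 0)) • Real.exp (-s t) • γ t
    rw [smul_smul]
    have h7 : ‖γ 0‖ = Real.exp (s 0) := (exp_half_log_norm_sq (h0 0)).symm
    rw [h7, ← Real.exp_add, ← Real.exp_add]
    simp

end HomogeneousFlow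

/-! ### Flows of Hamiltonians homogeneous of degree two -/

section HamiltonianFlow

variable {n : ℕ}

/-- The Hamiltonian vector field. -/
def hamField (H : PhaseSpace n → ℝ) (x : PhaseSpace n) : PhaseSpace n := symplJ n (gradient H x)

/-- Fixes the sign convention, under which the rotation z ↦ e^{it} z has the positive Hamiltonian
‖z‖² / 2. -/
lemma inner_hamField (H : PhaseSpace n → ℝ) (x w : PhaseSpace n) :
    ⟪symplJ n w, hamField H x⟫ = fderiv ℝ H x w := by
  rw [hamField, inner_symplJ_symplJ, real_inner_comm, inner_gradient_left]

lemma liouvilleForm_hamField (H : PhaseSpace n → ℝ) (x : PhaseSpace n) :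
    liouvilleForm x (hamField H x) = 1 / 2 * fderiv ℝ H x x := by
  rw [liouvilleForm_eq, inner_hamField]

lemma contDiffOn_hamField {H : PhaseSpace n → ℝ} (hH : ContDiffOn ℝ ∞ H {0}ᶜ) :
    ContDiffOn ℝ ∞ (hamField H) {0}ᶜ :=
  (symplJ n).contDiff.comp_contDiffOn
    ((InnerProductSpace.toDual ℝ (PhaseSpace n)).symm.contDiff.comp_contDiffOn
      (hH.fderiv_of_isOpen isOpen_compl_singleton (by simp)))

/-- `H` is smooth away from the origin and homogeneous of degree two. -/
structure IsHomHam (H : PhaseSpace n → ℝ) : Prop where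
  contDiffOn : ContDiffOn ℝ ∞ H {0}ᶜ
  map_smul : ∀ (c : ℝ) x, H (c • x) = c ^ 2 * H x

namespace IsHomHam

lemma gradient_smul {H : PhaseSpace n → ℝ} (hH : IsHomHam H) {c : ℝ} (hc : c ≠ 0)
    (x : PhaseSpace n) : gradient H (c • x) = c • gradient H x := by
  have h1 : fderiv ℝ (fun x => H (c • x)) x = c • fderiv ℝ H (c • x) := fderiv_comp_smul c
  have h2 : (fun x => H (c • x)) = c ^ 2 • H := funext fun x => hH.map_smul c x
  rw [h2, fderiv_const_smul_field] at h1
  have h3 : fderiv ℝ H (c • x) = c • fderiv ℝ H x := by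
    refine smul_right_injective _ hc ?_
    change c • _ = c • _
    rw [← h1, smul_smul, Pi.smul_apply, sq]
  rw [gradient, gradient, h3, _root_.map_smul]

lemma hamField_smul {H : PhaseSpace n → ℝ} (hH : IsHomHam H) {c : ℝ} (hc : c ≠ 0)
    (x : PhaseSpace n) : hamField H (c • x) = c • hamField H x := by
  rw [hamField, hH.gradient_smul hc, _root_.map_smul, hamField]

lemma contDiffAt {H : PhaseSpace n → ℝ} (hH : IsHomHam H) {x : PhaseSpace n} (hx : x ≠ 0) :
    ContDiffAt ℝ ∞ H x := hH.contDiffOn.contDiffAt (isOpen_compl_singleton.mem_nhds hx)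

/-- Euler's identity. -/
lemma fderiv_self {H : PhaseSpace n → ℝ} (hH : IsHomHam H) {x : PhaseSpace n} (hx : x ≠ 0) :
    fderiv ℝ H x x = 2 * H x := by
  have h0 : (1 : ℝ) • x ≠ 0 := by rwa [one_smul]
  have h1 : HasDerivAt (fun c : ℝ => H (c • x)) (fderiv ℝ H ((1 : ℝ) • x) ((1 : ℝ) • x)) 1 :=
    ((hH.contDiffAt h0).differentiableAt (by simp)).hasFDerivAt.comp_hasDerivAt 1
      ((hasDerivAt_id (1 : ℝ)).smul_const x)
  have h2 : HasDerivAt (fun c : ℝ => c ^ 2 * H x) (2 * H x) 1 := by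
    simpa using (hasDerivAt_pow 2 (1 : ℝ)).mul_const (H x)
  have h3 : (fun c : ℝ => H (c • x)) = fun c => c ^ 2 * H x := funext fun c => hH.map_smul c x
  rw [h3, one_smul] at h1
  exact h1.unique h2

/-- The Lie derivative of the Liouville form along the Hamiltonian field of a homogeneous function
vanishes. -/
lemma lieDeriv_liouville {H : PhaseSpace n → ℝ} (hH : IsHomHam H) {x : PhaseSpace n} (hx : x ≠ 0)
    (v : PhaseSpace n) :
    ⟪symplJ n (hamField H x), v⟫ + ⟪symplJ n x, fderiv ℝ (hamField H) x v⟫ = 0 := by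
  have hX : DifferentiableAt ℝ (hamField H) x :=
    ((contDiffOn_hamField hH.contDiffOn).contDiffAt
      (isOpen_compl_singleton.mem_nhds hx)).differentiableAt (by simp)
  -- Differentiate Euler's identity ⟪J x, X_H(x)⟫ = 2 H(x) in the direction v and use ⟪J v, X_H⟫ =
  -- dH(v).
  have h1 : HasFDerivAt (fun x => ⟪symplJ n x, hamField H x⟫)
      ((fderivInnerCLM ℝ (symplJ n x, hamField H x)).comp
        ((symplJ n).prod (fderiv ℝ (hamField H) x))) x :=
    (symplJ n).hasFDerivAt.inner ℝ hX.hasFDerivAt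
  have h2 : (fun x => ⟪symplJ n x, hamField H x⟫) =ᶠ[nhds x] fun x => 2 • H x := by
    filter_upwards [isOpen_compl_singleton.mem_nhds hx] with y hy
    rw [inner_hamField, hH.fderiv_self hy, nsmul_eq_mul]
    rfl
  have h3 := (((hH.contDiffAt hx).differentiableAt (by simp)).hasFDerivAt.const_smul
    (2 : ℕ)).congr_of_eventuallyEq h2
  have h4 := congrArg (fun C => C v) (h1.unique h3)
  have h5 := inner_hamField H x v
  have h6 := inner_symplJ_left (hamField H x) v
  rw [real_inner_comm] at h5
  simp only [ContinuousLinearMap.comp_apply, ContinuousLinearMap.prod_apply,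
    fderivInnerCLM_apply, smul_apply, nsmul_eq_mul] at h4
  rw [inner_hamField] at h4
  push_cast at h4
  linarith

/-- Existence of the flow of a homogeneous Hamiltonian. -/
theorem exists_flow {H : PhaseSpace n → ℝ} (hH : IsHomHam H) : ∃ f : ℝ → HomSymp n,
    HomSymp.SmoothFamily f ∧ f 0 = 1 ∧ (∀ s t, f (s + t) = f s * f t) ∧
    (∀ x, x ≠ 0 → ∀ t, HasDerivAt (fun t => f t x) (hamField H (f t x)) t) ∧
    ∀ γ : ℝ → PhaseSpace n, (∀ t, γ t ≠ 0) → (∀ t, HasDerivAt γ (hamField H (γ t)) t) →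
      ∀ t, γ t = f t (γ 0) := by
  have hXs := contDiffOn_hamField hH.contDiffOn
  obtain ⟨φ, h0, hne, hid, hs, hd, hu⟩ := exists_homogeneous_flow hXs
    fun c hc x _ => hH.hamField_smul hc x
  -- The group law and homogeneity both follow from uniqueness: a shifted or rescaled orbit is again
  -- an integral curve.
  have hadd : ∀ s t x, φ (s + t) x = φ s (φ t x) := fun s t x => by
    by_cases hx : x = 0
    · simp [hx, h0]
    · have := hu (fun s => φ (s + t) x) (fun s => hne _ _ hx)
        (fun s => (hd x hx (s + t)).comp_add_const s t) s
      simpa using this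
  have hsmul : ∀ t (c : ℝ) x, φ t (c • x) = c • φ t x := fun t c x => by
    by_cases hx : x = 0
    · simp [hx, h0]
    by_cases hc : c = 0
    · simp [hc, h0]
    have := hu (fun s => c • φ s x) (fun s => smul_ne_zero hc (hne _ _ hx)) (fun s => by
      rw [hH.hamField_smul hc]
      exact (hd x hx s).const_smul c) t
    rw [this, hid]
  have hsm : ∀ t, ContDiffOn ℝ ∞ (φ t) {0}ᶜ := fun t =>
    hs.comp (f := fun x => (t, x)) (contDiffOn_const.prodMk contDiffOn_id)
      fun x hx => ⟨mem_univ _, hx⟩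
  have hl : ∀ t z, z ≠ 0 → ∀ w, liouvilleForm (φ t z) (fderiv ℝ (φ t) z w) =
      liouvilleForm z w := by
    intro t z hz w
    set G : ℝ × PhaseSpace n → PhaseSpace n := fun q => φ q.1 q.2 with hG
    have hGs : ∀ t, ContDiffAt ℝ ∞ G (t, z) := fun t =>
      hs.contDiffAt ((isOpen_univ.prod isOpen_compl_singleton).mem_nhds ⟨mem_univ _, hz⟩)
    have hGd : ∀ t, DifferentiableAt ℝ G (t, z) := fun t => (hGs t).differentiableAt (by simp)
    have e1 : ∀ t, fderiv ℝ (φ t) z w = fderiv ℝ G (t, z) (0, w) := fun t => by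
      have h3 : HasFDerivAt (φ t) ((fderiv ℝ G (t, z)).comp
          ((0 : PhaseSpace n →L[ℝ] ℝ).prod (ContinuousLinearMap.id ℝ _))) z :=
        HasFDerivAt.comp (f := fun y => (t, y)) z (hGd t).hasFDerivAt
          ((hasFDerivAt_const t _).prodMk (hasFDerivAt_id _))
      rw [h3.fderiv]
      simp
    have e2 : ∀ t, ∀ y, y ≠ 0 → fderiv ℝ G (t, y) (1, 0) = hamField H (G (t, y)) := fun t y hy => by
      have h2 : HasDerivAt (fun s => φ s y) (fderiv ℝ G (t, y) (1, 0)) t :=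
        HasFDerivAt.comp_hasDerivAt (f := fun s : ℝ => (s, y)) t
          ((hs.contDiffAt ((isOpen_univ.prod isOpen_compl_singleton).mem_nhds
            (show (t, y) ∈ _ from ⟨mem_univ _, hy⟩))).differentiableAt (by simp)).hasFDerivAt
          ((hasDerivAt_id t).prodMk (hasDerivAt_const t _))
      exact h2.unique (hd y hy t)
    -- Variational equation along the orbit, obtained from `e2` by exchanging the t- and
    -- z-derivatives of G. Together with `lieDeriv_liouville` it makes the pull-back of λ₀ constant
    -- in t.
    have e3 : ∀ t, HasDerivAt (fun t => fderiv ℝ (φ t) z w)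
        (fderiv ℝ (hamField H) (φ t z) (fderiv ℝ (φ t) z w)) t := fun t => by
      have hD : HasFDerivAt (fderiv ℝ G) (fderiv ℝ (fderiv ℝ G) (t, z)) (t, z) :=
        (((hGs t).fderiv_right (m := ∞) (by simp)).differentiableAt (by simp)).hasFDerivAt
      have h1 : HasDerivAt (fun t => fderiv ℝ G (t, z) (0, w))
          (fderiv ℝ (fderiv ℝ G) (t, z) (1, 0) (0, w)) t := by
        have := (hD.comp_hasDerivAt (f := fun s : ℝ => (s, z)) t
          ((hasDerivAt_id t).prodMk (hasDerivAt_const t z))).clm_apply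
          (hasDerivAt_const t ((0 : ℝ), w))
        simpa using this
      have h2 : HasFDerivAt (fun q => fderiv ℝ G q ((1 : ℝ), (0 : PhaseSpace n)))
          ((fderiv ℝ (fderiv ℝ G) (t, z)).flip (1, 0)) (t, z) := by
        have := hD.clm_apply (hasFDerivAt_const ((1 : ℝ), (0 : PhaseSpace n)) (t, z))
        simpa using this
      have hXd : DifferentiableAt ℝ (hamField H) (G (t, z)) :=
        (hXs.contDiffAt (isOpen_compl_singleton.mem_nhds (hne t z hz))).differentiableAt (by simp)
      have h3 : HasFDerivAt (fun q => hamField H (G q))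
          ((fderiv ℝ (hamField H) (G (t, z))).comp (fderiv ℝ G (t, z))) (t, z) :=
        hXd.hasFDerivAt.comp (t, z) (hGd t).hasFDerivAt
      have h4 : (fun q => fderiv ℝ G q ((1 : ℝ), (0 : PhaseSpace n))) =ᶠ[nhds (t, z)]
          fun q => hamField H (G q) := by
        filter_upwards [(isOpen_univ.prod isOpen_compl_singleton).mem_nhds
          (show (t, z) ∈ (univ : Set ℝ) ×ˢ {(0 : PhaseSpace n)}ᶜ from ⟨mem_univ _, hz⟩)] with q hq
        exact e2 q.1 q.2 hq.2
      have h5 := congrArg (fun C => C ((0 : ℝ), w)) (h2.unique (h3.congr_of_eventuallyEq h4))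
      have h6 := ((hGs t).isSymmSndFDerivAt (by simpa using ENat.LEInfty.out)).eq (1, 0) (0, w)
      simp only [e1]
      refine h1.congr_deriv (h6.trans h5)
    have e4 : ∀ t, HasDerivAt (fun t => ⟪symplJ n (φ t z), fderiv ℝ (φ t) z w⟫) 0 t := fun t => by
      have h1 := ((symplJ n).hasFDerivAt.comp_hasDerivAt t (hd z hz t)).inner ℝ (e3 t)
      refine h1.congr_deriv ?_
      rw [add_comm]
      exact hH.lieDeriv_liouville (hne t z hz) _
    have e5 := is_const_of_deriv_eq_zero (fun t => (e4 t).differentiableAt)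
      (fun t => (e4 t).deriv) t 0
    have e6 : φ 0 = id := funext hid
    rw [liouvilleForm_eq, liouvilleForm_eq, e5, e6, fderiv_id]
    rfl
  have hinv : ∀ t x, φ (-t) (φ t x) = x := fun t x => by rw [← hadd, neg_add_cancel, hid]
  have hinv' : ∀ t x, φ t (φ (-t) x) = x := fun t x => by rw [← hadd, add_neg_cancel, hid]
  refine ⟨fun t => ⟨⟨φ t, φ (-t), hinv t, hinv' t⟩, hsm t, hsm (-t), hsmul t, hl t⟩, ⟨hs, ?_⟩,
    HomSymp.ext hid, fun s t => HomSymp.ext (hadd s t), hd, hu⟩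
  exact hs.comp (f := fun q : ℝ × PhaseSpace n => (-q.1, q.2))
    (contDiffOn_fst.neg.prodMk contDiffOn_snd) fun q hq => ⟨mem_univ _, hq.2⟩

/-- The flow of a homogeneous Hamiltonian. -/
def flow {H : PhaseSpace n → ℝ} (hH : IsHomHam H) : ℝ → HomSymp n := hH.exists_flow.choose

lemma smoothFamily_flow {H : PhaseSpace n → ℝ} (hH : IsHomHam H) :
    HomSymp.SmoothFamily hH.flow := hH.exists_flow.choose_spec.1

lemma flow_zero {H : PhaseSpace n → ℝ} (hH : IsHomHam H) : hH.flow 0 = 1 :=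
  hH.exists_flow.choose_spec.2.1

lemma flow_add {H : PhaseSpace n → ℝ} (hH : IsHomHam H) (s t : ℝ) :
    hH.flow (s + t) = hH.flow s * hH.flow t := hH.exists_flow.choose_spec.2.2.1 s t

lemma hasDerivAt_flow {H : PhaseSpace n → ℝ} (hH : IsHomHam H) {x : PhaseSpace n} (hx : x ≠ 0)
    (t : ℝ) : HasDerivAt (fun t => hH.flow t x) (hamField H (hH.flow t x)) t :=
  hH.exists_flow.choose_spec.2.2.2.1 x hx t

lemma eq_flow {H : PhaseSpace n → ℝ} (hH : IsHomHam H) {γ : ℝ → PhaseSpace n}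
    (h0 : ∀ t, γ t ≠ 0) (hγ : ∀ t, HasDerivAt γ (hamField H (γ t)) t) (t : ℝ) :
    γ t = hH.flow t (γ 0) := hH.exists_flow.choose_spec.2.2.2.2 γ h0 hγ t

lemma flow_neg {H : PhaseSpace n → ℝ} (hH : IsHomHam H) (t : ℝ) :
    hH.flow (-t) = (hH.flow t)⁻¹ := by
  rw [eq_inv_iff_mul_eq_one, ← flow_add, neg_add_cancel, flow_zero]

lemma hamiltonian_flow {H : PhaseSpace n → ℝ} (hH : IsHomHam H) (t : ℝ) {x : PhaseSpace n}
    (hx : x ≠ 0) : HomSymp.hamiltonian hH.flow t x = H x := by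
  have h1 := hH.hasDerivAt_flow (HomSymp.map_ne_zero (hH.flow t)⁻¹ hx) t
  rw [HomSymp.hamiltonian, h1.deriv, HomSymp.apply_inv_self, liouvilleForm_hamField,
    hH.fderiv_self hx]
  ring

end IsHomHam

end HamiltonianFlow

/-! ### Continuity and uniform positivity of contact Hamiltonians -/

section HamContinuity

variable {n : ℕ} [NeZero n]

local notation "𝓜" => 𝓡 (2 * n - 1)

/-- Lifting the curve through a local section replaces tangent spaces that vary with the point by
one fixed vector space, in which continuity of time derivatives can be discussed. -/
lemma stdForm_mfderivWithin_curve {c : ℝ → RP n} {σ : RP n → USphere n} {t : ℝ} {q : RP n}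
    (ht : t ∈ Icc (0 : ℝ) 1) (hq : c t = q)
    (hc : MDifferentiableWithinAt 𝓘(ℝ, ℝ) 𝓜 c (Icc (0 : ℝ) 1) t)
    (hσ : MDifferentiableAt 𝓜 𝓜 σ q) (hσm : ∀ᶠ p in nhds q, RP.mk (σ p) = p) :
    (stdForm q : EuclideanSpace ℝ (Fin (2 * n - 1)) →L[ℝ] ℝ)
      (mfderivWithin 𝓘(ℝ, ℝ) 𝓜 c (Icc (0 : ℝ) 1) t (1 : ℝ)) =
    liouvilleForm (σ q : PhaseSpace n) (mfderivWithin 𝓘(ℝ, ℝ) 𝓘(ℝ, PhaseSpace n)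
      (fun s => (σ (c s) : PhaseSpace n)) (Icc (0 : ℝ) 1) t (1 : ℝ) : PhaseSpace n) := by
  subst hq
  have hu := uniqueMDiffWithinAt_unitInterval ht
  set d : EuclideanSpace ℝ (Fin (2 * n - 1)) :=
    mfderivWithin 𝓘(ℝ, ℝ) 𝓜 c (Icc (0 : ℝ) 1) t (1 : ℝ) with hd
  have hmk : MDifferentiableAt 𝓜 𝓜 (RP.mk (n := n)) (σ (c t)) :=
    RP.contMDiff_mk.mdifferentiable (by simp) _
  have hval : MDifferentiableAt 𝓜 𝓘(ℝ, PhaseSpace n) (Subtype.val : USphere n → PhaseSpace n)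
      (σ (c t)) := (contMDiff_coe_sphere (m := ∞)).mdifferentiable (by simp) _
  have h1 : (mfderiv 𝓜 𝓜 RP.mk (σ (c t)) (mfderiv 𝓜 𝓜 σ (c t) d) :
      EuclideanSpace ℝ (Fin (2 * n - 1))) = d := by
    have h2 := mfderiv_comp (c t) hmk hσ
    have h3 : mfderiv 𝓜 𝓜 (RP.mk ∘ σ) (c t) = mfderiv 𝓜 𝓜 id (c t) :=
      Filter.EventuallyEq.mfderiv_eq hσm
    have h4 := h2.symm.trans (h3.trans mfderiv_id)
    exact congrArg (fun C : EuclideanSpace ℝ (Fin (2 * n - 1)) →L[ℝ]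
      EuclideanSpace ℝ (Fin (2 * n - 1)) => C d) h4
  have h5 : ∀ q : RP n, q = c t → ∀ v : EuclideanSpace ℝ (Fin (2 * n - 1)),
      (stdForm q : EuclideanSpace ℝ (Fin (2 * n - 1)) →L[ℝ] ℝ) v =
      (stdForm (c t) : EuclideanSpace ℝ (Fin (2 * n - 1)) →L[ℝ] ℝ) v := by
    rintro q rfl v; rfl
  have h6 := stdForm_mfderiv_mk (σ (c t)) (mfderiv 𝓜 𝓜 σ (c t) d)
  have h7 : (mfderivWithin 𝓘(ℝ, ℝ) 𝓘(ℝ, PhaseSpace n)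
      (fun s => (σ (c s) : PhaseSpace n)) (Icc (0 : ℝ) 1) t (1 : ℝ) : PhaseSpace n) =
      mvfderiv 𝓜 (Subtype.val : USphere n → PhaseSpace n) (σ (c t))
        (mfderiv 𝓜 𝓜 σ (c t) d) := by
    have h8 := mfderiv_comp_mfderivWithin t (hval.comp (c t) hσ) hc hu
    have h9 := mfderiv_comp (c t) hval hσ
    refine (congrArg (fun C : ℝ →L[ℝ] PhaseSpace n => C 1) h8).trans ?_
    exact congrArg (fun C : EuclideanSpace ℝ (Fin (2 * n - 1)) →L[ℝ] PhaseSpace n => C d) h9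
  rw [h7]
  refine Eq.trans ?_ h6
  refine Eq.trans ?_ (h5 _ hσm.self_of_nhds _).symm
  exact congrArg (stdForm (c t) : EuclideanSpace ℝ (Fin (2 * n - 1)) →L[ℝ] ℝ) h1.symm

/-- The contact Hamiltonian of a contact isotopy is continuous. -/
lemma continuousOn_ham (φ : ContactIsotopy (stdForm (n := n))) :
    ContinuousOn (fun z : ℝ × RP n => φ.ham z.1 z.2) (Icc (0 : ℝ) 1 ×ˢ univ) := by
  rintro ⟨t, q⟩ ⟨ht, -⟩
  obtain ⟨x, rfl⟩ := RP.mk_surjective q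
  obtain ⟨σ, hσ, -, hσm⟩ := RP.exists_smooth_section_through x
  set T : Set (ℝ × RP n) := Icc (0 : ℝ) 1 ×ˢ univ with hT
  set Γ : ℝ × RP n → ℝ → PhaseSpace n := fun z s =>
    (σ ((φ.toFun s : Equiv.Perm (RP n)) ((φ.toFun z.1 : Equiv.Perm (RP n)).symm z.2)) :
      PhaseSpace n) with hΓ
  have h1 : ContMDiffWithinAt ((𝓘(ℝ, ℝ).prod 𝓜).prod 𝓘(ℝ, ℝ)) 𝓘(ℝ, PhaseSpace n) ∞
      (Function.uncurry Γ) (T ×ˢ Icc (0 : ℝ) 1) ((t, RP.mk x), t) := by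
    have h2 : ContMDiffWithinAt ((𝓘(ℝ, ℝ).prod 𝓜).prod 𝓘(ℝ, ℝ)) 𝓜 ∞
        (fun p : (ℝ × RP n) × ℝ => (φ.toFun p.2 : Equiv.Perm (RP n))
          ((φ.toFun p.1.1 : Equiv.Perm (RP n)).symm p.1.2)) (T ×ˢ Icc (0 : ℝ) 1)
        ((t, RP.mk x), t) := by
      have h3 : ContMDiffOn ((𝓘(ℝ, ℝ).prod 𝓜).prod 𝓘(ℝ, ℝ)) 𝓜 ∞
          (fun p : (ℝ × RP n) × ℝ => (φ.toFun p.1.1 : Equiv.Perm (RP n)).symm p.1.2)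
          (T ×ˢ Icc (0 : ℝ) 1) := φ.smooth.2.comp contMDiffOn_fst fun p hp => hp.1
      exact (φ.smooth.1.comp (contMDiffOn_snd.prodMk h3) fun p hp => ⟨hp.2, mem_univ _⟩)
        _ ⟨⟨ht, mem_univ _⟩, ht⟩
    have h4 : ContMDiffAt 𝓜 𝓘(ℝ, PhaseSpace n) ∞ (fun p => (σ p : PhaseSpace n)) (RP.mk x) :=
      contMDiff_coe_sphere.contMDiffAt.comp _ hσ
    refine ContMDiffAt.comp_contMDiffWithinAt_of_eq (x := ((t, RP.mk x), t)) h4 h2 ?_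
    exact Equiv.apply_symm_apply _ _
  -- The lifted generator at (t, q) is the s-derivative at s = t of a map smooth in (t, q, s), hence
  -- continuous in (t, q).
  have h5 := ContMDiffWithinAt.mfderivWithin (m := 0) (g := fun z : ℝ × RP n => z.1) h1
    contMDiffWithinAt_fst ⟨ht, mem_univ _⟩ (fun z hz => hz.1) (by simp)
    (uniqueDiffOn_Icc zero_lt_one).uniqueMDiffOn
  let D : ℝ × RP n → ℝ →L[ℝ] PhaseSpace n := fun z =>
    mfderivWithin 𝓘(ℝ, ℝ) 𝓘(ℝ, PhaseSpace n) (Γ z) (Icc (0 : ℝ) 1) z.1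
  have h6 : ContinuousWithinAt D T (t, RP.mk x) :=
    (congrArg (fun F => ContinuousWithinAt F T (t, RP.mk x))
      (inTangentCoordinates_model_space (I := 𝓘(ℝ, ℝ)) (I' := 𝓘(ℝ, PhaseSpace n))
      (fun z : ℝ × RP n => z.1) (fun z : ℝ × RP n => Γ z z.1) D
      (t, RP.mk x))).mp h5.continuousWithinAt
  have h7 : ContinuousWithinAt (fun z : ℝ × RP n => (σ z.2 : PhaseSpace n)) T (t, RP.mk x) :=
    (ContinuousAt.comp (g := fun p => (σ p : PhaseSpace n)) (f := Prod.snd) (x := (t, RP.mk x))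
      (continuous_subtype_val.continuousAt.comp hσ.continuousAt)
      continuousAt_snd).continuousWithinAt
  have h8 : ContinuousWithinAt (fun z : ℝ × RP n => liouvilleForm (σ z.2 : PhaseSpace n)
      (D z 1)) T (t, RP.mk x) := by
    simp only [liouvilleForm_eq]
    exact continuousWithinAt_const.mul (((symplJ n).continuous.continuousAt.comp_continuousWithinAt
      h7).inner (h6.clm_apply continuousWithinAt_const))
  have h9 : ∀ᶠ q in nhds (RP.mk x), MDifferentiableAt 𝓜 𝓜 σ q := by
    have := (contMDiffAt_iff_contMDiffAt_nhds (n := 1) (by simp)).1 (hσ.of_le (by simp))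
    filter_upwards [this] with q hq using hq.mdifferentiableAt (by simp)
  have h10 : ∀ᶠ z in nhdsWithin (t, RP.mk x) T, φ.ham z.1 z.2 =
      liouvilleForm (σ z.2 : PhaseSpace n) (D z 1) := by
    have h11 : ∀ᶠ z in nhdsWithin (t, RP.mk x) T, MDifferentiableAt 𝓜 𝓜 σ z.2 ∧
        ∀ᶠ p in nhds z.2, RP.mk (σ p) = p :=
      ((continuous_snd.tendsto (t, RP.mk x)).eventually
        (h9.and hσm.eventually_nhds)).filter_mono nhdsWithin_le_nhds
    filter_upwards [h11, self_mem_nhdsWithin] with z hz hzT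
    exact stdForm_mfderivWithin_curve hzT.1 (Equiv.apply_symm_apply _ _)
      (φ.mdifferentiableWithinAt_curve hzT.1 _) hz.1 hz.2
  exact h8.congr_of_eventuallyEq h10 (h10.self_of_nhdsWithin ⟨ht, mem_univ _⟩)

/-- A non-negative isotopy which is positive at some time is uniformly positive on a time interval. -/
lemma exists_ham_ge {φ : ContactIsotopy (stdForm (n := n))} (h : φ.IsSomewherePositive) :
    ∃ a b δ : ℝ, 0 ≤ a ∧ a < b ∧ b ≤ 1 ∧ 0 < δ ∧ ∀ t ∈ Icc a b, ∀ q, δ ≤ φ.ham t q := by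
  obtain ⟨t₀, ht₀, hpos⟩ := h
  have hc := continuousOn_ham φ
  obtain ⟨δ, hδ, hge⟩ : ∃ δ : ℝ, 0 < δ ∧ ∀ q, δ < φ.ham t₀ q := by
    have h1 : Continuous fun q => φ.ham t₀ q :=
      hc.comp_continuous (f := fun q => (t₀, q)) (by fun_prop) fun q => ⟨ht₀, mem_univ _⟩
    have : Nonempty (RP n) := ⟨RP.mk (northPole n)⟩
    obtain ⟨q₀, -, hq₀⟩ := isCompact_univ.exists_isMinOn univ_nonempty h1.continuousOn
    have h2 : 0 < φ.ham t₀ q₀ := hpos q₀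
    exact ⟨φ.ham t₀ q₀ / 2, half_pos h2, fun q => (half_lt_self h2).trans_le (hq₀ (mem_univ q))⟩
  -- Compactness of the projective space makes the neighbourhood of t₀ uniform in q.
  have h3 : ∀ᶠ t in nhds t₀, ∀ q ∈ (univ : Set (RP n)), t ∈ Icc (0 : ℝ) 1 → δ < φ.ham t q := by
    refine isCompact_univ.eventually_forall_of_forall_eventually fun q _ => ?_
    have h4 := (hc (t₀, q) ⟨ht₀, mem_univ _⟩).eventually (lt_mem_nhds (hge q))
    rw [eventually_nhdsWithin_iff] at h4
    filter_upwards [h4] with z hz hz1 using hz ⟨hz1, mem_univ _⟩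
  obtain ⟨ε, hε, h5⟩ := Metric.eventually_nhds_iff.1 h3
  -- Truncation to [0, 1] leaves an interval of positive length even if t₀ is an end-point.
  refine ⟨max 0 (t₀ - ε / 2), min 1 (t₀ + ε / 2), δ, le_max_left _ _, ?_, min_le_left _ _, hδ,
    fun t ht q => (h5 ?_ q (mem_univ _) ⟨(le_max_left _ _).trans ht.1,
      ht.2.trans (min_le_left _ _)⟩).le⟩
  · rw [max_lt_iff, lt_min_iff, lt_min_iff]
    exact ⟨⟨zero_lt_one, by linarith [ht₀.1]⟩, by linarith [ht₀.2], by linarith⟩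
  · rw [Real.dist_eq, abs_lt]
    have h6 := (le_max_right _ _).trans ht.1
    have h7 := ht.2.trans (min_le_right _ _)
    constructor <;> linarith

end HamContinuity

/-! ### Rotations as a yardstick for positive elements -/

section Rotation

variable {n : ℕ}

lemma isHomHam_halfNormSq : IsHomHam (fun x : PhaseSpace n => 1 / 2 * ‖x‖ ^ 2) where
  contDiffOn := (contDiff_const.mul (contDiff_norm_sq ℝ)).contDiffOn
  map_smul c x := by rw [norm_smul, mul_pow, Real.norm_eq_abs, sq_abs]; ring

lemma hamField_eq {H : PhaseSpace n → ℝ} {x v : PhaseSpace n}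
    (h : HasFDerivAt H (innerSL ℝ v) x) : hamField H x = symplJ n v := by
  rw [hamField, gradient, h.fderiv]
  congr 1
  exact (InnerProductSpace.toDual ℝ (PhaseSpace n)).symm_apply_apply v

lemma hamField_halfNormSq (x : PhaseSpace n) :
    hamField (fun x : PhaseSpace n => 1 / 2 * ‖x‖ ^ 2) x = symplJ n x := by
  refine hamField_eq ?_
  have h1 := ((hasStrictFDerivAt_norm_sq x).hasFDerivAt).const_mul (1 / 2 : ℝ)
  refine h1.congr_fderiv ?_
  ext v
  simp

/-- The rotations `z ↦ e^{it} z`. -/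
def rot : ℝ → HomSymp n := isHomHam_halfNormSq.flow

lemma smoothFamily_rot : HomSymp.SmoothFamily (rot (n := n)) := isHomHam_halfNormSq.smoothFamily_flow

lemma rot_zero : rot (n := n) 0 = 1 := isHomHam_halfNormSq.flow_zero

lemma rot_add (s t : ℝ) : rot (n := n) (s + t) = rot s * rot t := isHomHam_halfNormSq.flow_add s t

lemma norm_cos_add_sin (t : ℝ) (x : PhaseSpace n) :
    ‖Real.cos t • x + Real.sin t • symplJ n x‖ ^ 2 = ‖x‖ ^ 2 := by
  have h1 : ⟪x, symplJ n x⟫ = 0 := by rw [real_inner_comm]; exact inner_symplJ_self x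
  have h2 : ‖symplJ n x‖ ^ 2 = ‖x‖ ^ 2 := by
    rw [← real_inner_self_eq_norm_sq, inner_symplJ_symplJ, real_inner_self_eq_norm_sq]
  rw [norm_add_sq_real, real_inner_smul_left, real_inner_smul_right, h1, norm_smul, norm_smul,
    mul_pow, mul_pow, h2, Real.norm_eq_abs, Real.norm_eq_abs, sq_abs, sq_abs]
  linear_combination ‖x‖ ^ 2 * Real.cos_sq_add_sin_sq t

lemma rot_apply (t : ℝ) (x : PhaseSpace n) :
    rot t x = Real.cos t • x + Real.sin t • symplJ n x := by
  by_cases hx : x = 0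
  · simp [hx]
  have h := isHomHam_halfNormSq.eq_flow (n := n)
    (γ := fun t => Real.cos t • x + Real.sin t • symplJ n x) (fun t h0 => hx ?_) (fun t => ?_) t
  · simp only [Real.cos_zero, Real.sin_zero, one_smul, zero_smul, add_zero] at h
    exact h.symm
  · have h1 := norm_cos_add_sin t x
    rw [h0] at h1
    simpa using h1.symm
  · rw [hamField_halfNormSq]
    refine (((Real.hasDerivAt_cos t).smul_const x).add
      ((Real.hasDerivAt_sin t).smul_const (symplJ n x))).congr_deriv ?_
    simp
    abel

lemma norm_rot (t : ℝ) (x : PhaseSpace n) : ‖rot t x‖ = ‖x‖ := by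
  have h := norm_cos_add_sin t x
  rw [← rot_apply] at h
  exact (sq_eq_sq₀ (norm_nonneg _) (norm_nonneg _)).1 h

lemma hamiltonian_rot (t : ℝ) {x : PhaseSpace n} (hx : x ≠ 0) :
    HomSymp.hamiltonian rot t x = 1 / 2 * ‖x‖ ^ 2 := isHomHam_halfNormSq.hamiltonian_flow t hx

lemma hamiltonian_rot_mul (c t : ℝ) {x : PhaseSpace n} (hx : x ≠ 0) :
    HomSymp.hamiltonian (fun t => rot (c * t)) t x = c * (1 / 2 * ‖x‖ ^ 2) := by
  have h1 : HasDerivAt (fun t : ℝ => c * t) c t := by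
    simpa using (hasDerivAt_id t).const_mul c
  rw [HomSymp.hamiltonian_comp smoothFamily_rot h1 hx, hamiltonian_rot _ hx]

variable [NeZero n]

/-- The class of the path `t ↦ e^{ict}`. -/
def rotClass (n : ℕ) [NeZero n] (c : ℝ) : ContRPCover n :=
  UniversalCover.mk (HomSymp.isotopy (fun t => rot (c * t))
    (smoothFamily_rot.comp (a := fun t : ℝ => c * t) (by fun_prop)) (by simp [rot_zero]))

lemma rotClass_add (c d : ℝ) : rotClass n (c + d) = rotClass n c * rotClass n d := by
  rw [rotClass, rotClass, rotClass, HomSymp.mk_isotopy_mul]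
  congr 1
  refine HomSymp.isotopy_congr _ _ _ _ fun t => ?_
  rw [add_mul, rot_add]

lemma rotClass_mono {c d : ℝ} (h : c ≤ d) :
    UniversalCover.Precedes (rotClass n c) (rotClass n d) := by
  refine HomSymp.precedes_mk_isotopy _ _ _ _ fun t _ x => ?_
  have hx : (x : PhaseSpace n) ≠ 0 := ne_zero_of_mem_unit_sphere x
  rw [hamiltonian_rot_mul c t hx, hamiltonian_rot_mul d t hx]
  exact mul_le_mul_of_nonneg_right h (by positivity)

/-- A class which strictly dominates the identity dominates a small rotation. -/
lemma exists_rotClass_precedes {φ : ContactIsotopy (stdForm (n := n))} (h1 : φ.IsNonneg)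
    (h2 : φ.IsSomewherePositive) :
    ∃ ε : ℝ, 0 < ε ∧ UniversalCover.Precedes (rotClass n ε) (UniversalCover.mk φ) := by
  obtain ⟨a, b, δ, ha, hab, hb, hδ, hge⟩ := exists_ham_ge h2
  -- The rotation is carried out only during [a, b], where φ is uniformly positive; elsewhere its
  -- Hamiltonian vanishes and non-negativity of φ suffices.
  set s : ℝ → ℝ := fun t => Real.smoothTransition ((t - a) / (b - a)) with hs
  have hba : 0 < b - a := sub_pos.2 hab
  have hss : ContDiff ℝ ∞ s := Real.smoothTransition.contDiff.comp (by fun_prop)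
  have hsm : Monotone s := fun x y hxy =>
    Real.smoothTransition.monotone (div_le_div_of_nonneg_right (by linarith) hba.le)
  have hs0 : ∀ t ≤ a, s t = 0 := fun t ht =>
    Real.smoothTransition.zero_of_nonpos (div_nonpos_of_nonpos_of_nonneg (by linarith) hba.le)
  have hs1 : ∀ t, b ≤ t → s t = 1 := fun t ht =>
    Real.smoothTransition.one_of_one_le ((one_le_div hba).2 (by linarith))
  have hd0 : ∀ t, t ∉ Icc a b → deriv s t = 0 := fun t ht => by
    rw [mem_Icc, not_and_or, not_le, not_le] at ht
    rcases ht with ht | ht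
    · have : s =ᶠ[nhds t] fun _ => 0 := by
        filter_upwards [gt_mem_nhds ht] with r hr using hs0 r (le_of_lt hr)
      rw [this.deriv_eq, deriv_const]
    · have : s =ᶠ[nhds t] fun _ => 1 := by
        filter_upwards [lt_mem_nhds ht] with r hr using hs1 r (le_of_lt hr)
      rw [this.deriv_eq, deriv_const]
  obtain ⟨C, hC⟩ := (isCompact_Icc (a := (0 : ℝ)) (b := 1)).exists_bound_of_continuousOn
    (hss.continuous_deriv (by simp)).continuousOn
  have hC' : ∀ t ∈ Icc (0 : ℝ) 1, deriv s t ≤ |C| := fun t ht =>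
    (le_abs_self _).trans ((hC t ht).trans (le_abs_self C))
  have hC0 : 0 < |C| + 1 := by positivity
  -- On the sphere the reparametrized rotation has Hamiltonian s'(t) ε / 2, which is at most δ
  -- because s' ≤ |C|; the added 1 avoids division by zero.
  set ε : ℝ := δ / (|C| + 1) with hε
  have hε0 : 0 < ε := div_pos hδ hC0
  have hm : MapsTo s (Icc 0 1) (Icc 0 1) := fun t _ =>
    ⟨Real.smoothTransition.nonneg _, Real.smoothTransition.le_one _⟩
  refine ⟨ε, hε0, ?_⟩
  set ρ := HomSymp.isotopy (fun t => rot (n := n) (ε * t))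
    (smoothFamily_rot.comp (a := fun t : ℝ => ε * t) (by fun_prop)) (by simp [rot_zero]) with hρ
  change UniversalCover.Precedes (UniversalCover.mk ρ) _
  rw [← ρ.mk_reparam hss hm (hs0 0 ha) (hs1 1 hb)]
  refine UniversalCover.precedes_of_ham_le fun t ht q => ?_
  obtain ⟨x, rfl⟩ := RP.mk_surjective q
  have hx : (x : PhaseSpace n) ≠ 0 := ne_zero_of_mem_unit_sphere x
  rw [ρ.ham_reparam hss hm (hs0 0 ha) ht, hρ, HomSymp.ham_isotopy_mk _ _ (hm ht),
    hamiltonian_rot_mul _ _ hx, norm_eq_of_mem_sphere]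
  by_cases htab : t ∈ Icc a b
  · refine le_trans ?_ (hge t htab _)
    have h3 : 0 ≤ deriv s t := hsm.deriv_nonneg
    have h4 := hC' t ht
    have h5 : ε * (|C| + 1) = δ := div_mul_cancel₀ _ hC0.ne'
    nlinarith
  · rw [hd0 t htab, zero_mul]
    exact h1 t ht _

end Rotation

/-! ### The pumping Hamiltonian in complex coordinates -/

section ComplexCoordinates

open Complex

variable {n : ℕ}

/-- The complex coordinates `z_j = x_j + i y_j`. -/
def cplx (j : Fin n) : PhaseSpace n →L[ℝ] ℂ :=
  ofRealCLM.comp (EuclideanSpace.proj (Sum.inl j)) +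
    I • ofRealCLM.comp (EuclideanSpace.proj (Sum.inr j))

lemma cplx_apply (j : Fin n) (z : PhaseSpace n) :
    cplx j z = (z (Sum.inl j) : ℂ) + I * (z (Sum.inr j) : ℂ) := by
  simp [cplx]

@[simp] lemma cplx_re (j : Fin n) (z : PhaseSpace n) : (cplx j z).re = z (Sum.inl j) := by
  simp [cplx_apply]

@[simp] lemma cplx_im (j : Fin n) (z : PhaseSpace n) : (cplx j z).im = z (Sum.inr j) := by
  simp [cplx_apply]

lemma cplx_symplJ (j : Fin n) (z : PhaseSpace n) : cplx j (symplJ n z) = I * cplx j z := by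
  apply Complex.ext <;> simp

lemma sum_normSq_cplx (z : PhaseSpace n) : ∑ j, normSq (cplx j z) = ‖z‖ ^ 2 := by
  rw [← real_inner_self_eq_norm_sq, inner_phaseSpace]
  exact Finset.sum_congr rfl fun j _ => by simp [normSq_apply]

lemma inner_eq_sum_cplx (z w : PhaseSpace n) :
    ⟪z, w⟫ = ∑ j, ((starRingEnd ℂ) (cplx j z) * cplx j w).re := by
  rw [inner_phaseSpace]
  exact Finset.sum_congr rfl fun j _ => by simp

lemma cplx_rot (t : ℝ) (j : Fin n) (z : PhaseSpace n) :
    cplx j (rot t z) = exp (t * I) * cplx j z := by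
  rw [rot_apply, map_add, map_smul, map_smul, cplx_symplJ, exp_mul_I, real_smul, real_smul]
  push_cast
  ring

/-- The vector with given complex coordinates. -/
def ofCplx (u : Fin n → ℂ) : PhaseSpace n :=
  WithLp.toLp 2 (Sum.elim (fun j => (u j).re) (fun j => (u j).im))

@[simp] lemma cplx_ofCplx (u : Fin n → ℂ) (j : Fin n) : cplx j (ofCplx u) = u j := by
  apply Complex.ext <;> simp [ofCplx]

/-- J is onto, so the pairings with all J w determine a vector. -/
lemma eq_hamField {H : PhaseSpace n → ℝ} {x V : PhaseSpace n}
    (h : ∀ w, ⟪symplJ n w, V⟫ = fderiv ℝ H x w) : hamField H x = V := by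
  refine ext_inner_left ℝ fun w => ?_
  have h1 := inner_hamField H x (-symplJ n w)
  rw [← h, map_neg, symplJ_symplJ, neg_neg] at h1
  exact h1

/-- `∑ z_j ^ (2m+2)`. -/
def powSum (m : ℕ) (z : PhaseSpace n) : ℂ := ∑ j, cplx j z ^ (2 * m + 2)

/-- `∑ (Re z_j ^ (m+1))²`. -/
def reSq (m : ℕ) (z : PhaseSpace n) : ℝ := ∑ j, (cplx j z ^ (m + 1)).re ^ 2

/-- The Hamiltonian `-Im ∑ z_j ^ (2m+2) / |z| ^ (2m)`. -/
def pumpHam (m : ℕ) (z : PhaseSpace n) : ℝ := -(powSum m z).im * ((‖z‖ ^ 2) ^ m)⁻¹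

lemma hasFDerivAt_powSum (m : ℕ) (z : PhaseSpace n) : HasFDerivAt (powSum m)
    (∑ j, (((2 * m + 2 : ℕ) : ℂ) * cplx j z ^ (2 * m + 1)) • cplx j) z := by
  refine HasFDerivAt.fun_sum fun j _ => ?_
  have h := (hasDerivAt_pow (2 * m + 2) (cplx j z)).comp_hasFDerivAt z (cplx j).hasFDerivAt
  exact h

lemma contDiff_powSum (m : ℕ) : ContDiff ℝ ∞ (powSum m : PhaseSpace n → ℂ) :=
  ContDiff.sum fun j _ => (cplx j).contDiff.pow _

lemma contDiff_reSq (m : ℕ) : ContDiff ℝ ∞ (reSq m : PhaseSpace n → ℝ) :=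
  ContDiff.sum fun j _ => ContDiff.pow (f := fun z => (cplx j z ^ (m + 1)).re)
    (reCLM.contDiff.comp ((cplx j).contDiff.pow (m + 1))) 2

lemma powSum_smul (m : ℕ) (c : ℝ) (z : PhaseSpace n) :
    powSum m (c • z) = (c : ℂ) ^ (2 * m + 2) * powSum m z := by
  simp only [powSum, Finset.mul_sum, map_smul, real_smul, mul_pow]

lemma reSq_smul (m : ℕ) (c : ℝ) (z : PhaseSpace n) :
    reSq m (c • z) = (c ^ 2) ^ (m + 1) * reSq m z := by
  simp only [reSq, Finset.mul_sum, map_smul, real_smul, mul_pow, ← ofReal_pow, re_ofReal_mul]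
  exact Finset.sum_congr rfl fun j _ => by ring

lemma isHomHam_pumpHam (m : ℕ) : IsHomHam (pumpHam m : PhaseSpace n → ℝ) where
  contDiffOn z hz := by
    have h1 : ContDiffAt ℝ ∞ (fun z : PhaseSpace n => (powSum m z).im) z :=
      (imCLM.contDiff.comp (contDiff_powSum m)).contDiffAt
    have h2 : ContDiffAt ℝ ∞ (fun z : PhaseSpace n => ((‖z‖ ^ 2) ^ m)⁻¹) z :=
      ((contDiff_norm_sq ℝ).pow m).contDiffAt.inv
        (pow_ne_zero m (pow_ne_zero 2 (norm_ne_zero_iff.2 hz)))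
    exact (h1.neg.mul h2).contDiffWithinAt
  map_smul c z := by
    by_cases hc : c = 0
    · simp [hc, pumpHam, powSum]
    have h1 : (c ^ 2) ^ m ≠ 0 := pow_ne_zero m (pow_ne_zero 2 hc)
    rw [pumpHam, pumpHam, powSum_smul, ← ofReal_pow, im_ofReal_mul, norm_smul, mul_pow, mul_pow,
      Real.norm_eq_abs, sq_abs, mul_inv]
    field_simp
    ring

/-- The conjugate power comes from Im z_j^(2m+2); the multiple of i z_j comes from differentiating
|z|^(-2m) and is an infinitesimal rotation. The formula is verified by pairing with J w. -/
lemma cplx_hamField_pumpHam (m : ℕ) {z : PhaseSpace n} (hz : z ≠ 0) (j : Fin n) :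
    cplx j (hamField (pumpHam m) z) = ((((‖z‖ ^ 2) ^ m)⁻¹ : ℝ) : ℂ) *
      ((2 * (m + 1) : ℝ) * (starRingEnd ℂ) (cplx j z) ^ (2 * m + 1) +
        (2 * m * ((powSum m z).im / ‖z‖ ^ 2) : ℝ) * I * cplx j z) := by
  have hN : ‖z‖ ^ 2 ≠ 0 := pow_ne_zero 2 (norm_ne_zero_iff.2 hz)
  have h1 := ((imCLM.hasFDerivAt (x := powSum m z)).comp z (hasFDerivAt_powSum m z)).neg
  have h0 : HasDerivAt (fun y : ℝ => (y ^ m)⁻¹) _ (‖z‖ ^ 2) :=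
    (hasDerivAt_pow m (‖z‖ ^ 2)).fun_inv (pow_ne_zero m hN)
  have h2 : HasFDerivAt (fun z : PhaseSpace n => ((‖z‖ ^ 2) ^ m)⁻¹) _ z :=
    HasDerivAt.comp_hasFDerivAt (f := fun z : PhaseSpace n => ‖z‖ ^ 2) z h0
      (hasStrictFDerivAt_norm_sq z).hasFDerivAt
  have h3 : HasFDerivAt (pumpHam m) _ z := h1.mul h2
  rw [eq_hamField (V := ofCplx fun j => ((((‖z‖ ^ 2) ^ m)⁻¹ : ℝ) : ℂ) *
      ((2 * (m + 1) : ℝ) * (starRingEnd ℂ) (cplx j z) ^ (2 * m + 1) +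
        (2 * m * ((powSum m z).im / ‖z‖ ^ 2) : ℝ) * I * cplx j z)), cplx_ofCplx]
  intro w
  have e1 : ∀ j, ((starRingEnd ℂ) (cplx j (symplJ n w)) * (((((‖z‖ ^ 2) ^ m)⁻¹ : ℝ) : ℂ) *
      ((2 * (m + 1) : ℝ) * (starRingEnd ℂ) (cplx j z) ^ (2 * m + 1) +
        (2 * m * ((powSum m z).im / ‖z‖ ^ 2) : ℝ) * I * cplx j z))).re =
      -(((‖z‖ ^ 2) ^ m)⁻¹ * (2 * (m + 1))) * (cplx j z ^ (2 * m + 1) * cplx j w).im +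
      (((‖z‖ ^ 2) ^ m)⁻¹ * (2 * m * ((powSum m z).im / ‖z‖ ^ 2))) *
        ((starRingEnd ℂ) (cplx j z) * cplx j w).re := fun j => by
    have e2 : (starRingEnd ℂ) (cplx j z) ^ (2 * m + 1) =
      (starRingEnd ℂ) (cplx j z ^ (2 * m + 1)) := (map_pow _ _ _).symm
    rw [cplx_symplJ, e2]
    generalize cplx j z ^ (2 * m + 1) = p
    generalize ((‖z‖ ^ 2) ^ m)⁻¹ = a
    generalize 2 * ((m : ℝ) + 1) = b
    generalize 2 * m * ((powSum m z).im / ‖z‖ ^ 2) = d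
    simp
    ring
  rw [h3.fderiv, inner_eq_sum_cplx]
  simp only [cplx_ofCplx, e1]
  rw [Finset.sum_add_distrib, ← Finset.mul_sum, ← Finset.mul_sum, ← inner_eq_sum_cplx]
  have e3 : ∑ j, (cplx j z ^ (2 * m + 1) * cplx j w).im =
      (∑ j, cplx j z ^ (2 * m + 1) * cplx j w).im := (im_sum _ _).symm
  -- The factor m keeps this true for m = 0, where m - 1 is truncated.
  have e4 : (m : ℝ) * (‖z‖ ^ 2) ^ (m - 1) * ‖z‖ ^ 2 = m * (‖z‖ ^ 2) ^ m := by
    cases m with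
    | zero => simp
    | succ m => rw [pow_succ, Nat.add_sub_cancel]; ring
  have e5 : (m : ℝ) * (‖z‖ ^ 2) ^ (m - 1) / ((‖z‖ ^ 2) ^ m) ^ 2 =
      m * (((‖z‖ ^ 2) ^ m)⁻¹ / ‖z‖ ^ 2) := by
    have := pow_ne_zero m hN
    rw [div_eq_iff (by positivity)]
    field_simp
    linear_combination e4
  rw [e3]
  simp only [ContinuousLinearMap.comp_apply, add_apply, neg_apply, smul_apply, sum_apply]
  have e6 : imCLM (∑ j, (((2 * m + 2 : ℕ) : ℂ) * cplx j z ^ (2 * m + 1)) • cplx j w) =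
      2 * (m + 1) * (∑ j, cplx j z ^ (2 * m + 1) * cplx j w).im := by
    simp only [smul_eq_mul, mul_assoc, ← Finset.mul_sum]
    rw [← ofReal_natCast, imCLM_apply, im_ofReal_mul]
    push_cast
    ring
  rw [e6, neg_div, e5]
  simp only [Function.comp_apply, Pi.neg_apply, imCLM_apply, innerSL_apply_apply, smul_eq_mul,
    nsmul_eq_mul, Nat.cast_ofNat]
  ring

end ComplexCoordinates

/-! ### Growth estimates for the pumping flow -/

section Pump

open Complex

variable {n : ℕ}

lemma powSum_eq_sum_sq (m : ℕ) (z : PhaseSpace n) :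
    powSum m z = ∑ j, (cplx j z ^ (m + 1)) ^ 2 := by
  simp only [powSum, ← pow_mul]
  exact Finset.sum_congr rfl fun j _ => by congr 1; ring

lemma normSq_cplx_pow (m : ℕ) (z : PhaseSpace n) (j : Fin n) :
    (cplx j z ^ (m + 1)).re ^ 2 + (cplx j z ^ (m + 1)).im ^ 2 = normSq (cplx j z) ^ (m + 1) := by
  rw [← map_pow normSq, normSq_apply]
  ring

lemma powSum_im (m : ℕ) (z : PhaseSpace n) : (powSum m z).im =
    2 * ∑ j, (cplx j z ^ (m + 1)).re * (cplx j z ^ (m + 1)).im := by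
  rw [powSum_eq_sum_sq, im_sum, Finset.mul_sum]
  refine Finset.sum_congr rfl fun j _ => ?_
  rw [sq, mul_im]
  ring

lemma powSum_re (m : ℕ) (z : PhaseSpace n) : (powSum m z).re =
    reSq m z - ∑ j, (cplx j z ^ (m + 1)).im ^ 2 := by
  rw [powSum_eq_sum_sq, re_sum, reSq, ← Finset.sum_sub_distrib]
  refine Finset.sum_congr rfl fun j _ => ?_
  rw [sq, mul_re]
  ring

lemma sum_normSq_pow_le (m : ℕ) (z : PhaseSpace n) :
    ∑ j, normSq (cplx j z) ^ (m + 1) ≤ (‖z‖ ^ 2) ^ (m + 1) := by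
  rw [← sum_normSq_cplx, pow_succ, Finset.mul_sum]
  refine Finset.sum_le_sum fun j _ => ?_
  rw [pow_succ]
  exact mul_le_mul_of_nonneg_right (pow_le_pow_left₀ (normSq_nonneg _)
    (Finset.single_le_sum (f := fun j => normSq (cplx j z)) (fun i _ => normSq_nonneg _)
    (Finset.mem_univ j)) m) (normSq_nonneg _)

/-- Power mean inequality over the n coordinates; the powers of n in later constants come from here.
-/
lemma le_sum_normSq_pow (m : ℕ) (z : PhaseSpace n) :
    (‖z‖ ^ 2) ^ (m + 1) / (n : ℝ) ^ m ≤ ∑ j, normSq (cplx j z) ^ (m + 1) := by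
  have h1 := pow_sum_div_card_le_sum_pow (s := Finset.univ)
    (f := fun j : Fin n => normSq (cplx j z)) (fun j _ => normSq_nonneg _) m
  rwa [sum_normSq_cplx, Finset.card_univ, Fintype.card_fin] at h1

lemma reSq_nonneg (m : ℕ) (z : PhaseSpace n) : 0 ≤ reSq m z :=
  Finset.sum_nonneg fun _ _ => sq_nonneg _

lemma reSq_add_imSq (m : ℕ) (z : PhaseSpace n) : reSq m z + ∑ j, (cplx j z ^ (m + 1)).im ^ 2 =
    ∑ j, normSq (cplx j z) ^ (m + 1) := by
  rw [reSq, ← Finset.sum_add_distrib]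
  exact Finset.sum_congr rfl fun j _ => normSq_cplx_pow m z j

lemma reSq_le (m : ℕ) (z : PhaseSpace n) : reSq m z ≤ (‖z‖ ^ 2) ^ (m + 1) := by
  have h1 := reSq_add_imSq m z
  have h2 : 0 ≤ ∑ j, (cplx j z ^ (m + 1)).im ^ 2 := Finset.sum_nonneg fun _ _ => sq_nonneg _
  linarith [sum_normSq_pow_le m z]

lemma abs_powSum_re_le (m : ℕ) (z : PhaseSpace n) : |(powSum m z).re| ≤ (‖z‖ ^ 2) ^ (m + 1) := by
  have h1 := reSq_add_imSq m z
  have h2 : 0 ≤ ∑ j, (cplx j z ^ (m + 1)).im ^ 2 := Finset.sum_nonneg fun _ _ => sq_nonneg _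
  have h3 := reSq_nonneg m z
  have h4 := sum_normSq_pow_le m z
  rw [powSum_re, abs_le]
  constructor <;> linarith

/-- The radial derivative along the pumping field. -/
lemma inner_hamField_pumpHam (m : ℕ) {z : PhaseSpace n} (hz : z ≠ 0) :
    2 * ⟪z, hamField (pumpHam m) z⟫ = ((‖z‖ ^ 2) ^ m)⁻¹ * (4 * (m + 1) * (powSum m z).re) := by
  rw [inner_eq_sum_cplx, powSum, re_sum, Finset.mul_sum, Finset.mul_sum, Finset.mul_sum]
  refine Finset.sum_congr rfl fun j _ => ?_
  rw [cplx_hamField_pumpHam m hz, ← map_pow (starRingEnd ℂ)]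
  generalize 2 * (m : ℝ) * ((powSum m z).im / ‖z‖ ^ 2) = d
  generalize ((‖z‖ ^ 2) ^ m)⁻¹ = a
  rw [show 2 * m + 2 = (2 * m + 1) + 1 by ring, pow_succ _ (2 * m + 1)]
  generalize cplx j z ^ (2 * m + 1) = p
  simp
  ring

/-- The derivative of `Re ∑ z_j ^ (2m+2)` along the pumping field. -/
lemma deriv_powSum_re (m : ℕ) {z : PhaseSpace n} (hz : z ≠ 0) :
    (∑ j, (((2 * m + 2 : ℕ) : ℂ) * cplx j z ^ (2 * m + 1)) * cplx j (hamField (pumpHam m) z)).re =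
    ((‖z‖ ^ 2) ^ m)⁻¹ * (4 * (m + 1) ^ 2 * ∑ j, normSq (cplx j z) ^ (2 * m + 1) -
      4 * (m + 1) * m * ((powSum m z).im / ‖z‖ ^ 2) * (powSum m z).im) := by
  have h1 : (powSum m z).im = ∑ j, (cplx j z ^ (2 * m + 1) * cplx j z).im := by
    rw [powSum, im_sum]
    rfl
  have h2 : ∀ j, ((((2 * m + 2 : ℕ) : ℂ) * cplx j z ^ (2 * m + 1)) *
      cplx j (hamField (pumpHam m) z)).re = ((‖z‖ ^ 2) ^ m)⁻¹ * (4 * (m + 1) ^ 2 *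
      normSq (cplx j z) ^ (2 * m + 1) - 4 * (m + 1) * m * ((powSum m z).im / ‖z‖ ^ 2) *
      (cplx j z ^ (2 * m + 1) * cplx j z).im) := fun j => by
    rw [cplx_hamField_pumpHam m hz, ← map_pow (starRingEnd ℂ), ← map_pow normSq, normSq_apply]
    generalize (powSum m z).im / ‖z‖ ^ 2 = d
    generalize ((‖z‖ ^ 2) ^ m)⁻¹ = a
    generalize cplx j z ^ (2 * m + 1) = p
    simp
    ring
  rw [re_sum, Finset.sum_congr rfl fun j _ => h2 j, ← Finset.mul_sum, Finset.sum_sub_distrib,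
    ← Finset.mul_sum, ← Finset.mul_sum, ← h1]

/-- The derivative of `∑ (Re z_j ^ (m+1))²` along the pumping field. -/
lemma deriv_reSq (m : ℕ) {z : PhaseSpace n} (hz : z ≠ 0) :
    ∑ j, 2 * (cplx j z ^ (m + 1)).re * (((m + 1 : ℕ) : ℂ) * cplx j z ^ m *
      cplx j (hamField (pumpHam m) z)).re =
    ((‖z‖ ^ 2) ^ m)⁻¹ * (4 * (m + 1) ^ 2 * ∑ j, normSq (cplx j z) ^ m *
      (cplx j z ^ (m + 1)).re ^ 2 -
      2 * (m + 1) * m * ((powSum m z).im / ‖z‖ ^ 2) * (powSum m z).im) := by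
  have h2 : ∀ j, 2 * (cplx j z ^ (m + 1)).re * (((m + 1 : ℕ) : ℂ) * cplx j z ^ m *
      cplx j (hamField (pumpHam m) z)).re = ((‖z‖ ^ 2) ^ m)⁻¹ * (4 * (m + 1) ^ 2 *
      (normSq (cplx j z) ^ m * (cplx j z ^ (m + 1)).re ^ 2) -
      4 * (m + 1) * m * ((powSum m z).im / ‖z‖ ^ 2) *
      ((cplx j z ^ (m + 1)).re * (cplx j z ^ (m + 1)).im)) := fun j => by
    have h3 : cplx j z ^ m * (starRingEnd ℂ) (cplx j z) ^ (2 * m + 1) =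
        ((normSq (cplx j z) ^ m : ℝ) : ℂ) * (starRingEnd ℂ) (cplx j z ^ (m + 1)) := by
      rw [ofReal_pow, ← mul_conj, map_pow, mul_pow]
      ring
    have h4 : ((m + 1 : ℕ) : ℂ) * cplx j z ^ m * cplx j (hamField (pumpHam m) z) =
        (((m + 1 : ℕ) : ℝ) : ℂ) * ((((‖z‖ ^ 2) ^ m)⁻¹ : ℝ) : ℂ) * ((2 * (m + 1) : ℝ) *
        (((normSq (cplx j z) ^ m : ℝ) : ℂ) * (starRingEnd ℂ) (cplx j z ^ (m + 1))) +
        (2 * m * ((powSum m z).im / ‖z‖ ^ 2) : ℝ) * I * cplx j z ^ (m + 1)) := by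
      rw [cplx_hamField_pumpHam m hz, ← h3, ofReal_natCast]
      ring
    rw [h4]
    generalize (powSum m z).im / ‖z‖ ^ 2 = d
    generalize ((‖z‖ ^ 2) ^ m)⁻¹ = a
    generalize cplx j z ^ (m + 1) = p
    generalize normSq (cplx j z) ^ m = b
    simp
    ring
  rw [Finset.sum_congr rfl fun j _ => h2 j, ← Finset.mul_sum, Finset.sum_sub_distrib,
    ← Finset.mul_sum, ← Finset.mul_sum]
  congr 2
  rw [powSum_im]
  ring

/-- The Cauchy-Schwarz estimates behind the monotonicity of `reSq`. -/
lemma pump_inequality (m : ℕ) (z : PhaseSpace n) :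
    m * ((powSum m z).im ^ 2 + 2 * reSq m z * (powSum m z).re) ≤
      2 * (m + 1) * (‖z‖ ^ 2 * ∑ j, normSq (cplx j z) ^ m * (cplx j z ^ (m + 1)).re ^ 2) := by
  set W := ∑ j, normSq (cplx j z) ^ m * (cplx j z ^ (m + 1)).re ^ 2 with hW
  set C := reSq m z with hC
  set X := ∑ j, (cplx j z ^ (m + 1)).re * (cplx j z ^ (m + 1)).im with hX
  set B := ∑ j, (cplx j z ^ (m + 1)).im ^ 2 with hB
  -- C + i X is the vector sum v of Re(z_j^(m+1)) z_j^(m+1), bounded by Cauchy–Schwarz with the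
  -- factors |z_j|^m |Re z_j^(m+1)| and |z_j|.
  have h1 : C ^ 2 + X ^ 2 ≤ W * ‖z‖ ^ 2 := by
    set v : ℂ := ∑ j, ((cplx j z ^ (m + 1)).re : ℂ) * cplx j z ^ (m + 1) with hv
    have hre : v.re = C := by
      rw [hv, re_sum, hC, reSq]
      exact Finset.sum_congr rfl fun j _ => by rw [re_ofReal_mul, sq]
    have him : v.im = X := by
      rw [hv, im_sum, hX]
      exact Finset.sum_congr rfl fun j _ => by rw [im_ofReal_mul]
    have h2 : ‖v‖ ≤ ∑ j, |(cplx j z ^ (m + 1)).re| * ‖cplx j z ^ (m + 1)‖ := by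
      refine (norm_sum_le _ _).trans (Finset.sum_le_sum fun j _ => ?_)
      rw [norm_mul, norm_real, Real.norm_eq_abs]
    have h3 : (∑ j, |(cplx j z ^ (m + 1)).re| * ‖cplx j z ^ (m + 1)‖) ^ 2 ≤
        W * ∑ j, normSq (cplx j z) := by
      refine Finset.sum_sq_le_sum_mul_sum_of_sq_le_mul _ (fun j _ =>
        mul_nonneg (pow_nonneg (normSq_nonneg _) _) (sq_nonneg _)) (fun j _ => normSq_nonneg _)
        fun j _ => ?_
      rw [mul_pow, sq_abs, ← normSq_eq_norm_sq, map_pow]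
      exact le_of_eq (by ring)
    rw [sum_normSq_cplx] at h3
    calc C ^ 2 + X ^ 2 = ‖v‖ ^ 2 := by
          rw [← hre, ← him, ← normSq_eq_norm_sq, normSq_apply]; ring
      _ ≤ _ := pow_le_pow_left₀ (norm_nonneg _) h2 2
      _ ≤ _ := h3
  have h4 : X ^ 2 ≤ C * B := Finset.sum_mul_sq_le_sq_mul_sq _ _ _
  have hm : (0 : ℝ) ≤ m := Nat.cast_nonneg m
  have hW0 : 0 ≤ W := Finset.sum_nonneg fun j _ =>
    mul_nonneg (pow_nonneg (normSq_nonneg _) _) (sq_nonneg _)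
  -- The power sum has imaginary part 2X and real part C - B, so the left side is 4X² + 2C² - 2CB,
  -- at most 2C² + 2X² because X² ≤ CB.
  have h5 : (powSum m z).im ^ 2 + 2 * C * (powSum m z).re ≤ 2 * (W * ‖z‖ ^ 2) := by
    rw [powSum_im, powSum_re]
    nlinarith
  have h6 : 0 ≤ W * ‖z‖ ^ 2 := mul_nonneg hW0 (sq_nonneg _)
  nlinarith [mul_le_mul_of_nonneg_left h5 hm]

/-- Cauchy–Schwarz for |z_j|^(2m+2) = |z_j| · |z_j|^(2m+1). It lets the positive term of
`hasDerivAt_powSum_pump` absorb the negative one. -/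
lemma powSum_im_sq_le (m : ℕ) (z : PhaseSpace n) :
    (powSum m z).im ^ 2 ≤ ‖z‖ ^ 2 * ∑ j, normSq (cplx j z) ^ (2 * m + 1) := by
  have h1 : |(powSum m z).im| ≤ ∑ j, normSq (cplx j z) ^ (m + 1) := by
    refine (abs_im_le_norm _).trans ((norm_sum_le _ _).trans (Finset.sum_le_sum fun j _ => ?_))
    rw [norm_pow, normSq_eq_norm_sq, ← pow_mul]
    exact le_of_eq (by congr 1)
  have h2 : (∑ j, normSq (cplx j z) ^ (m + 1)) ^ 2 ≤
      (∑ j, normSq (cplx j z)) * ∑ j, normSq (cplx j z) ^ (2 * m + 1) :=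
    Finset.sum_sq_le_sum_mul_sum_of_sq_le_mul _ (fun j _ => normSq_nonneg _)
      (fun j _ => pow_nonneg (normSq_nonneg _) _) fun j _ => le_of_eq (by ring)
  rw [sum_normSq_cplx] at h2
  calc _ = |(powSum m z).im| ^ 2 := (sq_abs _).symm
    _ ≤ _ := pow_le_pow_left₀ (abs_nonneg _) h1 2
    _ ≤ _ := h2

/-- The flow that pumps the set where `reSq` is positive to infinity. -/
def pump (m : ℕ) : ℝ → HomSymp n := (isHomHam_pumpHam m).flow

lemma hasDerivAt_normSq_pump (m : ℕ) {z : PhaseSpace n} (hz : z ≠ 0) (s : ℝ) :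
    HasDerivAt (fun s => ‖pump m s z‖ ^ 2)
      (((‖pump m s z‖ ^ 2) ^ m)⁻¹ * (4 * (m + 1) * (powSum m (pump m s z)).re)) s := by
  rw [← inner_hamField_pumpHam m (HomSymp.map_ne_zero (pump m s) hz)]
  exact ((isHomHam_pumpHam m).hasDerivAt_flow hz s).norm_sq

lemma hasDerivAt_powSum_pump (m : ℕ) {z : PhaseSpace n} (hz : z ≠ 0) (s : ℝ) :
    HasDerivAt (fun s => (powSum m (pump m s z)).re)
      (((‖pump m s z‖ ^ 2) ^ m)⁻¹ * (4 * (m + 1) ^ 2 *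
      ∑ j, normSq (cplx j (pump m s z)) ^ (2 * m + 1) - 4 * (m + 1) * m *
      ((powSum m (pump m s z)).im / ‖pump m s z‖ ^ 2) * (powSum m (pump m s z)).im)) s := by
  rw [← deriv_powSum_re m (HomSymp.map_ne_zero (pump m s) hz)]
  have h := reCLM.hasFDerivAt.comp_hasDerivAt s ((hasFDerivAt_powSum m (pump m s z)).comp_hasDerivAt
    s ((isHomHam_pumpHam m).hasDerivAt_flow hz s))
  refine h.congr_deriv ?_
  rw [sum_apply, reCLM_apply]
  rfl

lemma hasDerivAt_reSq_pump (m : ℕ) {z : PhaseSpace n} (hz : z ≠ 0) (s : ℝ) :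
    HasDerivAt (fun s => reSq m (pump m s z))
      (((‖pump m s z‖ ^ 2) ^ m)⁻¹ * (4 * (m + 1) ^ 2 * ∑ j, normSq (cplx j (pump m s z)) ^ m *
      (cplx j (pump m s z) ^ (m + 1)).re ^ 2 - 2 * (m + 1) * m *
      ((powSum m (pump m s z)).im / ‖pump m s z‖ ^ 2) * (powSum m (pump m s z)).im)) s := by
  rw [← deriv_reSq m (HomSymp.map_ne_zero (pump m s) hz)]
  refine HasDerivAt.fun_sum fun j _ => ?_
  have h1 := (cplx j).hasFDerivAt.comp_hasDerivAt s ((isHomHam_pumpHam m).hasDerivAt_flow hz s)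
  have h2 := (reCLM.hasFDerivAt.comp_hasDerivAt s (h1.pow (m + 1))).pow 2
  refine h2.congr_deriv ?_
  simp only [Nat.cast_ofNat, Nat.reduceSub, pow_one, Nat.add_sub_cancel, reCLM_apply]
  rfl

/-- Up to a positive factor, the derivative is the difference of the two sides of `pump_inequality`.
Monotonicity keeps the pumped points away from the origin. -/
lemma monotone_reSq_pump (m : ℕ) {z : PhaseSpace n} (hz : z ≠ 0) :
    Monotone fun s => reSq m (pump m s z) * ((‖pump m s z‖ ^ 2) ^ m)⁻¹ := by
  have hN : ∀ s, 0 < ‖pump m s z‖ ^ 2 := fun s =>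
    pow_pos (norm_pos_iff.2 (HomSymp.map_ne_zero (pump m s) hz)) 2
  have h1 := fun s => (hasDerivAt_reSq_pump m hz s).mul
    (((hasDerivAt_normSq_pump m hz s).pow m).inv (pow_ne_zero m (hN s).ne'))
  refine monotone_of_deriv_nonneg (fun s => (h1 s).differentiableAt) fun s => ?_
  refine le_of_le_of_eq ?_ (h1 s).deriv.symm
  have h2 := pump_inequality m (pump m s z)
  have h3 := hN s
  simp only [Pi.inv_apply, Pi.pow_apply]
  generalize ‖pump m s z‖ ^ 2 = N at *
  have e4 : (m : ℝ) * N ^ (m - 1) * N = m * N ^ m := by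
    cases m with
    | zero => simp
    | succ m => rw [pow_succ, Nat.add_sub_cancel]; ring
  generalize reSq m (pump m s z) = C at *
  generalize (powSum m (pump m s z)).im = Q at *
  generalize (powSum m (pump m s z)).re = P at *
  generalize ∑ j, normSq (cplx j (pump m s z)) ^ m * (cplx j (pump m s z) ^ (m + 1)).re ^ 2 = W at *
  have h5 : 0 < N ^ m := pow_pos h3 m
  have e5 : (m : ℝ) * N ^ (m - 1) = m * N ^ m / N := by rw [eq_div_iff h3.ne', e4]
  rw [e5]
  have e6 : 0 ≤ 2 * (m + 1) * (2 * (m + 1) * (N * W) - m * (Q ^ 2 + 2 * C * P)) /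
      (N * (N ^ m) ^ 2) := by
    refine div_nonneg (mul_nonneg (by positivity) (sub_nonneg.2 h2)) (by positivity)
  refine e6.trans_eq ?_
  field_simp
  ring

variable [NeZero n]

/-- Points of the sphere where `reSq` is bounded below are pumped to infinity uniformly. -/
theorem exists_pump_growth (m : ℕ) {κ : ℝ} (hκ : 0 < κ) (L : ℝ) :
    ∃ s : ℝ, ∀ z : PhaseSpace n, ‖z‖ = 1 → κ ≤ reSq m z → L ≤ ‖pump m s z‖ ^ 2 := by
  have hn : (0 : ℝ) < n := Nat.cast_pos.2 (NeZero.pos n)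
  -- b bounds from below the growth rate of Re Σ z_j^(2m+2) as long as the squared norm is at least
  -- κ; n^(2m) comes from the power mean inequality with exponent 2m + 1.
  set b : ℝ := 4 * (m + 1) * (κ ^ (m + 1) / (n : ℝ) ^ (2 * m)) with hb
  have hb0 : 0 < b := by positivity
  -- By this time the real part has gained max(L, 0)^(m+1) + 1; the 1 offsets an initial value that
  -- may be as low as -1. The real part is in turn at most the squared norm to the power m + 1.
  refine ⟨((max L 0) ^ (m + 1) + 1) / b, fun z hz hC => ?_⟩
  set s₀ : ℝ := ((max L 0) ^ (m + 1) + 1) / b with hs₀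
  have hs₀0 : 0 ≤ s₀ := by positivity
  have hz0 : z ≠ 0 := norm_ne_zero_iff.1 (by rw [hz]; exact one_ne_zero)
  have hN : ∀ s, 0 < ‖pump m s z‖ ^ 2 := fun s =>
    pow_pos (norm_pos_iff.2 (HomSymp.map_ne_zero (pump m s) hz0)) 2
  have h0 : pump m 0 z = z := by
    rw [pump, IsHomHam.flow_zero, HomSymp.one_apply]
  -- `reSq` divided by the m-th power of the squared norm starts at least at κ and never decreases,
  -- and it is at most the squared norm.
  have h1 : ∀ s, 0 ≤ s → κ ≤ ‖pump m s z‖ ^ 2 := fun s hs => by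
    have h2 := monotone_reSq_pump m hz0 hs
    simp only [h0, hz, one_pow, inv_one, mul_one] at h2
    have h3 := reSq_le m (pump m s z)
    have h4 : 0 < (‖pump m s z‖ ^ 2) ^ m := pow_pos (hN s) m
    refine hC.trans (h2.trans ?_)
    rw [← div_eq_mul_inv, div_le_iff₀ h4]
    exact h3.trans_eq (by ring)
  have h5 : ∀ s, 0 ≤ s → b ≤ deriv (fun s => (powSum m (pump m s z)).re) s := fun s hs => by
    rw [(hasDerivAt_powSum_pump m hz0 s).deriv]
    have h6 := powSum_im_sq_le m (pump m s z)
    have h7 := le_sum_normSq_pow (2 * m) (pump m s z)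
    have h8 := h1 s hs
    have h9 := hN s
    generalize ‖pump m s z‖ ^ 2 = N at *
    generalize (powSum m (pump m s z)).im = Q at *
    generalize ∑ j, normSq (cplx j (pump m s z)) ^ (2 * m + 1) = S at *
    have h10 : 0 < N ^ m := pow_pos h9 m
    -- The negative term costs at most the fraction m / (m + 1) of the positive one.
    have h11 : 4 * (m + 1) * S ≤ 4 * (m + 1) ^ 2 * S - 4 * (m + 1) * m * (Q / N) * Q := by
      have h12 : Q / N * Q ≤ S := by
        rw [div_mul_eq_mul_div, div_le_iff₀ h9]
        linarith
      have h13 : (0 : ℝ) ≤ 4 * (m + 1) * m := by positivity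
      nlinarith
    have h14 : b ≤ (N ^ m)⁻¹ * (4 * (m + 1) * (N ^ (2 * m + 1) / (n : ℝ) ^ (2 * m))) := by
      have e : (N ^ m)⁻¹ * (4 * (m + 1) * (N ^ (2 * m + 1) / (n : ℝ) ^ (2 * m))) =
          4 * (m + 1) * (N ^ (m + 1) / (n : ℝ) ^ (2 * m)) := by
        rw [show 2 * m + 1 = m + (m + 1) by ring, pow_add N m]
        field_simp
      rw [e, hb]
      gcongr
    refine h14.trans (mul_le_mul_of_nonneg_left (le_trans ?_ h11) (inv_nonneg.2 h10.le))
    gcongr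
  have h6 : Differentiable ℝ fun s => (powSum m (pump m s z)).re := fun s =>
    (hasDerivAt_powSum_pump m hz0 s).differentiableAt
  have h7 := (convex_Ici (0 : ℝ)).mul_sub_le_image_sub_of_le_deriv h6.continuous.continuousOn
    h6.differentiableOn (C := b) (fun s hs => h5 s (interior_subset hs)) 0 self_mem_Ici s₀ hs₀0 hs₀0
  have h8 := (abs_le.1 (abs_powSum_re_le m z)).1
  have h9 := (abs_le.1 (abs_powSum_re_le m (pump m s₀ z))).2
  rw [hz, one_pow, one_pow] at h8
  have h10 : b * (s₀ - 0) = (max L 0) ^ (m + 1) + 1 := by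
    rw [sub_zero, hs₀]
    exact mul_div_cancel₀ _ hb0.ne'
  simp only [h10, h0] at h7
  have h11 : (max L 0) ^ (m + 1) ≤ (‖pump m s₀ z‖ ^ 2) ^ (m + 1) := by linarith
  exact (le_max_left L 0).trans (le_of_pow_le_pow_left₀ (Nat.succ_ne_zero m) (hN s₀).le h11)

end Pump

/-! ### Arbitrarily long positive paths below a small rotation -/

section Squeeze

variable {n : ℕ}

namespace IsHomHam

/-- Conservation of energy. -/
lemma apply_flow {H : PhaseSpace n → ℝ} (hH : IsHomHam H) (t : ℝ) (x : PhaseSpace n) :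
    H (hH.flow t x) = H x := by
  by_cases hx : x = 0
  · simp [hx]
  have h1 : ∀ t, HasDerivAt (fun t => H (hH.flow t x)) 0 t := fun t => by
    have hy : hH.flow t x ≠ 0 := HomSymp.map_ne_zero (hH.flow t) hx
    refine (((hH.contDiffAt hy).differentiableAt (by simp)).hasFDerivAt.comp_hasDerivAt t
      (hH.hasDerivAt_flow hx t)).congr_deriv ?_
    rw [← inner_hamField]
    exact inner_symplJ_self _
  have h2 := is_const_of_deriv_eq_zero (fun t => (h1 t).differentiableAt)
    (fun t => (h1 t).deriv) t 0
  rw [h2, flow_zero, HomSymp.one_apply]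

lemma inv_flow {H : PhaseSpace n → ℝ} (hH : IsHomHam H) (t : ℝ) (x : PhaseSpace n) :
    H ((hH.flow t)⁻¹ x) = H x := by
  rw [← flow_neg, hH.apply_flow]

/-- The flow of a Hamiltonian commutes with the rotations that preserve the Hamiltonian. -/
lemma rot_mul_flow {H : PhaseSpace n → ℝ} (hH : IsHomHam H) {a : ℝ}
    (ha : ∀ z, H (rot a z) = H z) (s : ℝ) : rot a * hH.flow s = hH.flow s * rot a := by
  set R : PhaseSpace n →L[ℝ] PhaseSpace n :=
    Real.cos a • ContinuousLinearMap.id ℝ _ + Real.sin a • symplJ n with hR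
  have hRr : ∀ z, R z = rot a z := fun z => by rw [rot_apply]; simp [hR]
  have hin : ∀ x y, ⟪R x, R y⟫ = ⟪x, y⟫ := fun x y => by
    rw [hRr, hRr, rot_apply, rot_apply, inner_add_left, inner_add_right, inner_add_right,
      real_inner_smul_left, real_inner_smul_left, real_inner_smul_left, real_inner_smul_left,
      real_inner_smul_right, real_inner_smul_right, real_inner_smul_right, real_inner_smul_right,
      inner_symplJ_symplJ, inner_symplJ_left]
    linear_combination ⟪x, y⟫ * Real.cos_sq_add_sin_sq a
  have hRJ : ∀ x, R (symplJ n x) = symplJ n (R x) := fun x => by simp [hR]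
  have hX : ∀ y, y ≠ 0 → hamField H (R y) = R (hamField H y) := fun y hy => by
    have hRy : R y ≠ 0 := by rw [hRr]; exact HomSymp.map_ne_zero (rot a) hy
    refine eq_hamField fun w => ?_
    obtain ⟨w, rfl⟩ : ∃ w', R w' = w := ⟨(rot a)⁻¹ w, by rw [hRr, HomSymp.apply_inv_self]⟩
    rw [← hRJ, hin, inner_hamField]
    have h1 := ((hH.contDiffAt hRy).differentiableAt (by simp)).hasFDerivAt.comp y R.hasFDerivAt
    have h2 : H ∘ R = H := funext fun z => by rw [Function.comp_apply, hRr, ha]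
    rw [h2] at h1
    rw [h1.fderiv]
    rfl
  refine HomSymp.ext fun z => ?_
  by_cases hz : z = 0
  · simp [hz]
  have h := hH.eq_flow (γ := fun s => rot a (hH.flow s z))
    (fun s => HomSymp.map_ne_zero (rot a) (HomSymp.map_ne_zero (hH.flow s) hz)) (fun s => by
      have h1 := R.hasFDerivAt.comp_hasDerivAt s (hH.hasDerivAt_flow hz s)
      rw [← hRr, hX _ (HomSymp.map_ne_zero (hH.flow s) hz)]
      refine h1.congr_of_eventuallyEq (Filter.Eventually.of_forall fun s => (hRr _).symm)) s
  rw [HomSymp.mul_apply, h, flow_zero]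
  rfl

lemma smoothFamily_flow_mul {H : PhaseSpace n → ℝ} (hH : IsHomHam H) (c : ℝ) :
    HomSymp.SmoothFamily (fun t => hH.flow (c * t)) :=
  hH.smoothFamily_flow.comp (a := fun t : ℝ => c * t) (by fun_prop)

lemma flow_mul_zero {H : PhaseSpace n → ℝ} (hH : IsHomHam H) (c : ℝ) :
    hH.flow (c * 0) = 1 := by rw [mul_zero, flow_zero]

lemma hamiltonian_flow_mul {H : PhaseSpace n → ℝ} (hH : IsHomHam H) (c t : ℝ) {x : PhaseSpace n}
    (hx : x ≠ 0) : HomSymp.hamiltonian (fun t => hH.flow (c * t)) t x = c * H x := by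
  have h1 : HasDerivAt (fun t : ℝ => c * t) c t := by
    simpa using (hasDerivAt_id t).const_mul c
  rw [HomSymp.hamiltonian_comp hH.smoothFamily_flow h1 hx, hH.hamiltonian_flow _ hx]

/-- The class of the Hamiltonian path `t ↦ flow (c * t)`. -/
def flowClass [NeZero n] {H : PhaseSpace n → ℝ} (hH : IsHomHam H) (c : ℝ) : ContRPCover n :=
  UniversalCover.mk (HomSymp.isotopy (fun t => hH.flow (c * t)) (hH.smoothFamily_flow_mul c)
    (hH.flow_mul_zero c))

lemma flowClass_add [NeZero n] {H : PhaseSpace n → ℝ} (hH : IsHomHam H) (c d : ℝ) :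
    hH.flowClass (c + d) = hH.flowClass c * hH.flowClass d := by
  rw [flowClass, flowClass, flowClass, HomSymp.mk_isotopy_mul]
  congr 1
  refine HomSymp.isotopy_congr _ _ _ _ fun t => ?_
  rw [add_mul, flow_add]

lemma flowClass_zero [NeZero n] {H : PhaseSpace n → ℝ} (hH : IsHomHam H) :
    hH.flowClass 0 = 1 := by
  have h := hH.flowClass_add 0 0
  rwa [add_zero, eq_comm, mul_eq_left] at h

lemma flowClass_pow [NeZero n] {H : PhaseSpace n → ℝ} (hH : IsHomHam H) (c : ℝ) (N : ℕ) :
    hH.flowClass c ^ N = hH.flowClass (N * c) := by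
  induction N with
  | zero => simp [flowClass_zero]
  | succ N ih => rw [pow_succ, ih, ← flowClass_add]; congr 1; push_cast; ring

end IsHomHam

open Complex in
-- The rotation multiplies each z_j^(2m+2) by e^{2πi}. By `rot_mul_flow` it therefore commutes with
-- the pumping flow.
lemma pumpHam_rot (m : ℕ) (z : PhaseSpace n) :
    pumpHam m (rot (Real.pi / (m + 1)) z) = pumpHam m z := by
  have h1 : powSum m (rot (Real.pi / (m + 1)) z) = powSum m z := by
    rw [powSum, powSum]
    refine Finset.sum_congr rfl fun j _ => ?_
    have h2 : ((m : ℂ) + 1) ≠ 0 := by exact_mod_cast Nat.succ_ne_zero m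
    rw [cplx_rot, mul_pow, ← exp_nat_mul]
    have h3 : ((2 * m + 2 : ℕ) : ℂ) * (((Real.pi / (m + 1) : ℝ) : ℂ) * I) =
        2 * Real.pi * I := by
      push_cast
      field_simp
    rw [h3, exp_two_pi_mul_I, one_mul]
  rw [pumpHam, pumpHam, h1, norm_rot]

open Complex in
-- The inverse rotation multiplies z_j^(m+1) by -i, which exchanges real and imaginary parts up to
-- sign.
lemma reSq_rot (m : ℕ) (z : PhaseSpace n) :
    reSq m ((rot (Real.pi / (2 * (m + 1))))⁻¹ z) = ∑ j, (cplx j z ^ (m + 1)).im ^ 2 := by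
  have h0 : (rot (n := n) (Real.pi / (2 * (m + 1))))⁻¹ = rot (-(Real.pi / (2 * (m + 1)))) :=
    (isHomHam_halfNormSq.flow_neg _).symm
  rw [h0, reSq]
  refine Finset.sum_congr rfl fun j _ => ?_
  have h2 : ((m : ℂ) + 1) ≠ 0 := by exact_mod_cast Nat.succ_ne_zero m
  rw [cplx_rot, mul_pow, ← exp_nat_mul]
  have h3 : ((m + 1 : ℕ) : ℂ) * (((-(Real.pi / (2 * (m + 1))) : ℝ) : ℂ) * I) =
      -Real.pi / 2 * I := by
    push_cast
    field_simp
  rw [h3, exp_neg_pi_div_two_mul_I]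
  simp

/-- The Hamiltonian supported where the real parts of the powers `z_j ^ (m+1)` are not too small. -/
def squeezeHam (n m : ℕ) (z : PhaseSpace n) : ℝ :=
  ‖z‖ ^ 2 * Real.smoothTransition (reSq m z * ((‖z‖ ^ 2) ^ (m + 1))⁻¹ - 1 / (4 * (n : ℝ) ^ m))

lemma isHomHam_squeezeHam (m : ℕ) : IsHomHam (squeezeHam n m) where
  contDiffOn z hz := by
    have h2 : ContDiffAt ℝ ∞ (fun z : PhaseSpace n => ((‖z‖ ^ 2) ^ (m + 1))⁻¹) z :=
      ((contDiff_norm_sq ℝ).pow (m + 1)).contDiffAt.inv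
        (pow_ne_zero _ (pow_ne_zero 2 (norm_ne_zero_iff.2 hz)))
    exact ((contDiff_norm_sq ℝ).contDiffAt.mul (Real.smoothTransition.contDiff.contDiffAt.comp z
      (((contDiff_reSq m).contDiffAt.mul h2).sub contDiffAt_const))).contDiffWithinAt
  map_smul c z := by
    by_cases hc : c = 0
    · simp [hc, squeezeHam]
    have h1 : (c ^ 2) ^ (m + 1) ≠ 0 := pow_ne_zero _ (pow_ne_zero 2 hc)
    have h2 : (c ^ 2) ^ (m + 1) * reSq m z * ((c ^ 2 * ‖z‖ ^ 2) ^ (m + 1))⁻¹ =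
        reSq m z * ((‖z‖ ^ 2) ^ (m + 1))⁻¹ := by
      rw [mul_pow, mul_inv]
      field_simp
    rw [squeezeHam, squeezeHam, reSq_smul, norm_smul, mul_pow, Real.norm_eq_abs, sq_abs, h2]
    ring

lemma squeezeHam_nonneg (m : ℕ) (z : PhaseSpace n) : 0 ≤ squeezeHam n m z :=
  mul_nonneg (sq_nonneg _) (Real.smoothTransition.nonneg _)

/-- By the power mean inequality the sums of (Re z_j^(m+1))² and of (Im z_j^(m+1))² add up to at
least ‖z‖^(2m+2) / n^m. One of them reaches half of that, beyond the threshold 1/4 in `squeezeHam`;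
the imaginary sum is the real one at the rotated point. -/
lemma squeezeHam_add_pos [NeZero n] (m : ℕ) {z : PhaseSpace n} (hz : z ≠ 0) :
    0 < squeezeHam n m z + squeezeHam n m ((rot (Real.pi / (2 * (m + 1))))⁻¹ z) := by
  have hn : (0 : ℝ) < n := Nat.cast_pos.2 (NeZero.pos n)
  have hN : 0 < ‖z‖ ^ 2 := pow_pos (norm_pos_iff.2 hz) 2
  have h0 : (rot (n := n) (Real.pi / (2 * (m + 1))))⁻¹ = rot (-(Real.pi / (2 * (m + 1)))) :=
    (isHomHam_halfNormSq.flow_neg _).symm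
  have h1 := reSq_add_imSq m z
  have h2 := le_sum_normSq_pow m z
  rw [← h1, ← reSq_rot m z] at h2
  have hnorm : ‖(rot (Real.pi / (2 * (m + 1))))⁻¹ z‖ = ‖z‖ := by rw [h0, norm_rot]
  set y := (rot (Real.pi / (2 * (m + 1))))⁻¹ z with hy
  have hk : 0 < (‖z‖ ^ 2) ^ (m + 1) := pow_pos hN _
  have hm : 0 < (n : ℝ) ^ m := pow_pos hn m
  have key : ∀ w : PhaseSpace n, ‖w‖ = ‖z‖ →
      (‖z‖ ^ 2) ^ (m + 1) / (n : ℝ) ^ m / 2 ≤ reSq m w → 0 < squeezeHam n m w := fun w hw h => by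
    rw [squeezeHam, hw]
    refine mul_pos hN (Real.smoothTransition.pos_of_pos ?_)
    rw [sub_pos, ← div_eq_mul_inv, lt_div_iff₀ hk]
    refine lt_of_lt_of_le ?_ h
    have : 0 < (‖z‖ ^ 2) ^ (m + 1) / (n : ℝ) ^ m := div_pos hk hm
    have e : 1 / (4 * (n : ℝ) ^ m) * (‖z‖ ^ 2) ^ (m + 1) =
        (‖z‖ ^ 2) ^ (m + 1) / (n : ℝ) ^ m / 4 := by field_simp
    rw [e]
    linarith
  rcases le_or_gt ((‖z‖ ^ 2) ^ (m + 1) / (n : ℝ) ^ m / 2) (reSq m z) with h | h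
  · exact add_pos_of_pos_of_nonneg (key z rfl h) (squeezeHam_nonneg m y)
  · exact add_pos_of_nonneg_of_pos (squeezeHam_nonneg m z) (key y hnorm (by linarith))

/-- The heart of the proof. The rotation path is conjugated by the pumping flow P at a large time.
Its end-point commutes with P, so the class does not change, while the Hamiltonian at a unit vector
x becomes (c/2) ‖P x‖²: at least N where `squeezeHam` is non-zero, and non-negative elsewhere. -/
lemma squeeze_precedes [NeZero n] (m N : ℕ) :
    UniversalCover.Precedes ((isHomHam_squeezeHam (n := n) m).flowClass N)
      (rotClass n (Real.pi / (m + 1))) := by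
  have hn : (0 : ℝ) < n := Nat.cast_pos.2 (NeZero.pos n)
  set c : ℝ := Real.pi / (m + 1) with hc
  have hc0 : 0 < c := by positivity
  -- Growth to 2N/c makes (c/2) ‖P x‖² at least N, and `squeezeHam` is at most 1 on the unit sphere;
  -- κ is the threshold below which it vanishes there.
  obtain ⟨s, hs⟩ := exists_pump_growth (n := n) m (κ := 1 / (4 * (n : ℝ) ^ m)) (by positivity)
    (2 * N / c)
  have hpump : HomSymp.SmoothFamily (pump (n := n) m) := (isHomHam_pumpHam m).smoothFamily_flow
  have hrot : HomSymp.SmoothFamily (fun t => rot (n := n) (c * t)) :=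
    smoothFamily_rot.comp (a := fun t : ℝ => c * t) (by fun_prop)
  -- The double inverse keeps the shape h f h⁻¹ of `hamiltonian_conj`, with h = (pump m s)⁻¹.
  have hconj : HomSymp.SmoothFamily (fun t => (pump (n := n) m s)⁻¹ * rot (c * t) *
      (pump m s)⁻¹⁻¹) :=
    ((HomSymp.SmoothFamily.const _).mul hrot).mul (HomSymp.SmoothFamily.const _)
  have hzero : (pump (n := n) m s)⁻¹ * rot (c * 0) * (pump m s)⁻¹⁻¹ = 1 := by
    rw [mul_zero, rot_zero]; group
  have h1 : rotClass n c = UniversalCover.mk (HomSymp.isotopy _ hconj hzero) := by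
    refine HomSymp.mk_isotopy_eq_of_homotopy _ _ _ _
      (K := fun z => (pump m (z.1 * s))⁻¹ * rot (c * z.2) * (pump m (z.1 * s))) ?_ (fun t => ?_)
      (fun t => ?_) (fun r => ?_) (fun r => ?_)
    · have hp : HomSymp.SmoothFamily (fun z : ℝ × ℝ => pump (n := n) m (z.1 * s)) :=
        hpump.comp (a := fun z : ℝ × ℝ => z.1 * s) (by fun_prop)
      exact (hp.inv.mul (smoothFamily_rot.comp (a := fun z : ℝ × ℝ => c * z.2) (by fun_prop))).mul hp
    · have : pump (n := n) m 0 = 1 := IsHomHam.flow_zero _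
      simp [this]
    · simp
    · simp [rot_zero]
    -- At t = 1 the conjugate does not depend on r, because rotation by c preserves `pumpHam`.
    · have := (isHomHam_pumpHam (n := n) m).rot_mul_flow (pumpHam_rot m) (r * s)
      change (pump m (r * s))⁻¹ * rot (c * 1) * pump m (r * s) = rot (c * 1)
      rw [mul_one, mul_assoc, inv_mul_eq_iff_eq_mul]
      exact this
  rw [h1]
  refine HomSymp.precedes_mk_isotopy _ _ _ _ fun t _ x => ?_
  have hx : (x : PhaseSpace n) ≠ 0 := ne_zero_of_mem_unit_sphere x
  have hx1 : ‖(x : PhaseSpace n)‖ = 1 := norm_eq_of_mem_sphere x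
  rw [IsHomHam.hamiltonian_flow_mul _ _ _ hx, HomSymp.hamiltonian_conj hrot _ _ hx, inv_inv,
    hamiltonian_rot_mul _ _ (HomSymp.map_ne_zero _ hx), squeezeHam, hx1]
  simp only [one_pow, inv_one, mul_one, one_mul]
  rcases le_or_gt (reSq m (x : PhaseSpace n)) (1 / (4 * (n : ℝ) ^ m)) with h | h
  · rw [Real.smoothTransition.zero_of_nonpos (by linarith), mul_zero]
    positivity
  · have h2 := hs x hx1 h.le
    rw [div_le_iff₀ hc0] at h2
    have h3 := Real.smoothTransition.le_one (reSq m (x : PhaseSpace n) - 1 / (4 * (n : ℝ) ^ m))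
    have h4 : (0 : ℝ) ≤ N := Nat.cast_nonneg N
    nlinarith [mul_le_mul_of_nonneg_left h3 h4]

/-- The product of the flow of `H` with its conjugate by a rotation. -/
def twinPath {H : PhaseSpace n → ℝ} (hH : IsHomHam H) (a c t : ℝ) : HomSymp n :=
  hH.flow (c * t) * (rot a * hH.flow (c * t) * (rot a)⁻¹)

lemma smoothFamily_twinPath {H : PhaseSpace n → ℝ} (hH : IsHomHam H) (a c : ℝ) :
    HomSymp.SmoothFamily (twinPath hH a c) :=
  (hH.smoothFamily_flow_mul c).mul (((HomSymp.SmoothFamily.const _).mul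
    (hH.smoothFamily_flow_mul c)).mul (HomSymp.SmoothFamily.const _))

lemma twinPath_zero {H : PhaseSpace n → ℝ} (hH : IsHomHam H) (a c : ℝ) :
    twinPath hH a c 0 = 1 := by
  simp [twinPath, IsHomHam.flow_zero]

/-- H is constant along its own flow f, so the first term may also be written at f⁻¹ x. The
Hamiltonian is then c (G ∘ f⁻¹) with G = H + H ∘ (rot a)⁻¹ independent of c and t, the form needed
for the volume estimate. -/
lemma hamiltonian_twinPath {H : PhaseSpace n → ℝ} (hH : IsHomHam H) (a c t : ℝ)
    {x : PhaseSpace n} (hx : x ≠ 0) : HomSymp.hamiltonian (twinPath hH a c) t x =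
      c * (H ((hH.flow (c * t))⁻¹ x) + H ((rot a)⁻¹ ((hH.flow (c * t))⁻¹ x))) := by
  have h := HomSymp.hamiltonian_mul (hH.smoothFamily_flow_mul c)
    (((HomSymp.SmoothFamily.const (rot a)).mul (hH.smoothFamily_flow_mul c)).mul
    (HomSymp.SmoothFamily.const (rot a)⁻¹)) t hx
  have hy : (hH.flow (c * t))⁻¹ x ≠ 0 := HomSymp.map_ne_zero (hH.flow (c * t))⁻¹ hx
  rw [hH.hamiltonian_flow_mul c t hx, HomSymp.hamiltonian_conj (hH.smoothFamily_flow_mul c) _ _ hy,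
    hH.hamiltonian_flow_mul c t (HomSymp.map_ne_zero (rot a)⁻¹ hy)] at h
  rw [hH.inv_flow, mul_add]
  exact h

/-- The isotopy of the projective space induced by `twinPath`. -/
def twinIsotopy [NeZero n] {H : PhaseSpace n → ℝ} (hH : IsHomHam H) (a c : ℝ) :
    ContactIsotopy (stdForm (n := n)) :=
  HomSymp.isotopy _ (smoothFamily_twinPath hH a c) (twinPath_zero hH a c)

lemma mk_twinIsotopy [NeZero n] {H : PhaseSpace n → ℝ} (hH : IsHomHam H) (a c : ℝ) :
    UniversalCover.mk (twinIsotopy hH a c) =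
      hH.flowClass c * (rotClass n a * hH.flowClass c * (rotClass n a)⁻¹) := by
  have h1 : rotClass n a * hH.flowClass c * (rotClass n a)⁻¹ = UniversalCover.mk
      (HomSymp.isotopy (fun t => rot a * hH.flow (c * t) * (rot a)⁻¹)
      (((HomSymp.SmoothFamily.const _).mul
    (hH.smoothFamily_flow_mul c)).mul (HomSymp.SmoothFamily.const _))
    (by simp [IsHomHam.flow_zero])) := by
    rw [rotClass, IsHomHam.flowClass, ContactIsotopy.mk_conj]
    congr 1
    simp [ContactIsotopy.conj, HomSymp.isotopy]
  rw [h1, IsHomHam.flowClass, HomSymp.mk_isotopy_mul]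
  rfl

/-- There are twin flows with positive Hamiltonian all of whose multiples are dominated by a given
small rotation. -/
theorem exists_twin_precedes [NeZero n] {ε : ℝ} (hε : 0 < ε) :
    ∃ (H : PhaseSpace n → ℝ) (hH : IsHomHam H) (a : ℝ), (∀ x, 0 ≤ H x) ∧
      (∀ x, x ≠ 0 → 0 < H x + H ((rot a)⁻¹ x)) ∧ ∀ N : ℕ, UniversalCover.Precedes
        (UniversalCover.mk (twinIsotopy hH a N)) (rotClass n ε) := by
  -- Two rotations by π/(m+1) must fit into ε.
  obtain ⟨m, hm⟩ := exists_nat_ge (2 * Real.pi / ε)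
  refine ⟨squeezeHam n m, isHomHam_squeezeHam m, Real.pi / (2 * (m + 1)), squeezeHam_nonneg m,
    fun x hx => squeezeHam_add_pos m hx, fun N => ?_⟩
  set a := Real.pi / (2 * ((m : ℝ) + 1)) with ha
  set c := Real.pi / ((m : ℝ) + 1) with hc
  have h1 := squeeze_precedes (n := n) m N
  -- Conjugation by a rotation fixes the classes of rotations, so the conjugate flow obeys the same
  -- bound.
  have h2 : UniversalCover.Precedes
      (rotClass n a * (isHomHam_squeezeHam (n := n) m).flowClass N * (rotClass n a)⁻¹)
      (rotClass n c) := by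
    have h3 := (h1.mul_left (rotClass n a)).mul_right (rotClass n a)⁻¹
    rwa [← hc, ← rotClass_add, add_comm, rotClass_add, mul_inv_cancel_right] at h3
  have h4 := h1.mul h2
  rw [← mk_twinIsotopy, ← hc, ← rotClass_add] at h4
  refine h4.trans (rotClass_mono ?_)
  rw [div_le_iff₀ hε] at hm
  rw [hc, ← add_div, div_le_iff₀ (by positivity)]
  nlinarith

end Squeeze

/-! ### The two dichotomies, given the growth of V along twin isotopies -/

section Dichotomy

variable {n : ℕ} [NeZero n]

open UniversalCover

lemma ham_twinIsotopy_mk {H : PhaseSpace n → ℝ} (hH : IsHomHam H) (a c : ℝ) {t : ℝ}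
    (ht : t ∈ Icc (0 : ℝ) 1) (x : USphere n) : (twinIsotopy hH a c).ham t (RP.mk x) =
      c * (H ((hH.flow (c * t))⁻¹ x) + H ((rot a)⁻¹ ((hH.flow (c * t))⁻¹ x))) := by
  rw [twinIsotopy, HomSymp.ham_isotopy_mk _ _ ht,
    hamiltonian_twinPath hH a c t (ne_zero_of_mem_unit_sphere x)]

lemma ham_twinIsotopy_pos {H : PhaseSpace n → ℝ} (hH : IsHomHam H) {a : ℝ}
    (hpos : ∀ x, x ≠ 0 → 0 < H x + H ((rot a)⁻¹ x)) {c : ℝ} (hc : 0 < c) {t : ℝ}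
    (ht : t ∈ Icc (0 : ℝ) 1) (q : RP n) : 0 < (twinIsotopy hH a c).ham t q := by
  obtain ⟨x, rfl⟩ := RP.mk_surjective q
  rw [ham_twinIsotopy_mk hH a c ht]
  exact mul_pos hc (hpos _ (HomSymp.map_ne_zero (hH.flow (c * t))⁻¹ (ne_zero_of_mem_unit_sphere x)))

lemma isNonneg_twinIsotopy {H : PhaseSpace n → ℝ} (hH : IsHomHam H) (a : ℝ)
    (hnn : ∀ x, 0 ≤ H x) {c : ℝ} (hc : 0 ≤ c) : (twinIsotopy hH a c).IsNonneg := by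
  intro t ht q
  obtain ⟨x, rfl⟩ := RP.mk_surjective q
  change 0 ≤ (twinIsotopy hH a c).ham t (RP.mk x)
  rw [ham_twinIsotopy_mk hH a c ht]
  exact mul_nonneg hc (add_nonneg (hnn _) (hnn _))

lemma strictlyPrecedes_iff {a b : ContRPCover n} : StrictlyPrecedes a b ↔
    ∃ φ : ContactIsotopy (stdForm (n := n)), φ.IsNonneg ∧ φ.IsSomewherePositive ∧ mk φ * a = b := by
  simp only [StrictlyPrecedes, ContactIsotopy.lift_one]

/-- A bi-invariant function satisfying the reverse triangle inequality and positive exactly on the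
strict order relation is infinite there. -/
theorem eq_top_of_strictlyPrecedes {d : ContRPCover n → ContRPCover n → ℝ≥0∞}
    (h1 : ∀ a b, 0 < d a b ↔ StrictlyPrecedes a b)
    (h2 : ∀ a b c, Precedes a b → Precedes b c → d a b + d b c ≤ d a c)
    (h3 : IsBiInvariant d) {a b : ContRPCover n} (hab : StrictlyPrecedes a b) : d a b = ⊤ := by
  obtain ⟨φ, hφ, hφ', rfl⟩ := strictlyPrecedes_iff.1 hab
  obtain ⟨ε, hε, hεφ⟩ := exists_rotClass_precedes hφ hφ'
  obtain ⟨H, hH, θ, hnn, hpos, hN⟩ := exists_twin_precedes (n := n) hε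
  have e1 : d a (mk φ * a) = d 1 (mk φ) := by
    have := (h3 a 1 (mk φ)).2
    rwa [one_mul] at this
  set W : ℕ → ContRPCover n := fun N => mk (twinIsotopy hH θ N) with hW
  have hW1 : ∀ N, Precedes 1 (W N) := fun N =>
    precedes_iff.2 ⟨_, isNonneg_twinIsotopy hH θ hnn (Nat.cast_nonneg N), mul_one _⟩
  set U := hH.flowClass 1 with hU
  set V := rotClass n θ * U * (rotClass n θ)⁻¹ with hV
  have hWUV : ∀ N : ℕ, W N = U ^ N * V ^ N := fun N => by
    rw [hV, conj_pow, hU, IsHomHam.flowClass_pow, mul_one, hW, ← mk_twinIsotopy]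
  -- W N = U^N V^N and W (N + 1) = U^N (U V) V^N, so bi-invariance strips the outer factors.
  have hstep : ∀ N : ℕ, d (W N) (W (N + 1)) = d 1 (W 1) := fun N => by
    have h4 := (h3 (U ^ N) 1 (W 1)).1
    have h5 := (h3 (V ^ N) (U ^ N * 1) (U ^ N * W 1)).2
    rw [h4] at h5
    rw [← h5, mul_one, hWUV, hWUV, hWUV]
    congr 1
    rw [pow_succ U, pow_succ' V, pow_one, pow_one]
    group
  have hprec : ∀ N : ℕ, Precedes (W N) (W (N + 1)) := fun N => by
    have h4 := ((hW1 1).mul_left (U ^ N)).mul_right (V ^ N)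
    rw [mul_one] at h4
    rw [hWUV, hWUV]
    convert h4 using 1
    rw [hWUV, pow_succ U, pow_succ' V, pow_one, pow_one]
    group
  have hlb : ∀ N : ℕ, (N : ℝ≥0∞) * d 1 (W 1) ≤ d 1 (W N) := fun N => by
    induction N with
    | zero => simp
    | succ N ih =>
      rw [Nat.cast_succ, add_mul, one_mul]
      calc _ ≤ d 1 (W N) + d (W N) (W (N + 1)) := add_le_add ih (hstep N).ge
        _ ≤ _ := h2 _ _ _ (hW1 N) (hprec N)
  have hpos1 : 0 < d 1 (W 1) := by
    refine (h1 _ _).2 (strictlyPrecedes_iff.2 ⟨_, isNonneg_twinIsotopy hH θ hnn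
      (Nat.cast_nonneg 1), ⟨0, left_mem_Icc.2 zero_le_one, fun q => ?_⟩, mul_one _⟩)
    exact ham_twinIsotopy_pos hH hpos (by norm_num) (left_mem_Icc.2 zero_le_one) q
  rw [e1]
  refine ENNReal.eq_top_of_forall_nnreal_le fun r => ?_
  obtain ⟨N, hNr⟩ := ENNReal.exists_nat_mul_gt hpos1.ne' (ENNReal.coe_ne_top (r := r))
  -- Every W N lies below the class of φ, so d 1 (mk φ) dominates all multiples of d 1 (W 1) > 0.
  refine hNr.le.trans ((hlb N).trans (le_trans le_self_add (h2 1 (W N) (mk φ) (hW1 N) ?_)))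
  exact (hN N).trans hεφ

/-- A non-negative path from a to b that is positive at some time would witness the relation; hence
V vanishes at all times along every admissible path. -/
lemma lorentzDist_eq_zero {a b : ContRPCover n} (h : ¬ StrictlyPrecedes a b) :
    lorentzDist a b = 0 := by
  rw [lorentzDist]
  simp only [ENNReal.iSup_eq_zero]
  rintro φ ⟨hφ, hφb⟩
  have h1 : ∀ t ∈ Icc (0 : ℝ) 1, lorentzFinsler (φ.generator t) = 0 := fun t ht => by
    rw [lorentzFinsler, if_neg]
    exact fun hp => h ⟨φ, hφ, ⟨t, ht, hp⟩, hφb⟩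
  rw [lorentzLength, MeasureTheory.setLIntegral_congr_fun measurableSet_Icc
    (g := fun _ => 0) fun t ht => by simp [h1 t ht]]
  simp

/-- A smooth monotone function which vanishes on the first half of the unit interval. -/
def delay (t : ℝ) : ℝ := Real.smoothTransition (2 * t - 1)

lemma contDiff_delay : ContDiff ℝ ∞ delay := Real.smoothTransition.contDiff.comp (by fun_prop)

lemma mapsTo_delay : MapsTo delay (Icc 0 1) (Icc 0 1) := fun _ _ =>
  ⟨Real.smoothTransition.nonneg _, Real.smoothTransition.le_one _⟩

lemma delay_eq_zero {t : ℝ} (ht : t ≤ 1 / 2) : delay t = 0 :=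
  Real.smoothTransition.zero_of_nonpos (by linarith)

lemma delay_zero : delay 0 = 0 := delay_eq_zero (by norm_num)

lemma delay_one : delay 1 = 1 := Real.smoothTransition.one_of_one_le (by norm_num)

lemma monotone_delay : Monotone delay := fun x y hxy =>
  Real.smoothTransition.monotone (by linarith)

/-- A smooth path which follows `φ` on the first half of the time interval and ends at the product
of the end-points. -/
def delayedMul (φ χ : ContactIsotopy (stdForm (n := n))) : ContactIsotopy (stdForm (n := n)) :=
  φ.mul (χ.reparam delay contDiff_delay mapsTo_delay delay_zero)

lemma mk_delayedMul (φ χ : ContactIsotopy (stdForm (n := n))) :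
    mk (delayedMul φ χ) = mk φ * mk χ := by
  rw [delayedMul, ← mk_mul, ContactIsotopy.mk_reparam _ _ _ _ delay_one]

lemma isNonneg_delayedMul {φ χ : ContactIsotopy (stdForm (n := n))} (h1 : φ.IsNonneg)
    (h2 : χ.IsNonneg) : (delayedMul φ χ).IsNonneg := by
  refine h1.mul fun t ht q => ?_
  change 0 ≤ ContactIsotopy.ham _ t q
  rw [ContactIsotopy.ham_reparam _ contDiff_delay mapsTo_delay delay_zero ht]
  exact mul_nonneg monotone_delay.deriv_nonneg (h2 _ (mapsTo_delay ht) q)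

/-- The time derivative at t < 1/2 only involves times near t, at which the second factor is still
the identity. -/
lemma generator_delayedMul (φ χ : ContactIsotopy (stdForm (n := n))) {t : ℝ} (ht : t < 1 / 2) :
    (delayedMul φ χ).generator t = φ.generator t := by
  have h1 : ∀ s : ℝ, s < 1 / 2 → (delayedMul φ χ).toFun s = φ.toFun s := fun s hs => by
    simp [delayedMul, ContactIsotopy.mul, ContactIsotopy.reparam, delay_eq_zero hs.le, χ.zero]
  ext1 q
  have h3 : (fun s : ℝ => ((delayedMul φ χ).toFun s : Equiv.Perm (RP n))
      (((delayedMul φ χ).toFun t : Equiv.Perm (RP n)).symm q)) =ᶠ[nhds t]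
      fun s : ℝ => (φ.toFun s : Equiv.Perm (RP n)) ((φ.toFun t : Equiv.Perm (RP n)).symm q) := by
    filter_upwards [gt_mem_nhds ht] with s hs
    rw [h1 s hs, h1 t ht]
  exact congrArg (fun C : ℝ →L[ℝ] EuclideanSpace ℝ (Fin (2 * n - 1)) => C 1)
    ((h3.filter_mono nhdsWithin_le_nhds).mfderivWithin_eq h3.self_of_nhds)

/-- The twin isotopies, along which V grows linearly in N by `hV`, are completed to non-negative
paths ending at b. Only lengths are compared; no invariance of the distance enters. -/
theorem lorentzDist_eq_top {a b : ContRPCover n} (hab : StrictlyPrecedes a b)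
    (hV : ∀ (H : PhaseSpace n → ℝ) (hH : IsHomHam H) (θ : ℝ),
      (∀ x, x ≠ 0 → 0 < H x + H ((rot θ)⁻¹ x)) → ∃ v : ℝ, 0 < v ∧ ∀ N : ℕ, ∀ t ∈ Icc (0 : ℝ) 1,
        v * N ≤ lorentzFinsler ((twinIsotopy hH θ N).generator t)) : lorentzDist a b = ⊤ := by
  obtain ⟨φ, hφ, hφ', rfl⟩ := strictlyPrecedes_iff.1 hab
  obtain ⟨ε, hε, hεφ⟩ := exists_rotClass_precedes hφ hφ'
  obtain ⟨H, hH, θ, hnn, hpos, hN⟩ := exists_twin_precedes (n := n) hε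
  obtain ⟨v, hv, hvN⟩ := hV H hH θ hpos
  have hlen : ∀ N : ℕ, (N : ℝ≥0∞) * (ENNReal.ofReal v * ENNReal.ofReal (1 / 2)) ≤
      lorentzDist a (mk φ * a) := fun N => by
    obtain ⟨χ, hχ, hχφ⟩ := ((hN N).trans hεφ).exists_eq_mul
    set p := twinIsotopy hH θ N with hp
    have h1 : (delayedMul p χ).IsNonneg ∧ (delayedMul p χ).lift a 1 = mk φ * a :=
      ⟨isNonneg_delayedMul (isNonneg_twinIsotopy hH θ hnn (Nat.cast_nonneg N)) hχ, by
        rw [ContactIsotopy.lift_one, mk_delayedMul, hχφ]⟩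
    refine le_trans ?_ (le_iSup₂_of_le (delayedMul p χ) h1 le_rfl)
    rw [lorentzLength]
    -- Only the first half of the time interval is counted, where the generator is that of the twin
    -- isotopy.
    calc (N : ℝ≥0∞) * (ENNReal.ofReal v * ENNReal.ofReal (1 / 2))
        = ∫⁻ _ in Ico (0 : ℝ) (1 / 2), ENNReal.ofReal (v * N) := by
          rw [MeasureTheory.setLIntegral_const, Real.volume_Ico, sub_zero,
            ENNReal.ofReal_mul hv.le, ENNReal.ofReal_natCast]
          ring
      _ ≤ ∫⁻ t in Ico (0 : ℝ) (1 / 2),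
          ENNReal.ofReal (lorentzFinsler ((delayedMul p χ).generator t)) := by
          refine MeasureTheory.setLIntegral_mono' measurableSet_Ico fun t ht => ?_
          rw [generator_delayedMul _ _ ht.2]
          exact ENNReal.ofReal_le_ofReal (hvN N t ⟨ht.1, by linarith [ht.2]⟩)
      _ ≤ _ := MeasureTheory.lintegral_mono_set (Ico_subset_Icc_self.trans
          (Icc_subset_Icc_right (by norm_num)))
  have hc : ENNReal.ofReal v * ENNReal.ofReal (1 / 2) ≠ 0 :=
    mul_ne_zero (by simpa using hv) (by norm_num)
  refine ENNReal.eq_top_of_forall_nnreal_le fun r => ?_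
  obtain ⟨N, hNr⟩ := ENNReal.exists_nat_mul_gt hc (ENNReal.coe_ne_top (r := r))
  exact hNr.le.trans (hlen N)

end Dichotomy

/-! ### Homogeneous symplectic maps preserve volume -/

section SymplecticVolume

variable {n : ℕ} {V : Type*} [NormedAddCommGroup V] [NormedSpace ℝ V]

lemma contDiff_liouvilleForm :
    ContDiff ℝ ∞ (liouvilleForm : PhaseSpace n → PhaseSpace n →L[ℝ] ℝ) := by
  have h : ∀ i : Fin n ⊕ Fin n, ContDiff ℝ ∞ fun z : PhaseSpace n => z i := fun i =>
    (EuclideanSpace.proj i : PhaseSpace n →L[ℝ] ℝ).contDiff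
  unfold liouvilleForm
  refine ContDiff.const_smul _ (ContDiff.sum fun j _ => ?_)
  exact ((h (Sum.inl j)).smul contDiff_const).sub ((h (Sum.inr j)).smul contDiff_const)

/-- The pull-back of the Liouville form. -/
def pullLiouville (s : V → PhaseSpace n) (y : V) : V →L[ℝ] ℝ :=
  (liouvilleForm (s y)).comp (fderiv ℝ s y)

lemma contDiffAt_pullLiouville {s : V → PhaseSpace n} {y : V} (hs : ContDiffAt ℝ ∞ s y) :
    ContDiffAt ℝ ∞ (pullLiouville s) y :=
  (contDiff_liouvilleForm.contDiffAt.comp y hs).clm_comp (hs.fderiv_right (by simp))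

/-- The exterior derivative of the pull-back of the Liouville form is the pull-back of the standard
symplectic form. -/
lemma fderiv_pullLiouville_sub {s : V → PhaseSpace n} {y : V} (hs : ContDiffAt ℝ ∞ s y) (u v : V) :
    fderiv ℝ (pullLiouville s) y u v - fderiv ℝ (pullLiouville s) y v u =
      ⟪symplJ n (fderiv ℝ s y u), fderiv ℝ s y v⟫ := by
  have hD : HasFDerivAt (fderiv ℝ s) (fderiv ℝ (fderiv ℝ s) y) y :=
    ((hs.fderiv_right (m := ∞) (by simp)).differentiableAt (by simp)).hasFDerivAt
  have h1 : ∀ u v : V, fderiv ℝ (pullLiouville s) y u v =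
      1 / 2 * (⟪symplJ n (s y), fderiv ℝ (fderiv ℝ s) y u v⟫ +
        ⟪symplJ n (fderiv ℝ s y u), fderiv ℝ s y v⟫) := fun u v => by
    have h2 : HasFDerivAt (fun y => pullLiouville s y v)
        ((fderiv ℝ (pullLiouville s) y).flip v) y := by
      have := (((contDiffAt_pullLiouville hs).differentiableAt (by simp)).hasFDerivAt).clm_apply
        (hasFDerivAt_const v y)
      simpa using this
    have h3 : HasFDerivAt (fun y => fderiv ℝ s y v) ((fderiv ℝ (fderiv ℝ s) y).flip v) y := by
      have := hD.clm_apply (hasFDerivAt_const v y)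
      simpa using this
    have h4 := (((symplJ n).hasFDerivAt.comp y
      (hs.differentiableAt (by simp)).hasFDerivAt).inner ℝ h3).const_mul (1 / 2 : ℝ)
    have h5 : (fun y => pullLiouville s y v) =
        fun y => 1 / 2 * ⟪symplJ n (s y), fderiv ℝ s y v⟫ := funext fun y => liouvilleForm_eq _ _
    rw [h5] at h2
    have h6 := congrArg (fun C => C u) (h2.unique h4)
    simpa [fderivInnerCLM_apply] using h6
  -- The second derivatives of s cancel by symmetry, and the two halves of the symplectic form add
  -- up by antisymmetry.
  have h7 := (hs.isSymmSndFDerivAt (by simpa using ENat.LEInfty.out)).eq u v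
  have h8 := inner_symplJ_left (fderiv ℝ s y v) (fderiv ℝ s y u)
  rw [real_inner_comm _ (fderiv ℝ s y v)] at h8
  rw [h1, h1, h7]
  linarith

namespace HomSymp

/-- A homogeneous map preserving the Liouville form is symplectic. -/
lemma symplectic (f : HomSymp n) {z : PhaseSpace n} (hz : z ≠ 0) (u v : PhaseSpace n) :
    ⟪symplJ n (fderiv ℝ f z u), fderiv ℝ f z v⟫ = ⟪symplJ n u, v⟫ := by
  have h1 : pullLiouville f =ᶠ[nhds z] pullLiouville id := by
    filter_upwards [isOpen_compl_singleton.mem_nhds hz] with w hw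
    ext v
    simp only [pullLiouville, ContinuousLinearMap.comp_apply, f.liouville hw]
    simp
  rw [← fderiv_pullLiouville_sub (f.contDiffAt hz), h1.fderiv_eq,
    fderiv_pullLiouville_sub contDiffAt_id]
  simp

/-- A = df satisfies Aᵀ J A = J, and det J ≠ 0 because J² = -1; hence (det A)² = 1. -/
lemma abs_det_fderiv (f : HomSymp n) {z : PhaseSpace n} (hz : z ≠ 0) :
    |(fderiv ℝ f z).det| = 1 := by
  set A := fderiv ℝ f z with hA
  have h1 : (ContinuousLinearMap.adjoint A).comp ((symplJ n).comp A) = symplJ n := by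
    ext1 u
    refine ext_inner_right ℝ fun v => ?_
    simp only [ContinuousLinearMap.comp_apply, ContinuousLinearMap.adjoint_inner_left]
    exact f.symplectic hz u v
  have h2 : (symplJ n).comp (symplJ n) = -ContinuousLinearMap.id ℝ (PhaseSpace n) := by
    ext1 u
    simp
  have hmul : ∀ B C : PhaseSpace n →L[ℝ] PhaseSpace n, (B.comp C).det = B.det * C.det :=
    fun B C => LinearMap.det_comp _ _
  have h3 : (symplJ n).det ≠ 0 := fun h => by
    have h4 := hmul (symplJ n) (symplJ n)
    rw [h2, h] at h4
    have h5 : (-ContinuousLinearMap.id ℝ (PhaseSpace n)).comp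
        (-ContinuousLinearMap.id ℝ (PhaseSpace n)) = ContinuousLinearMap.id ℝ (PhaseSpace n) := by
      ext1 u; simp
    have h6 := hmul (-ContinuousLinearMap.id ℝ (PhaseSpace n)) (-ContinuousLinearMap.id ℝ (PhaseSpace n))
    rw [h5, h4] at h6
    simp [ContinuousLinearMap.det] at h6
  have h7 : (ContinuousLinearMap.adjoint A).det = A.det := by
    have hb := (EuclideanSpace.basisFun (Fin n ⊕ Fin n) ℝ)
    have h8 := LinearMap.toMatrix_adjoint hb hb (A : PhaseSpace n →ₗ[ℝ] PhaseSpace n)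
    have h9 := congrArg Matrix.det h8
    rw [Matrix.det_conjTranspose, LinearMap.det_toMatrix, LinearMap.det_toMatrix] at h9
    exact h9
  have h8 := hmul (ContinuousLinearMap.adjoint A) ((symplJ n).comp A)
  rw [h1, hmul, h7] at h8
  have h9 : A.det * A.det = 1 := mul_right_cancel₀ h3 (by linarith)
  rcases mul_self_eq_one_iff.1 h9 with h | h <;> simp [h]

/-- Homogeneous symplectic maps preserve the volume. -/
lemma volume_image (f : HomSymp n) {S : Set (PhaseSpace n)} (hS : MeasurableSet S)
    (h0 : (0 : PhaseSpace n) ∉ S) :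
    MeasureTheory.volume (f '' S) = MeasureTheory.volume S := by
  have hS0 : ∀ x ∈ S, x ≠ 0 := fun x hx h => h0 (h ▸ hx)
  rw [← MeasureTheory.lintegral_abs_det_fderiv_eq_addHaar_image MeasureTheory.volume hS
    (fun x hx => ((f.contDiffAt (hS0 x hx)).differentiableAt (by simp)).hasFDerivAt.hasFDerivWithinAt)
    (fun x hx y hy h => by
      rw [← f.inv_apply_self x, h, f.inv_apply_self y]),
    MeasureTheory.setLIntegral_congr_fun hS
      (fun x hx => by rw [f.abs_det_fderiv (hS0 x hx)] : EqOn _ (fun _ => ENNReal.ofReal 1) S)]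
  simp

end HomSymp

end SymplecticVolume

/-! ### Algebra of η ∧ (dη)ⁿ⁻¹ -/

section WedgeAlgebra

/-- Right multiplication by the transposition reverses the sign and fixes F, so the sum equals its
own negative. -/
lemma sum_sign_mul_eq_zero {ι : Type*} [Fintype ι] [DecidableEq ι] {i j : ι} (hij : i ≠ j)
    (F : Equiv.Perm ι → ℝ) (hF : ∀ σ, F (σ * Equiv.swap i j) = F σ) :
    ∑ σ : Equiv.Perm ι, ((Equiv.Perm.sign σ : ℤ) : ℝ) * F σ = 0 := by
  have h := Equiv.sum_comp (Equiv.mulRight (Equiv.swap i j))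
    fun σ : Equiv.Perm ι => ((Equiv.Perm.sign σ : ℤ) : ℝ) * F σ
  have h1 : ∀ σ : Equiv.Perm ι, ((Equiv.Perm.sign (Equiv.mulRight (Equiv.swap i j) σ) : ℤ) : ℝ) *
      F (Equiv.mulRight (Equiv.swap i j) σ) = -(((Equiv.Perm.sign σ : ℤ) : ℝ) * F σ) := fun σ => by
    simp [hF, Equiv.Perm.sign_mul, Equiv.Perm.sign_swap hij]
  rw [Finset.sum_congr rfl fun σ _ => h1 σ, Finset.sum_neg_distrib] at h
  linarith

variable {m : ℕ}

/-- The value of `a ∧ Wᵐ` on a basis, up to the factor `2ᵐ`, for a one-form `a` and a two-form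
`W`. -/
def wedgeSum (a : Option (Fin m × Bool) → ℝ)
    (W : Option (Fin m × Bool) → Option (Fin m × Bool) → ℝ) : ℝ :=
  ∑ σ : Equiv.Perm (Option (Fin m × Bool)), ((Equiv.Perm.sign σ : ℤ) : ℝ) *
    (a (σ none) * ∏ k, W (σ (some (k, false))) (σ (some (k, true))))

/-- Behaviour of `a ∧ (da)ᵐ` under rescaling of `a`. -/
lemma wedgeSum_smul (a b : Option (Fin m × Bool) → ℝ)
    (W : Option (Fin m × Bool) → Option (Fin m × Bool) → ℝ) (f : ℝ) :
    wedgeSum (fun i => f * a i) (fun i j => f * W i j + (b i * a j - b j * a i)) =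
      f ^ (m + 1) * wedgeSum a W := by
  unfold wedgeSum
  -- Expand over the set t of factors that contribute f W. If t is not everything, the term contains
  -- a twice, in a and in some b ∧ a, and vanishes.
  simp_rw [Finset.prod_add, Finset.mul_sum]
  rw [Finset.sum_comm, Finset.sum_eq_single_of_mem Finset.univ (by simp)]
  · refine Finset.sum_congr rfl fun σ _ => ?_
    rw [Finset.prod_mul_distrib]
    simp
    ring
  · intro t _ ht
    obtain ⟨k, hk⟩ : ∃ k, k ∉ t := by
      by_contra! h
      exact ht (Finset.eq_univ_iff_forall.2 h)
    -- R collects what involves neither `none` nor the pair k, so it survives swapping `none` with a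
    -- slot of k. Each of the two terms of b ∧ a in the factor k is then symmetric under one such
    -- swap.
    set R : Equiv.Perm (Option (Fin m × Bool)) → ℝ := fun σ =>
      f * (∏ l ∈ t, f * W (σ (some (l, false))) (σ (some (l, true)))) *
      ∏ l ∈ (Finset.univ \ t).erase k, (b (σ (some (l, false))) * a (σ (some (l, true))) -
        b (σ (some (l, true))) * a (σ (some (l, false)))) with hR
    have hRs : ∀ (c : Bool) σ, R (σ * Equiv.swap none (some (k, c))) = R σ := fun c σ => by
      have h1 : ∀ l ≠ k, ∀ d, (σ * Equiv.swap none (some (k, c))) (some (l, d)) =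
          σ (some (l, d)) := fun l hl d => by
        rw [Equiv.Perm.mul_apply, Equiv.swap_apply_of_ne_of_ne (by simp) (by simp [hl])]
      simp only [hR]
      congr 1
      · congr 1
        refine Finset.prod_congr rfl fun l hl => ?_
        have : l ≠ k := fun h => hk (h ▸ hl)
        rw [h1 l this, h1 l this]
      · refine Finset.prod_congr rfl fun l hl => ?_
        have : l ≠ k := (Finset.mem_erase.1 hl).1
        rw [h1 l this, h1 l this]
    have h2 := sum_sign_mul_eq_zero (i := none) (j := some (k, true)) (by simp)
      (fun σ => (a (σ none) * a (σ (some (k, true)))) * b (σ (some (k, false))) * R σ) fun σ => by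
        have : (σ * Equiv.swap none (some (k, true))) (some (k, false)) = σ (some (k, false)) := by
          rw [Equiv.Perm.mul_apply, Equiv.swap_apply_of_ne_of_ne (by simp) (by simp)]
        simp only [hRs, this]
        simp [mul_comm]
    have h3 := sum_sign_mul_eq_zero (i := none) (j := some (k, false)) (by simp)
      (fun σ => (a (σ none) * a (σ (some (k, false)))) * b (σ (some (k, true))) * R σ) fun σ => by
        have : (σ * Equiv.swap none (some (k, false))) (some (k, true)) = σ (some (k, true)) := by
          rw [Equiv.Perm.mul_apply, Equiv.swap_apply_of_ne_of_ne (by simp) (by simp)]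
        simp only [hRs, this]
        simp [mul_comm]
    rw [← sub_eq_zero.2 (h2.trans h3.symm), ← Finset.sum_sub_distrib]
    refine Finset.sum_congr rfl fun σ _ => ?_
    rw [← Finset.mul_prod_erase (Finset.univ \ t) _ (by simpa using hk)]
    simp only [hR]
    ring

/-- The permutation of the index set attached to a choice of one coordinate in each of the `m`
conjugate pairs. -/
def pairPerm (J : Equiv.Perm (Fin m)) (c : Fin m → Bool) : Equiv.Perm (Option (Fin m × Bool)) :=
  Equiv.optionCongr ((Equiv.prodCongrLeft fun _ : Bool => J) *
    (Equiv.prodCongrRight fun k : Fin m => if c k then Equiv.swap false true else 1))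

lemma pairPerm_some (J : Equiv.Perm (Fin m)) (c : Fin m → Bool) (k : Fin m) (b : Bool) :
    pairPerm J c (some (k, b)) = some (J k, xor (c k) b) := by
  cases h : c k <;> cases b <;> simp [pairPerm, h]

/-- J acts on both members of the pairs and contributes its sign twice; only the flips within pairs
count. -/
lemma sign_pairPerm (J : Equiv.Perm (Fin m)) (c : Fin m → Bool) :
    ((Equiv.Perm.sign (pairPerm J c) : ℤ) : ℝ) = ∏ k, if c k then -1 else 1 := by
  have h : ∀ k, Equiv.Perm.sign (if c k then Equiv.swap false true else 1) =
      if c k then -1 else 1 := fun k => by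
    split_ifs <;> simp
  rw [pairPerm, Equiv.optionCongr_sign, Equiv.Perm.sign_mul, Equiv.Perm.sign_prodCongrLeft,
    Equiv.Perm.sign_prodCongrRight]
  simp only [h, Fintype.prod_bool, Int.units_mul_self, one_mul]
  push_cast
  refine Finset.prod_congr rfl fun k _ => ?_
  split_ifs <;> simp

/-- `a ∧ Wᵐ ≠ 0` if `a` is a multiple of one coordinate of a coframe and `W` is the standard
symplectic form in the other ones. -/
lemma wedgeSum_ne_zero {M : Matrix (Option (Fin m × Bool)) (Option (Fin m × Bool)) ℝ}
    (hM : M.det ≠ 0) {c : ℝ} (hc : c ≠ 0) :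
    wedgeSum (fun i => c * M none i) (fun i j => ∑ k, (M (some (k, false)) i * M (some (k, true)) j -
      M (some (k, true)) i * M (some (k, false)) j)) ≠ 0 := by
  classical
  -- In the expansion of Wᵐ, g k records which conjugate pair the k-th factor takes and in which
  -- order; the resulting term is, up to sign and the factor c, the determinant of M with rows
  -- chosen by r g.
  set r : (Fin m → Fin m × Bool) → Option (Fin m × Bool) → Option (Fin m × Bool) := fun g i =>
    i.map fun p => ((g p.1).1, xor (g p.1).2 p.2) with hr
  set ε : Bool → ℝ := fun b => if b then -1 else 1 with hε
  have h1 : wedgeSum (fun i => c * M none i)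
      (fun i j => ∑ k, (M (some (k, false)) i * M (some (k, true)) j -
        M (some (k, true)) i * M (some (k, false)) j)) =
      ∑ g : Fin m → Fin m × Bool, c * ((∏ k, ε (g k).2) * (M.submatrix (r g) id).det) := by
    have h2 : ∀ i j, ∑ k, (M (some (k, false)) i * M (some (k, true)) j -
        M (some (k, true)) i * M (some (k, false)) j) =
        ∑ p : Fin m × Bool, ε p.2 * (M (some p) i * M (some (p.1, !p.2)) j) := fun i j => by
      rw [Fintype.sum_prod_type]
      refine Finset.sum_congr rfl fun k _ => ?_
      simp [hε]
      ring
    unfold wedgeSum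
    simp_rw [h2, Finset.prod_univ_sum, Fintype.piFinset_univ, Finset.mul_sum]
    rw [Finset.sum_comm]
    refine Finset.sum_congr rfl fun g _ => ?_
    rw [← Matrix.det_transpose, Matrix.det_apply', Finset.mul_sum, Finset.mul_sum]
    refine Finset.sum_congr rfl fun σ _ => ?_
    rw [Fintype.prod_option, Fintype.prod_prod_type, Finset.prod_mul_distrib]
    simp only [Fintype.prod_bool, Matrix.transpose_apply, Matrix.submatrix_apply, id, hr,
      Option.map_none, Option.map_some, Bool.xor_true, Bool.xor_false]
    simp_rw [mul_comm (M (some ((g _).1, !(g _).2)) _)]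
    ring
  -- A repeated pair produces two equal rows. Otherwise r g is a permutation whose sign cancels the
  -- signs of the orders, so all surviving terms are equal and none cancel.
  have h2 : ∀ g : Fin m → Fin m × Bool, (∏ k, ε (g k).2) * (M.submatrix (r g) id).det =
      if Function.Injective fun k => (g k).1 then M.det else 0 := fun g => by
    split_ifs with hg
    · set J : Equiv.Perm (Fin m) := Equiv.ofBijective _ (Finite.injective_iff_bijective.1 hg)
      have h3 : r g = pairPerm J fun k => (g k).2 := by
        funext i
        rcases i with _ | ⟨k, b⟩
        · rfl
        · rw [pairPerm_some]; rfl
      rw [h3, Matrix.det_permute, sign_pairPerm, ← mul_assoc, ← Finset.prod_mul_distrib,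
        Finset.prod_eq_one, one_mul]
      intro k _
      cases (g k).2 <;> simp [hε]
    · obtain ⟨k, l, h3, h4⟩ : ∃ k l, (g k).1 = (g l).1 ∧ k ≠ l := by
        simpa [Function.Injective] using hg
      rw [Matrix.det_zero_of_row_eq (i := some (k, (g k).2)) (j := some (l, (g l).2))
        (by simp [h4]), mul_zero]
      funext i
      simp [hr, h3]
  rw [h1]
  simp_rw [h2]
  rw [← Finset.mul_sum, ← Finset.sum_filter, Finset.sum_const, nsmul_eq_mul]
  refine mul_ne_zero hc (mul_ne_zero ?_ hM)
  rw [Nat.cast_ne_zero, Finset.card_ne_zero]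
  exact ⟨fun k => (k, false), Finset.mem_filter.2 ⟨Finset.mem_univ _, fun _ _ h => h⟩⟩

/-- The bijection under which `wedgeDensity` is a `wedgeSum`. -/
def wedgeIndex (n : ℕ) [NeZero n] : Option (Fin (n - 1) × Bool) ≃ Fin (2 * n - 1) :=
  Equiv.ofBijective
    (fun i => i.elim ⟨0, by have := NeZero.pos n; omega⟩ fun p =>
      if p.2 then ⟨2 * p.1 + 2, by omega⟩ else ⟨2 * p.1 + 1, by omega⟩) <| by
    rw [Fintype.bijective_iff_injective_and_card]
    refine ⟨?_, ?_⟩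
    · rintro (_ | ⟨⟨k, hk⟩, _ | _⟩) (_ | ⟨⟨l, hl⟩, _ | _⟩) h <;> simp at h ⊢ <;> omega
    · have := NeZero.pos n
      simp
      omega

lemma wedgeDensity_eq (n : ℕ) [NeZero n]
    (η : EuclideanSpace ℝ (Fin (2 * n - 1)) → EuclideanSpace ℝ (Fin (2 * n - 1)) →L[ℝ] ℝ)
    (y : EuclideanSpace ℝ (Fin (2 * n - 1))) : wedgeDensity n η y = 1 / 2 ^ (n - 1) *
      wedgeSum (fun i => η y (EuclideanSpace.single (wedgeIndex n i) 1)) (fun i j =>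
        fderiv ℝ η y (EuclideanSpace.single (wedgeIndex n i) 1)
          (EuclideanSpace.single (wedgeIndex n j) 1) -
        fderiv ℝ η y (EuclideanSpace.single (wedgeIndex n j) 1)
          (EuclideanSpace.single (wedgeIndex n i) 1)) := by
  unfold wedgeDensity wedgeSum
  simp only
  rw [← Equiv.sum_comp (wedgeIndex n).permCongr]
  congr 1
  refine Finset.sum_congr rfl fun σ _ => ?_
  have h1 : ∀ i j, (wedgeIndex n) i = j →
      (wedgeIndex n).permCongr σ j = wedgeIndex n (σ i) := by
    rintro i _ rfl
    simp
  have h2 : (wedgeIndex n).permCongr σ ⟨0, by have := NeZero.pos n; omega⟩ =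
      wedgeIndex n (σ none) := h1 _ _ rfl
  have h3 : ∀ k : Fin (n - 1), (wedgeIndex n).permCongr σ ⟨2 * k + 1, by omega⟩ =
      wedgeIndex n (σ (some (k, false))) := fun k => h1 _ _ rfl
  have h4 : ∀ k : Fin (n - 1), (wedgeIndex n).permCongr σ ⟨2 * k + 2, by omega⟩ =
      wedgeIndex n (σ (some (k, true))) := fun k => h1 _ _ rfl
  simp only [Equiv.Perm.sign_permCongr, h2, h3, h4]

/-- Behaviour of `η ∧ (dη)ⁿ⁻¹` under multiplication of `η` by a function. -/
lemma wedgeDensity_smul (n : ℕ) [NeZero n]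
    {η : EuclideanSpace ℝ (Fin (2 * n - 1)) → EuclideanSpace ℝ (Fin (2 * n - 1)) →L[ℝ] ℝ}
    {f : EuclideanSpace ℝ (Fin (2 * n - 1)) → ℝ} {y : EuclideanSpace ℝ (Fin (2 * n - 1))}
    (hη : DifferentiableAt ℝ η y) (hf : DifferentiableAt ℝ f y) :
    wedgeDensity n (fun y => f y • η y) y = f y ^ n * wedgeDensity n η y := by
  have h := wedgeSum_smul (fun i => η y (EuclideanSpace.single (wedgeIndex n i) 1))
    (fun i => fderiv ℝ f y (EuclideanSpace.single (wedgeIndex n i) 1)) (fun i j =>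
        fderiv ℝ η y (EuclideanSpace.single (wedgeIndex n i) 1)
          (EuclideanSpace.single (wedgeIndex n j) 1) -
        fderiv ℝ η y (EuclideanSpace.single (wedgeIndex n j) 1)
          (EuclideanSpace.single (wedgeIndex n i) 1)) (f y)
  rw [Nat.sub_add_cancel (NeZero.pos n)] at h
  rw [wedgeDensity_eq, wedgeDensity_eq, mul_left_comm, ← h]
  congr 3
  · funext i j
    rw [fderiv_fun_smul hf hη]
    simp
    ring

lemma sum_fin_eq_zero_add {n : ℕ} [NeZero n] (f : Fin n → ℝ) :
    ∑ j, f j = f 0 + ∑ k : Fin (n - 1), f ⟨k + 1, by omega⟩ := by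
  obtain ⟨m, rfl⟩ : ∃ m, n = m + 1 := ⟨n - 1, (Nat.sub_add_cancel (NeZero.pos n)).symm⟩
  exact Fin.sum_univ_succ f

/-- The contact condition for the pull-back of the Liouville form, at a point where the sphere is
tangent to a coordinate hyperplane. -/
lemma wedgeDensity_pullLiouville_ne_zero {n : ℕ} [NeZero n]
    {s : EuclideanSpace ℝ (Fin (2 * n - 1)) → PhaseSpace n} {y : EuclideanSpace ℝ (Fin (2 * n - 1))}
    (hs : ContDiffAt ℝ ∞ s y) (hinj : Function.Injective (fderiv ℝ s y))
    (hy : s y = -northPole n) (h0 : ∀ v, fderiv ℝ s y v (Sum.inl 0) = 0) :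
    wedgeDensity n (pullLiouville s) y ≠ 0 := by
  set e : Option (Fin (n - 1) × Bool) → EuclideanSpace ℝ (Fin (2 * n - 1)) :=
    fun i => EuclideanSpace.single (wedgeIndex n i) 1 with he
  set M : Matrix (Option (Fin (n - 1) × Bool)) (Option (Fin (n - 1) × Bool)) ℝ := fun r i =>
    fderiv ℝ s y (e i) (r.elim (Sum.inr 0) fun p =>
      if p.2 then Sum.inr ⟨p.1 + 1, by omega⟩ else Sum.inl ⟨p.1 + 1, by omega⟩) with hM
  -- A kernel vector yields u with ds(u) = 0: the x_0-coordinate vanishes by `h0`, the others by the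
  -- matrix equation.
  have hdet : M.det ≠ 0 := fun h => by
    obtain ⟨v, hv0, hv⟩ := Matrix.exists_mulVec_eq_zero_iff.2 h
    set u := ∑ i, v i • e i with hu
    have h1 : ∀ r : Option (Fin (n - 1) × Bool), fderiv ℝ s y u (r.elim (Sum.inr 0) fun p : Fin (n - 1) × Bool =>
      if p.2 then Sum.inr ⟨p.1 + 1, by omega⟩ else Sum.inl ⟨p.1 + 1, by omega⟩) = 0 := fun r => by
      have := congrFun hv r
      rw [hu, map_sum]
      simpa [Matrix.mulVec, dotProduct, hM, mul_comm] using this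
    have h2 : fderiv ℝ s y u = 0 := by
      have h3 : ∀ j : Fin n, j = 0 ∨ ∃ k : Fin (n - 1), j = ⟨k + 1, by omega⟩ := fun j => by
        rcases Nat.eq_zero_or_pos (j : ℕ) with h | h
        · exact Or.inl (Fin.ext (by simpa using h))
        · exact Or.inr ⟨⟨j - 1, by omega⟩, Fin.ext (by simp; omega)⟩
      ext i
      rcases i with j | j <;> rcases h3 j with rfl | ⟨k, rfl⟩
      · exact h0 u
      · exact h1 (some (k, false))
      · exact h1 none
      · exact h1 (some (k, true))
    have h3 : u = 0 := hinj (by rw [h2, map_zero])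
    refine hv0 (funext fun i => ?_)
    have h4 := congrArg (fun w : EuclideanSpace ℝ (Fin (2 * n - 1)) => w (wedgeIndex n i)) h3
    simpa [hu, he, -Fintype.sum_option, Pi.single_apply] using h4
  -- At the south pole x_0 = -1 and all other coordinates vanish, so λ₀ = -½ dy_0.
  have key := wedgeSum_ne_zero hdet (c := -(1 / 2)) (by norm_num)
  rw [wedgeDensity_eq]
  refine mul_ne_zero (by positivity) ?_
  convert key using 2
  · funext i
    rw [pullLiouville, ContinuousLinearMap.comp_apply, hy, liouvilleForm_apply,
      Finset.sum_eq_single_of_mem (0 : Fin n) (by simp)]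
    · simp [northPole, hM, he]
    · intro j _ hj
      simp [northPole, hj]
  · funext i j
    rw [fderiv_pullLiouville_sub hs, inner_phaseSpace, sum_fin_eq_zero_add]
    simp only [hM, symplJ_inl, symplJ_inr, h0, mul_zero, zero_mul, add_zero, zero_add]
    refine Finset.sum_congr rfl fun k _ => ?_
    simp only [Option.elim, if_true, Bool.false_eq_true, if_false]
    ring

end WedgeAlgebra

/-! ### The contact volume density in the stereographic chart -/

section StereographicLift

variable {n : ℕ} [NeZero n]

local notation "𝓜" => 𝓡 (2 * n - 1)

/-- The inverse of the stereographic projection, as a map to `ℝ²ⁿ`. -/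
def stereoLift (n : ℕ) [NeZero n] (y : EuclideanSpace ℝ (Fin (2 * n - 1))) : PhaseSpace n :=
  ((stereographic' (2 * n - 1) (northPole n)).symm y : USphere n)

lemma norm_stereoLift (y : EuclideanSpace ℝ (Fin (2 * n - 1))) : ‖stereoLift n y‖ = 1 :=
  norm_eq_of_mem_sphere _

lemma stereoLift_ne_zero (y : EuclideanSpace ℝ (Fin (2 * n - 1))) : stereoLift n y ≠ 0 :=
  ne_zero_of_mem_unit_sphere _

lemma stereoLift_injective : Function.Injective (stereoLift n) := fun y z h =>
  (stereographic' (2 * n - 1) (northPole n)).symm.injOn (by simp) (by simp) (Subtype.ext h)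

lemma stereoParam_eq (y : EuclideanSpace ℝ (Fin (2 * n - 1))) :
    stereoParam n y = RP.mk (toUSphere (stereoLift n y)) := by
  rw [stereoLift, toUSphere_coe, stereoParam]

/-- A is the isometric identification of ℝ²ⁿ⁻¹ with the hyperplane orthogonal to the pole; isolating
it leaves an explicit rational formula. -/
lemma exists_stereoLift_eq : ∃ A : EuclideanSpace ℝ (Fin (2 * n - 1)) →ₗᵢ[ℝ] PhaseSpace n,
    (∀ y, ⟪A y, (northPole n : PhaseSpace n)⟫ = 0) ∧ ∀ y, stereoLift n y =
      (‖y‖ ^ 2 + 4)⁻¹ • ((4 : ℝ) • A y + (‖y‖ ^ 2 - 4) • (northPole n : PhaseSpace n)) := by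
  let U : (Submodule.span ℝ {(northPole n : PhaseSpace n)})ᗮ ≃ₗᵢ[ℝ]
      EuclideanSpace ℝ (Fin (2 * n - 1)) := (OrthonormalBasis.fromOrthogonalSpanSingleton
    (2 * n - 1) (ne_zero_of_mem_unit_sphere (northPole n))).repr
  refine ⟨(Submodule.subtypeₗᵢ _).comp U.symm.toLinearIsometry, fun y => ?_, fun y => ?_⟩
  · exact Submodule.mem_orthogonal_singleton_iff_inner_left.1 (U.symm y).2
  · have h := stereographic'_symm_apply (northPole n) y (n := 2 * n - 1)
    have h1 : ‖((U.symm y : (Submodule.span ℝ {(northPole n : PhaseSpace n)})ᗮ) : PhaseSpace n)‖ =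
        ‖y‖ := U.symm.norm_map y
    rw [stereoLift, h]
    simp only
    change (‖((U.symm y : (Submodule.span ℝ {(northPole n : PhaseSpace n)})ᗮ) : PhaseSpace n)‖ ^ 2 +
      4)⁻¹ • (4 : ℝ) • ((U.symm y : (Submodule.span ℝ {(northPole n : PhaseSpace n)})ᗮ) :
        PhaseSpace n) +
      (‖((U.symm y : (Submodule.span ℝ {(northPole n : PhaseSpace n)})ᗮ) : PhaseSpace n)‖ ^ 2 +
      4)⁻¹ • (‖((U.symm y : (Submodule.span ℝ {(northPole n : PhaseSpace n)})ᗮ) :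
        PhaseSpace n)‖ ^ 2 - 4) • (northPole n : PhaseSpace n) = _
    rw [h1, ← smul_add]
    rfl

lemma contDiff_stereoLift : ContDiff ℝ ∞ (stereoLift n) := by
  obtain ⟨A, -, hA⟩ := exists_stereoLift_eq (n := n)
  rw [funext hA]
  have h : ContDiff ℝ ∞ fun y : EuclideanSpace ℝ (Fin (2 * n - 1)) => ‖y‖ ^ 2 := contDiff_norm_sq ℝ
  refine ((h.add contDiff_const).inv fun y => by positivity).smul ?_
  exact (A.toContinuousLinearMap.contDiff.const_smul (4 : ℝ)).add
    ((h.sub contDiff_const).smul contDiff_const)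

lemma hemisphereDomain_eq : hemisphereDomain n = ball 0 2 := by
  obtain ⟨A, hA0, hA⟩ := exists_stereoLift_eq (n := n)
  ext y
  change ⟪stereoLift n y, (northPole n : PhaseSpace n)⟫ < 0 ↔ _
  rw [hA, inner_smul_left, inner_add_left, inner_smul_left, inner_smul_left, hA0,
    real_inner_self_eq_norm_sq, norm_eq_of_mem_sphere, mem_ball_zero_iff]
  have h1 : 0 < (‖y‖ ^ 2 + 4)⁻¹ := by positivity
  simp only [conj_trivial, mul_zero, zero_add, one_pow, mul_one]
  constructor <;> intro h
  · have := (mul_neg_iff.1 h).resolve_right fun h2 => h2.1.not_gt h1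
    nlinarith [norm_nonneg y]
  · exact mul_neg_of_pos_of_neg h1 (by nlinarith [norm_nonneg y])

/-- Differentiating the formula with its denominator cleared avoids the quotient rule. -/
lemma fderiv_stereoLift {A : EuclideanSpace ℝ (Fin (2 * n - 1)) →ₗᵢ[ℝ] PhaseSpace n}
    (hA : ∀ y, stereoLift n y =
      (‖y‖ ^ 2 + 4)⁻¹ • ((4 : ℝ) • A y + (‖y‖ ^ 2 - 4) • (northPole n : PhaseSpace n)))
    (y v : EuclideanSpace ℝ (Fin (2 * n - 1))) :
    (‖y‖ ^ 2 + 4) • fderiv ℝ (stereoLift n) y v =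
      (4 : ℝ) • A v + (2 * ⟪y, v⟫) • (northPole n - stereoLift n y : PhaseSpace n) := by
  have h1 : (fun y => (‖y‖ ^ 2 + 4) • stereoLift n y) =
      fun y => (4 : ℝ) • A y + (‖y‖ ^ 2 - 4) • (northPole n : PhaseSpace n) := funext fun y => by
    rw [hA, smul_inv_smul₀ (by positivity)]
  have hN : HasFDerivAt (fun y : EuclideanSpace ℝ (Fin (2 * n - 1)) => ‖y‖ ^ 2)
      ((2 : ℝ) • innerSL ℝ y) y := by
    have := (hasStrictFDerivAt_norm_sq y).hasFDerivAt
    rwa [← Nat.cast_smul_eq_nsmul ℝ] at this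
  have h2 := (hN.add_const 4).smul
    ((contDiff_stereoLift (n := n)).differentiable (by simp) y).hasFDerivAt
  have h3 := (A.toContinuousLinearMap.hasFDerivAt (x := y) |>.const_smul (4 : ℝ)).add
    ((hN.sub_const 4).smul_const (northPole n : PhaseSpace n))
  have h5 : ((fun x : EuclideanSpace ℝ (Fin (2 * n - 1)) => ‖x‖ ^ 2 + 4) • stereoLift n) = ((4 : ℝ) • ⇑A.toContinuousLinearMap +
      fun y : EuclideanSpace ℝ (Fin (2 * n - 1)) => (‖y‖ ^ 2 - 4) • (northPole n : PhaseSpace n)) := by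
    funext z
    exact congrFun h1 z
  rw [h5] at h2
  have h4 := congrArg (fun C => C v) (h2.unique h3)
  simp at h4
  rw [smul_sub, eq_sub_of_add_eq h4]
  abel

/-- If v is in the kernel, pairing with the pole p gives 2⟪y, v⟫ (1 - ⟪s(y), p⟫) = 0 with ⟪s(y), p⟫
< 1. So ⟪y, v⟫ = 0, and then A v = 0. -/
lemma fderiv_stereoLift_injective (y : EuclideanSpace ℝ (Fin (2 * n - 1))) :
    Function.Injective (fderiv ℝ (stereoLift n) y) := by
  obtain ⟨A, hA0, hA⟩ := exists_stereoLift_eq (n := n)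
  rw [injective_iff_map_eq_zero]
  intro v hv
  have h1 := fderiv_stereoLift hA y v
  rw [hv, smul_zero] at h1
  have h2 : ⟪stereoLift n y, (northPole n : PhaseSpace n)⟫ = (‖y‖ ^ 2 - 4) / (‖y‖ ^ 2 + 4) := by
    rw [hA, inner_smul_left, inner_add_left, inner_smul_left, inner_smul_left, hA0,
      real_inner_self_eq_norm_sq, norm_eq_of_mem_sphere]
    simp
    ring
  have h3 := congrArg (fun w => ⟪w, (northPole n : PhaseSpace n)⟫) h1
  simp only [inner_zero_left, inner_add_left, inner_smul_left, inner_sub_left, hA0, h2,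
    real_inner_self_eq_norm_sq, norm_eq_of_mem_sphere, conj_trivial] at h3
  have h4 : (0 : ℝ) < 1 ^ 2 - (‖y‖ ^ 2 - 4) / (‖y‖ ^ 2 + 4) := by
    rw [sub_pos, div_lt_iff₀ (by positivity)]
    linarith
  have h5 : 2 * ⟪y, v⟫ = 0 := by
    rcases mul_eq_zero.1 (show 2 * ⟪y, v⟫ * (1 ^ 2 - (‖y‖ ^ 2 - 4) / (‖y‖ ^ 2 + 4)) = 0 by linarith)
      with h | h
    · exact h
    · exact absurd h h4.ne'
  rw [h5, zero_smul, add_zero] at h1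
  have h6 : A v = 0 := (smul_eq_zero.1 h1.symm).resolve_left (by norm_num)
  exact A.injective (by rw [h6, map_zero])

lemma inner_stereoLift_fderiv (y v : EuclideanSpace ℝ (Fin (2 * n - 1))) :
    ⟪stereoLift n y, fderiv ℝ (stereoLift n) y v⟫ = 0 := by
  have h1 := ((contDiff_stereoLift (n := n)).differentiable (by simp) y).hasFDerivAt
  have h2 := h1.norm_sq
  have h3 : (fun y => ‖stereoLift n y‖ ^ 2) = fun _ => 1 := funext fun y => by
    rw [norm_stereoLift, one_pow]
  rw [h3] at h2
  have h4 := congrArg (fun C => C v) (h2.unique (hasFDerivAt_const 1 y))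
  simpa using h4

/-- The pull-back of the standard contact form under the stereographic parametrization. -/
lemma stdForm_comp_mfderiv_stereoParam (y : EuclideanSpace ℝ (Fin (2 * n - 1))) :
    ContinuousLinearMap.comp
      (stdForm (stereoParam n y) : EuclideanSpace ℝ (Fin (2 * n - 1)) →L[ℝ] ℝ)
      (mfderiv 𝓜 𝓜 (stereoParam n) y) = pullLiouville (stereoLift n) y := by
  have h := stdForm_mfderiv_mk_toUSphere (I := 𝓜) (g := stereoLift n) (y := y)
    ((contDiff_stereoLift.differentiable (by simp) y).mdifferentiableAt) (stereoLift_ne_zero y)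
  have h1 : (fun y => RP.mk (toUSphere (stereoLift n y))) = stereoParam n :=
    funext fun y => (stereoParam_eq y).symm
  ext1 v
  have h2 := h v
  rw [h1, ← stereoParam_eq, norm_stereoLift] at h2
  refine h2.trans ?_
  rw [one_pow, inv_one, one_mul, mvfderiv, mfderiv_eq_fderiv]
  rfl

/-- The density of the standard contact volume form in the stereographic chart. -/
def stereoDensity (n : ℕ) [NeZero n] : EuclideanSpace ℝ (Fin (2 * n - 1)) → ℝ :=
  wedgeDensity n (pullLiouville (stereoLift n))

lemma continuous_stereoDensity : Continuous (stereoDensity n) := by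
  have h : ContDiff ℝ ∞ (pullLiouville (stereoLift n)) :=
    contDiff_iff_contDiffAt.2 fun y => contDiffAt_pullLiouville contDiff_stereoLift.contDiffAt
  have h0 := h.continuous
  have h1 := h.continuous_fderiv (by simp)
  unfold stereoDensity wedgeDensity
  fun_prop

/-- The origin goes to the south pole, where `wedgeDensity_pullLiouville_ne_zero` applies. By
continuity this one point suffices to make integrals against the density positive. -/
lemma stereoDensity_zero_ne_zero : stereoDensity n 0 ≠ 0 := by
  obtain ⟨A, hA0, hA⟩ := exists_stereoLift_eq (n := n)
  refine wedgeDensity_pullLiouville_ne_zero contDiff_stereoLift.contDiffAt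
    (fderiv_stereoLift_injective 0) ?_ fun v => ?_
  · rw [hA]
    simp [smul_smul]
  · have h1 := fderiv_stereoLift hA 0 v
    have h2 : fderiv ℝ (stereoLift n) 0 v = A v := by
      simpa using h1
    have h3 := hA0 v
    rw [h2]
    simpa [northPole, EuclideanSpace.inner_single_right] using h3

end StereographicLift

/-! ### Comparison with Lebesgue volume in polar coordinates -/

section ConeVolume

open MeasureTheory

variable {n : ℕ} [NeZero n]

/-- The differential of polar coordinates at radius one. -/
def coneFrame (n : ℕ) [NeZero n] (y : EuclideanSpace ℝ (Fin (2 * n - 1))) :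
    EuclideanSpace ℝ (Fin (2 * n - 1)) × ℝ →L[ℝ] PhaseSpace n :=
  (fderiv ℝ (stereoLift n) y).comp (ContinuousLinearMap.fst ℝ _ ℝ) +
    (ContinuousLinearMap.snd ℝ _ ℝ).smulRight (stereoLift n y)

/-- The radial direction is orthogonal to the tangent space of the sphere, and the parametrization
of the sphere is an immersion. -/
lemma coneFrame_injective (y : EuclideanSpace ℝ (Fin (2 * n - 1))) :
    Function.Injective (coneFrame n y) := by
  rw [injective_iff_map_eq_zero]
  rintro ⟨v, ρ⟩ h
  have h1 : fderiv ℝ (stereoLift n) y v + ρ • stereoLift n y = 0 := h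
  have h2 := congrArg (fun w => ⟪stereoLift n y, w⟫) h1
  simp only [inner_add_right, inner_stereoLift_fderiv, inner_smul_right, inner_zero_right,
    real_inner_self_eq_norm_sq, norm_stereoLift] at h2
  have h3 : ρ = 0 := by linarith
  rw [h3, zero_smul, add_zero] at h1
  rw [h3, fderiv_stereoLift_injective y (h1.trans (map_zero _).symm)]
  rfl

lemma continuous_coneFrame : Continuous (coneFrame n) := by
  have h1 := (contDiff_stereoLift (n := n)).continuous_fderiv (by simp)
  have h2 := (contDiff_stereoLift (n := n)).continuous
  unfold coneFrame
  refine (h1.clm_comp continuous_const).add ?_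
  exact ((ContinuousLinearMap.smulRightL ℝ (EuclideanSpace ℝ (Fin (2 * n - 1)) × ℝ)
    (PhaseSpace n)) (ContinuousLinearMap.snd ℝ _ ℝ)).continuous.comp h2

lemma hasFDerivAt_cone (p : EuclideanSpace ℝ (Fin (2 * n - 1)) × ℝ) :
    HasFDerivAt (fun p : EuclideanSpace ℝ (Fin (2 * n - 1)) × ℝ => Real.exp p.2 • stereoLift n p.1)
      (Real.exp p.2 • coneFrame n p.1) p := by
  have h1 : HasFDerivAt (fun p : EuclideanSpace ℝ (Fin (2 * n - 1)) × ℝ => stereoLift n p.1) _ p :=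
    ((contDiff_stereoLift (n := n)).differentiable (by simp) p.1).hasFDerivAt.comp p (hasFDerivAt_fst (p := p))
  have h2 : HasFDerivAt (fun p : EuclideanSpace ℝ (Fin (2 * n - 1)) × ℝ => Real.exp p.2) _ p :=
    (Real.hasDerivAt_exp p.2).comp_hasFDerivAt p (hasFDerivAt_snd (𝕜 := ℝ) (p := p))
  refine (h2.smul h1).congr_fderiv ?_
  refine ContinuousLinearMap.ext fun w => ?_
  simp [coneFrame, smul_smul]

/-- A bound for an integral over the hemisphere by the volume of a sublevel set. -/
lemma exists_lintegral_hemisphere_le (n : ℕ) [NeZero n] : ∃ C : ℝ≥0∞, C ≠ ⊤ ∧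
    ∀ g : PhaseSpace n → ℝ, ContinuousOn g {0}ᶜ → (∀ x, x ≠ 0 → 0 < g x) →
      (∀ (c : ℝ) x, g (c • x) = c ^ 2 * g x) →
      ∫⁻ y in hemisphereDomain n, ENNReal.ofReal ((g (stereoLift n y))⁻¹ ^ n) ≤
        C * volume {x : PhaseSpace n | x ≠ 0 ∧ g x < 1} := by
  have hdim : Module.finrank ℝ (EuclideanSpace ℝ (Fin (2 * n - 1)) × ℝ) = 2 * n := by
    have := NeZero.pos n
    simp
    omega
  have : T2Space (EuclideanSpace ℝ (Fin (2 * n - 1)) × ℝ) := Prod.t2Space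
  -- A linear identification makes polar coordinates a self-map of one space, so that the change of
  -- variables formula applies; it scales volume by the constant κ.
  obtain ⟨T⟩ : Nonempty (PhaseSpace n ≃L[ℝ] EuclideanSpace ℝ (Fin (2 * n - 1)) × ℝ) :=
    FiniteDimensional.nonempty_continuousLinearEquiv_of_finrank_eq (by rw [hdim]; simp [two_mul])
  have : (volume : Measure (EuclideanSpace ℝ (Fin (2 * n - 1)) × ℝ)).IsAddHaarMeasure :=
    Measure.prod.instIsAddHaarMeasure _ _
  have : ((volume : Measure (EuclideanSpace ℝ (Fin (2 * n - 1)) × ℝ)).map T.symm).IsAddHaarMeasure :=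
    T.symm.isAddHaarMeasure_map _
  obtain ⟨κ, hκT⟩ : ∃ κ : NNReal,
      (volume : Measure (EuclideanSpace ℝ (Fin (2 * n - 1)) × ℝ)).map T.symm =
        κ • (volume : Measure (PhaseSpace n)) := ⟨_, Measure.isAddLeftInvariant_eq_smul _ _⟩
  have hTS : ∀ S : Set (PhaseSpace n), MeasurableSet S → volume (T '' S) = (κ : ℝ≥0∞) * volume S :=
    fun S hS => by
      rw [T.image_eq_preimage_symm, ← Measure.map_apply T.symm.continuous.measurable hS, hκT]
      rfl
  set B : EuclideanSpace ℝ (Fin (2 * n - 1)) → (EuclideanSpace ℝ (Fin (2 * n - 1)) × ℝ →L[ℝ]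
      EuclideanSpace ℝ (Fin (2 * n - 1)) × ℝ) := fun y =>
    (T : PhaseSpace n →L[ℝ] EuclideanSpace ℝ (Fin (2 * n - 1)) × ℝ).comp (coneFrame n y) with hB
  have hBdet : ∀ y, (B y).det ≠ 0 := fun y h => by
    have h1 := LinearMap.bot_lt_ker_of_det_eq_zero h
    have h2 : LinearMap.ker (B y : EuclideanSpace ℝ (Fin (2 * n - 1)) × ℝ →ₗ[ℝ]
      EuclideanSpace ℝ (Fin (2 * n - 1)) × ℝ) = ⊥ :=
      LinearMap.ker_eq_bot.2 (T.injective.comp (coneFrame_injective y))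
    exact h1.ne' h2
  have hBc : Continuous fun y => |(B y).det| :=
    (ContinuousLinearMap.continuous_det.comp (continuous_const.clm_comp continuous_coneFrame)).abs
  obtain ⟨y₀, -, hy₀⟩ := (isCompact_closedBall (0 : EuclideanSpace ℝ (Fin (2 * n - 1))) 2).exists_isMinOn
    (nonempty_closedBall.2 (by norm_num)) hBc.continuousOn
  set c := |(B y₀).det| with hc
  have hc0 : 0 < c := abs_pos.2 (hBdet y₀)
  -- On the shell A below, the Jacobian is at least d g⁻ⁿ: e^(-2n) is lost over the unit range of r,
  -- and c is the least angular factor on the closed ball.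
  set d := Real.exp (-1) ^ (2 * n) * c with hd
  have hd0 : 0 < d := by positivity
  refine ⟨(ENNReal.ofReal d)⁻¹ * κ, ENNReal.mul_ne_top (by simpa using hd0) ENNReal.coe_ne_top,
    fun g hg hpos hsmul => ?_⟩
  -- e^{ℓ(y)} is the radius at which the ray through `stereoLift n y` leaves {g < 1}.
  set ℓ : EuclideanSpace ℝ (Fin (2 * n - 1)) → ℝ := fun y =>
    -(1 / 2) * Real.log (g (stereoLift n y)) with hℓ
  have hgs : Continuous fun y => g (stereoLift n y) :=
    hg.comp_continuous contDiff_stereoLift.continuous stereoLift_ne_zero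
  have hℓc : Continuous ℓ :=
    continuous_const.mul (hgs.log fun y => (hpos _ (stereoLift_ne_zero y)).ne')
  have hexp : ∀ y, Real.exp (ℓ y) ^ 2 = (g (stereoLift n y))⁻¹ := fun y => by
    rw [← Real.exp_nat_mul, hℓ]
    have : (((2 : ℕ) : ℝ) * (-(1 / 2) * Real.log (g (stereoLift n y)))) =
      -Real.log (g (stereoLift n y)) := by push_cast; ring
    simp only [this]
    rw [Real.exp_neg, Real.exp_log (hpos _ (stereoLift_ne_zero y))]
  -- The shell of logarithmic thickness one inside the level set g = 1. Its fibres have length one,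
  -- so integrals over the base become integrals over A.
  set A := regionBetween (fun y => ℓ y - 1) ℓ (hemisphereDomain n) with hA
  have hdom : MeasurableSet (hemisphereDomain n) := by
    rw [hemisphereDomain_eq]; exact measurableSet_ball
  have hAm : MeasurableSet A :=
    measurableSet_regionBetween (hℓc.sub continuous_const).measurable hℓc.measurable hdom
  set Φ : EuclideanSpace ℝ (Fin (2 * n - 1)) × ℝ → EuclideanSpace ℝ (Fin (2 * n - 1)) × ℝ :=
    fun p => T (Real.exp p.2 • stereoLift n p.1) with hΦ
  have hΦd : ∀ p, HasFDerivAt Φ (Real.exp p.2 • B p.1) p := fun p => by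
    have := (T : PhaseSpace n →L[ℝ] EuclideanSpace ℝ (Fin (2 * n - 1)) × ℝ).hasFDerivAt.comp p
      (hasFDerivAt_cone p)
    rwa [ContinuousLinearMap.comp_smul] at this
  have hΦi : Function.Injective Φ := fun p q h => by
    have h1 := T.injective h
    have h2 : p.2 = q.2 := by
      have := congrArg norm h1
      simpa [norm_smul, norm_stereoLift] using this
    rw [h2] at h1
    exact Prod.ext (stereoLift_injective (smul_right_injective _ (Real.exp_pos _).ne' h1)) h2
  have hS : MeasurableSet {x : PhaseSpace n | x ≠ 0 ∧ g x < 1} := by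
    have h1 := hg.isOpen_inter_preimage isOpen_compl_singleton (isOpen_Iio (a := (1 : ℝ)))
    exact h1.measurableSet
  have hΦA : Φ '' A ⊆ T '' {x : PhaseSpace n | x ≠ 0 ∧ g x < 1} := by
    rintro _ ⟨⟨y, r⟩, ⟨-, -, hr⟩, rfl⟩
    refine ⟨_, ⟨smul_ne_zero (Real.exp_pos _).ne' (stereoLift_ne_zero y), ?_⟩, rfl⟩
    rw [hsmul]
    have h1 : Real.exp r ^ 2 < Real.exp (ℓ y) ^ 2 := by
      have := Real.exp_lt_exp.2 hr
      gcongr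
    rw [hexp] at h1
    have h2 := hpos _ (stereoLift_ne_zero y)
    calc Real.exp r ^ 2 * g (stereoLift n y) < (g (stereoLift n y))⁻¹ * g (stereoLift n y) := by
          gcongr
      _ = 1 := inv_mul_cancel₀ h2.ne'
  have hlow : ∀ p ∈ A, ENNReal.ofReal d * ENNReal.ofReal ((g (stereoLift n p.1))⁻¹ ^ n) ≤
      ENNReal.ofReal |(Real.exp p.2 • B p.1).det| := by
    rintro ⟨y, r⟩ ⟨hy, hr, -⟩
    rw [← ENNReal.ofReal_mul hd0.le]
    refine ENNReal.ofReal_le_ofReal ?_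
    have h1 : (Real.exp r • B y).det = Real.exp r ^ (2 * n) * (B y).det := by
      have := LinearMap.det_smul (Real.exp r) (B y : EuclideanSpace ℝ (Fin (2 * n - 1)) × ℝ →ₗ[ℝ]
        EuclideanSpace ℝ (Fin (2 * n - 1)) × ℝ)
      rwa [hdim] at this
    have h2 : c ≤ |(B y).det| := hy₀ (by
      rw [hemisphereDomain_eq] at hy
      exact ball_subset_closedBall hy)
    have h3 : Real.exp (-1) * Real.exp (ℓ y) ≤ Real.exp r := by
      rw [← Real.exp_add]
      exact Real.exp_le_exp.2 (by simp only at hr; linarith)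
    simp only
    rw [h1, abs_mul, abs_of_nonneg (by positivity), ← hexp, hd, ← pow_mul]
    calc Real.exp (-1) ^ (2 * n) * c * Real.exp (ℓ y) ^ (2 * n) =
          (Real.exp (-1) * Real.exp (ℓ y)) ^ (2 * n) * c := by rw [mul_pow]; ring
      _ ≤ Real.exp r ^ (2 * n) * |(B y).det| := by gcongr
  have hint : ∫⁻ p in A, ENNReal.ofReal d * ENNReal.ofReal ((g (stereoLift n p.1))⁻¹ ^ n) =
      ENNReal.ofReal d *
        ∫⁻ y in hemisphereDomain n, ENNReal.ofReal ((g (stereoLift n y))⁻¹ ^ n) := by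
    have hm : Measurable fun y => ENNReal.ofReal ((g (stereoLift n y))⁻¹ ^ n) :=
      ((hgs.inv₀ fun y => (hpos _ (stereoLift_ne_zero y)).ne').pow n).measurable.ennreal_ofReal
    have hm' : Measurable fun p : EuclideanSpace ℝ (Fin (2 * n - 1)) × ℝ =>
      ENNReal.ofReal ((g (stereoLift n p.1))⁻¹ ^ n) := hm.comp measurable_fst
    rw [lintegral_const_mul _ hm', ← lintegral_indicator hAm, Measure.volume_eq_prod,
      lintegral_prod _ (hm'.indicator hAm).aemeasurable, ← lintegral_indicator hdom]
    congr 1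
    refine lintegral_congr fun y => ?_
    by_cases hy : y ∈ hemisphereDomain n
    · have h1 : (fun r => A.indicator (fun p : EuclideanSpace ℝ (Fin (2 * n - 1)) × ℝ =>
          ENNReal.ofReal ((g (stereoLift n p.1))⁻¹ ^ n)) (y, r)) =
          (Ioo (ℓ y - 1) (ℓ y)).indicator
            fun _ => ENNReal.ofReal ((g (stereoLift n y))⁻¹ ^ n) := funext fun r => by
        by_cases hr : r ∈ Ioo (ℓ y - 1) (ℓ y)
        · rw [indicator_of_mem hr, indicator_of_mem (show (y, r) ∈ A from ⟨hy, hr⟩)]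
        · rw [indicator_of_notMem hr, indicator_of_notMem fun h : (y, r) ∈ A => hr h.2]
      rw [h1, lintegral_indicator measurableSet_Ioo, indicator_of_mem hy]
      simp
    · rw [indicator_of_notMem hy]
      have h1 : ∀ r, A.indicator (fun p : EuclideanSpace ℝ (Fin (2 * n - 1)) × ℝ =>
          ENNReal.ofReal ((g (stereoLift n p.1))⁻¹ ^ n)) (y, r) = 0 := fun r =>
        indicator_of_notMem (fun h : (y, r) ∈ A => hy h.1) _
      simp only [h1, lintegral_zero]
  have key : ENNReal.ofReal d *
      ∫⁻ y in hemisphereDomain n, ENNReal.ofReal ((g (stereoLift n y))⁻¹ ^ n) ≤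
      κ * volume {x : PhaseSpace n | x ≠ 0 ∧ g x < 1} := by
    rw [← hint, ← hTS _ hS]
    refine (setLIntegral_mono' hAm hlow).trans ?_
    rw [lintegral_abs_det_fderiv_eq_addHaar_image volume hAm
      (fun p _ => (hΦd p).hasFDerivWithinAt) hΦi.injOn]
    exact measure_mono hΦA
  rw [mul_assoc]
  rw [← ENNReal.mul_le_iff_le_inv (by simpa using hd0) ENNReal.ofReal_ne_top]
  exact key

end ConeVolume

/-! ### Uniform bounds on contact volumes and growth of V -/

section VolumeBound

open MeasureTheory

variable {n : ℕ}

/-- Positive homogeneous functions of degree two have sublevel sets of finite volume. -/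
lemma volume_sublevel_lt_top {g : PhaseSpace n → ℝ} (hg : ContinuousOn g {0}ᶜ)
    (hpos : ∀ x, x ≠ 0 → 0 < g x) (hsmul : ∀ (c : ℝ) x, g (c • x) = c ^ 2 * g x) :
    volume {x : PhaseSpace n | x ≠ 0 ∧ g x < 1} < ⊤ := by
  -- The sphere is empty for n = 0, which is not excluded here.
  rcases (sphere (0 : PhaseSpace n) 1).eq_empty_or_nonempty with he | hne
  · refine (measure_mono (t := {0}) fun x hx => ?_).trans_lt isCompact_singleton.measure_lt_top
    exact absurd (show ‖x‖⁻¹ • x ∈ sphere (0 : PhaseSpace n) 1 by simp [norm_smul, hx.1])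
      (by rw [he]; simp)
  obtain ⟨x₀, hx₀, hmin⟩ := (isCompact_sphere (0 : PhaseSpace n) 1).exists_isMinOn hne
    (hg.mono fun x hx => ne_zero_of_mem_unit_sphere ⟨x, hx⟩)
  have hδ := hpos x₀ (ne_zero_of_mem_unit_sphere ⟨x₀, hx₀⟩)
  refine (measure_mono (t := closedBall 0 (Real.sqrt (g x₀)⁻¹)) ?_).trans_lt
    measure_closedBall_lt_top
  rintro x ⟨hx0, hx1⟩
  have hx : 0 < ‖x‖ := norm_pos_iff.2 hx0
  have h1 : g x₀ ≤ g (‖x‖⁻¹ • x) := hmin (by simp [norm_smul, hx0])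
  rw [hsmul] at h1
  rw [mem_closedBall_zero_iff]
  refine Real.le_sqrt_of_sq_le ?_
  rw [le_inv_comm₀ (by positivity) hδ, ← inv_pow]
  refine h1.trans ?_
  exact mul_le_of_le_one_right (by positivity) hx1.le

/-- The left set is the image of the right one under f, which preserves volume. -/
lemma HomSymp.volume_sublevel (f : HomSymp n) {g : PhaseSpace n → ℝ} (hg : ContinuousOn g {0}ᶜ) :
    volume {x : PhaseSpace n | x ≠ 0 ∧ g (f⁻¹ x) < 1} = volume {x : PhaseSpace n | x ≠ 0 ∧ g x < 1} := by
  have hS : MeasurableSet {x : PhaseSpace n | x ≠ 0 ∧ g x < 1} :=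
    (hg.isOpen_inter_preimage isOpen_compl_singleton (isOpen_Iio (a := (1 : ℝ)))).measurableSet
  rw [← f.volume_image hS fun h => h.1 rfl]
  congr 1
  ext x
  constructor
  · rintro ⟨h0, h1⟩
    exact ⟨f⁻¹ x, ⟨HomSymp.map_ne_zero f⁻¹ h0, h1⟩, f.apply_inv_self x⟩
  · rintro ⟨z, ⟨h0, h1⟩, rfl⟩
    exact ⟨f.map_ne_zero h0, by rwa [f.inv_apply_self]⟩

variable [NeZero n]

local notation "𝓜" => 𝓡 (2 * n - 1)

/-- The volume of a conformal multiple of the standard contact form. -/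
lemma contactVolume_inv_smul {h : RP n → ℝ} {g : PhaseSpace n → ℝ} (hg : ContDiffOn ℝ ∞ g {0}ᶜ)
    (hpos : ∀ x, x ≠ 0 → 0 < g x) {c : ℝ} (hc : c ≠ 0)
    (hh : ∀ x : USphere n, h (RP.mk x) = c * g x) :
    contactVolume (fun q => (h q)⁻¹ • stdForm q) =
      |c|⁻¹ ^ n * ∫ y in hemisphereDomain n, (g (stereoLift n y))⁻¹ ^ n * |stereoDensity n y| := by
  have h1 : (fun y => ContinuousLinearMap.comp
      ((h (stereoParam n y))⁻¹ • stdForm (stereoParam n y) :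
        EuclideanSpace ℝ (Fin (2 * n - 1)) →L[ℝ] ℝ) (mfderiv 𝓜 𝓜 (stereoParam n) y)) =
      fun y => (c * g (stereoLift n y))⁻¹ • pullLiouville (stereoLift n) y := funext fun y => by
    have hy : h (stereoParam n y) = c * g (stereoLift n y) := hh _
    ext1 v
    have h2 := congrArg (fun B : EuclideanSpace ℝ (Fin (2 * n - 1)) →L[ℝ] ℝ => B v)
      (stdForm_comp_mfderiv_stereoParam y)
    rw [← hy]
    exact congrArg ((h (stereoParam n y))⁻¹ * ·) h2
  have hgs : Differentiable ℝ fun y => (c * g (stereoLift n y))⁻¹ := fun y => by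
    have h2 : DifferentiableAt ℝ g (stereoLift n y) :=
      (hg.contDiffAt (isOpen_compl_singleton.mem_nhds (stereoLift_ne_zero y))).differentiableAt
        (by simp)
    exact ((h2.comp y (contDiff_stereoLift.differentiable (by simp) y)).const_mul c).inv
      (mul_ne_zero hc (hpos _ (stereoLift_ne_zero y)).ne')
  unfold contactVolume
  rw [← integral_const_mul]
  refine integral_congr_ae (Filter.Eventually.of_forall fun y => ?_)
  refine (congrArg (fun η => |wedgeDensity n η y|) h1).trans ?_
  rw [wedgeDensity_smul n ((contDiffAt_pullLiouville
    contDiff_stereoLift.contDiffAt).differentiableAt (by simp)) (hgs y), abs_mul, abs_pow, abs_inv,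
    abs_mul, abs_of_pos (hpos _ (stereoLift_ne_zero y)), mul_inv, mul_pow, mul_assoc]
  rfl

lemma integrableOn_hemisphere {F : EuclideanSpace ℝ (Fin (2 * n - 1)) → ℝ} (hF : Continuous F) :
    IntegrableOn F (hemisphereDomain n) := by
  rw [hemisphereDomain_eq]
  exact (hF.continuousOn.integrableOn_compact (isCompact_closedBall _ _)).mono_set
    ball_subset_closedBall

/-- The integral of the contact volume density of a homogeneous function composed with a homogeneous
symplectic map is bounded, uniformly in the map. -/
lemma exists_integral_stereoDensity_le {g : PhaseSpace n → ℝ} (hg : ContinuousOn g {0}ᶜ)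
    (hpos : ∀ x, x ≠ 0 → 0 < g x) (hsmul : ∀ (c : ℝ) x, g (c • x) = c ^ 2 * g x) :
    ∃ C : ℝ, ∀ f : HomSymp n,
      0 < (∫ y in hemisphereDomain n, (g (f⁻¹ (stereoLift n y)))⁻¹ ^ n * |stereoDensity n y|) ∧
      ∫ y in hemisphereDomain n, (g (f⁻¹ (stereoLift n y)))⁻¹ ^ n * |stereoDensity n y| ≤ C := by
  obtain ⟨C, hC, hCg⟩ := exists_lintegral_hemisphere_le n
  obtain ⟨D, hD⟩ := (isCompact_closedBall (0 : EuclideanSpace ℝ (Fin (2 * n - 1))) 2).exists_bound_of_continuousOn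
    (continuous_stereoDensity (n := n)).continuousOn
  have hD0 : 0 ≤ D := (norm_nonneg _).trans (hD 0 (by simp))
  have hfin : C * volume {x : PhaseSpace n | x ≠ 0 ∧ g x < 1} ≠ ⊤ :=
    ENNReal.mul_ne_top hC (volume_sublevel_lt_top hg hpos hsmul).ne
  refine ⟨(C * volume {x : PhaseSpace n | x ≠ 0 ∧ g x < 1}).toReal * D, fun f => ?_⟩
  have hfc : ContinuousOn (fun x => g (f⁻¹ x)) {0}ᶜ :=
    hg.comp (HomSymp.contDiffOn f⁻¹).continuousOn fun x hx => HomSymp.map_ne_zero f⁻¹ hx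
  have hpos' : ∀ x, x ≠ 0 → 0 < g (f⁻¹ x) := fun x hx => hpos _ (HomSymp.map_ne_zero f⁻¹ hx)
  have hcont : Continuous fun y => (g (f⁻¹ (stereoLift n y)))⁻¹ ^ n :=
    ((hfc.comp_continuous contDiff_stereoLift.continuous stereoLift_ne_zero).inv₀
      fun y => (hpos' _ (stereoLift_ne_zero y)).ne').pow n
  have hnn : ∀ y, 0 < (g (f⁻¹ (stereoLift n y)))⁻¹ ^ n := fun y =>
    pow_pos (inv_pos.2 (hpos' _ (stereoLift_ne_zero y))) n
  have hcw := hcont.mul (continuous_stereoDensity (n := n)).abs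
  constructor
  · rw [setIntegral_pos_iff_support_of_nonneg_ae
      (Filter.Eventually.of_forall fun y => mul_nonneg (hnn y).le (abs_nonneg _))
      (integrableOn_hemisphere hcw)]
    -- The integrand is non-zero at y = 0, hence on a neighbourhood inside the ball.
    refine IsOpen.measure_pos _ (hcw.isOpen_support.inter ?_) ⟨0, ?_, ?_⟩
    · rw [hemisphereDomain_eq]; exact isOpen_ball
    · exact mul_ne_zero (hnn 0).ne' (abs_ne_zero.2 stereoDensity_zero_ne_zero)
    · rw [hemisphereDomain_eq]; simp
  · have h1 : ∫ y in hemisphereDomain n, (g (f⁻¹ (stereoLift n y)))⁻¹ ^ n * |stereoDensity n y| ≤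
        ∫ y in hemisphereDomain n, (g (f⁻¹ (stereoLift n y)))⁻¹ ^ n * D := by
      refine setIntegral_mono_on (integrableOn_hemisphere hcw)
        (integrableOn_hemisphere (hcont.mul continuous_const)) ?_ fun y hy => ?_
      · rw [hemisphereDomain_eq]; exact measurableSet_ball
      · rw [hemisphereDomain_eq] at hy
        exact mul_le_mul_of_nonneg_left (hD y (ball_subset_closedBall hy)) (hnn y).le
    refine h1.trans ?_
    rw [integral_mul_const]
    refine mul_le_mul_of_nonneg_right ?_ hD0
    rw [integral_eq_lintegral_of_nonneg_ae (Filter.Eventually.of_forall fun y => (hnn y).le)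
      hcont.aestronglyMeasurable]
    refine ENNReal.toReal_mono hfin ?_
    -- Volume preservation replaces the sublevel set of g by that of g ∘ f⁻¹; this is what makes C
    -- uniform in f.
    rw [← f.volume_sublevel hg]
    refine hCg (fun x => g (f⁻¹ x)) hfc hpos' fun c x => ?_
    rw [HomSymp.map_smul, hsmul]

/-- The Lorentz–Finsler length of the generators of the twin isotopies grows linearly. -/
theorem exists_le_lorentzFinsler_twinIsotopy {H : PhaseSpace n → ℝ} (hH : IsHomHam H) {θ : ℝ}
    (hpos : ∀ x, x ≠ 0 → 0 < H x + H ((rot θ)⁻¹ x)) :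
    ∃ v : ℝ, 0 < v ∧ ∀ N : ℕ, ∀ t ∈ Icc (0 : ℝ) 1,
      v * N ≤ lorentzFinsler ((twinIsotopy hH θ N).generator t) := by
  set G : PhaseSpace n → ℝ := fun x => H x + H ((rot θ)⁻¹ x) with hG
  have hGs : ContDiffOn ℝ ∞ G {0}ᶜ := hH.contDiffOn.add
    (hH.contDiffOn.comp (HomSymp.contDiffOn (rot θ)⁻¹) fun x hx => HomSymp.map_ne_zero (rot θ)⁻¹ hx)
  have hsmul : ∀ (c : ℝ) x, G (c • x) = c ^ 2 * G x := fun c x => by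
    simp only [hG]
    rw [HomSymp.map_smul, hH.map_smul, hH.map_smul]
    ring
  obtain ⟨C, hC⟩ := exists_integral_stereoDensity_le hGs.continuousOn hpos hsmul
  have hC0 : 0 < C := (hC 1).1.trans_le (hC 1).2
  have hn : (0 : ℝ) < n := Nat.cast_pos.2 (NeZero.pos n)
  -- The contact volume at time t is at most N⁻ⁿ C, and (N⁻ⁿ C)^(-1/n) = N C^(-1/n).
  refine ⟨C ^ (-(1 / (n : ℝ))), Real.rpow_pos_of_pos hC0 _, fun N t ht => ?_⟩
  -- For N = 0 the isotopy is constant and only V ≥ 0 is needed.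
  rcases Nat.eq_zero_or_pos N with rfl | hN
  · rw [Nat.cast_zero, mul_zero, lorentzFinsler]
    split_ifs
    · exact Real.rpow_nonneg (integral_nonneg fun y => abs_nonneg _) _
    · exact le_rfl
  have hN' : (0 : ℝ) < N := Nat.cast_pos.2 hN
  set f := hH.flow (N * t) with hf
  have hfs : ContDiffOn ℝ ∞ (fun x => G (f⁻¹ x)) {0}ᶜ :=
    hGs.comp (HomSymp.contDiffOn f⁻¹) fun x hx => HomSymp.map_ne_zero f⁻¹ hx
  have h1 := contactVolume_inv_smul (h := (twinIsotopy hH θ N).ham t) hfs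
    (fun x hx => hpos _ (HomSymp.map_ne_zero f⁻¹ hx)) hN'.ne' (ham_twinIsotopy_mk hH θ N ht)
  rw [lorentzFinsler, if_pos (show IsPositiveField _ _ from ham_twinIsotopy_pos hH hpos hN' ht)]
  change _ ≤ contactVolume (fun q => ((twinIsotopy hH θ N).ham t q)⁻¹ • stdForm q) ^ _
  rw [h1, abs_of_pos hN']
  have h2 : C ^ (-(1 / (n : ℝ))) * N = ((N : ℝ)⁻¹ ^ n * C) ^ (-(1 / (n : ℝ))) := by
    rw [Real.mul_rpow (by positivity) hC0.le, ← Real.rpow_natCast, ← Real.rpow_mul (by positivity),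
      mul_comm]
    congr 1
    rw [show (n : ℝ) * -(1 / (n : ℝ)) = -1 by field_simp, Real.rpow_neg_one, inv_inv]
  rw [h2]
  refine Real.rpow_le_rpow_of_nonpos (mul_pos (by positivity) (hC f).1) ?_
    (by rw [neg_nonpos]; positivity)
  exact mul_le_mul_of_nonneg_left (hC f).2 (by positivity)

end VolumeBound

end

theorem mainTheorem2 (n : ℕ) [NeZero n] :
    (∀ d : ContRPCover n → ContRPCover n → ℝ≥0∞,
      (∀ a b, 0 < d a b ↔ UniversalCover.StrictlyPrecedes a b) →
      (∀ a b c, UniversalCover.Precedes a b → UniversalCover.Precedes b c →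
        d a b + d b c ≤ d a c) →
      UniversalCover.IsBiInvariant d →
      ∀ a b, (UniversalCover.StrictlyPrecedes a b → d a b = ⊤) ∧
        (¬ UniversalCover.StrictlyPrecedes a b → d a b = 0)) ∧
    ∀ a b : ContRPCover n,
      (UniversalCover.StrictlyPrecedes a b → lorentzDist a b = ⊤) ∧
      (¬ UniversalCover.StrictlyPrecedes a b → lorentzDist a b = 0) := by
  refine ⟨fun d h1 h2 h3 a b => ⟨eq_top_of_strictlyPrecedes h1 h2 h3, fun h => ?_⟩,
    fun a b => ⟨fun h => lorentzDist_eq_top h fun H hH θ hpos => ?_, lorentzDist_eq_zero⟩⟩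
  · exact not_lt.1 (fun h0 => h ((h1 a b).1 h0)) |>.antisymm bot_le
  · exact exists_le_lorentzFinsler_twinIsotopy hH hpos
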